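/- **Notation.** Let $k\ge 1$ be an integer and fix a smooth cut-off $\zeta:[0,\infty)\to[0,1]$ with $\zeta=1$ on $[0,\frac18]$ and $\zeta=0$ on $[\frac14,\infty)$. For $\varepsilon>0$ and $\lambda\in\mathbb C$ put $\mu=\min\{|\lambda|,\frac1\varepsilon\}$. For $f:(0,\infty)\to\mathbb R$ let $\hat f(\lambda)=\int_0^\infty x^{-\lambda}f(x)\frac{dx}{x}$ be the Mellin transform (understood on a line $\operatorname{Re}\lambda=\beta$ in the $L^2$ sense of Plancherel), and $$[f]_\ell=\big\|\,|\lambda|^{3\ell+1}\mu^{\ell}\hat f\,\big\|_{L^2(\operatorname{Re}\lambda=3\ell-\frac12)},\qquad \ell\in\mathbb N_0 .$$ The space $X^k_\varepsilon$ consists of all $f$ for which there is a (necessarily unique) polynomial $P_f$ of degree at most $3k-1$ (the Taylor polynomial of $f$ at $0$) such that, with $f_0=f-\zeta P_f$, $$\|f\|_{X^k_\varepsilon}=\|P_f\|+\|f_0\|_{L^2(0,\infty)}+\sum_{\ell=0}^k[f_0]_\ell<\infty ;$$ norms of polynomials are $\ell^2$-norms of the coefficients. Let $K=\{x>0,\ 0<y<x\}$,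 $\Gamma=\{x>0,\ y=x\}$, and for a given function $\phi$ on $(0,\infty)$ let $K^\phi=\{x>0,\ 0<y<x+\int_0^x\phi\}$. A function $q$ is called $\varepsilon$-harmonic if it is smooth and $q_{xx}+\varepsilon^{-2}q_{yy}=0$. Use the coordinates $x=e^u\cos(\varepsilon v)$, $y=\frac1\varepsilon e^u\sin(\varepsilon v)$, in which $K$ is the strip $u\in\mathbb R$, $0<v<\omega:=\frac1\varepsilon\arctan\varepsilon$, and put $r=e^u=\sqrt{x^2+\varepsilon^2y^2}$. For a function $q$ on $K$ let $\hat q(\lambda,v)=\int_{\mathbb R}e^{-\lambda u}q(u,v)\,du$ (on lines in the $L^2$ sense), and $\Lambda^\alpha=\lambda^{\alpha_1}(\frac1\varepsilon\partial_v)^{\alpha_2}$, $|\alpha|=\alpha_1+\alpha_2$, for $\alpha\in[0,\infty)\times\mathbb N_0$. **Lemma.** There are constants $C,\delta>0$ depending only on $k$ (and on the fixed $\zeta$) such that for every $\varepsilon\in\big(0,\frac{\pi}{3(2k+1)}\big)$ and every $\phi\in X^k_\varepsilon$ with $\|\phi\|_{X^k_\varepsilon}\le\delta$ there is a function $\psi:K\to\mathbb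 R$ such that $$\Psi(x,y)=(x,\,y+\psi(x,y))$$ is a $C^\infty$-diffeomorphism of $K$ onto $K^\phi$; $\psi$ has the boundary values $\psi(x,0)=0$ and $\psi(x,x)=\int_0^x\phi$ for $x>0$. There is a decomposition $\psi=\psi_0+\psi_1$, $\psi_1=\zeta(r)\,\mathcal P$, with an $\varepsilon$-harmonic function $\psi_0$ on $K$ and an $\varepsilon$-harmonic polynomial $\mathcal P$ in $(x,y)$ of degree at most $3k$, such that $$\sup_{\ell\in[0,k]}\ \sum_{|\alpha|=3\ell+2}\Big\|\sup_{0<v<\omega}\big|e^{\frac12\varepsilon|\lambda|(\omega-v)}\mu^{\ell+1}\Lambda^{\alpha}\,\widehat{\varepsilon\psi_0}\big|\Big\|_{L^2(\operatorname{Re}\lambda=3\ell+\frac12)}+\|\mathcal P\|\ \le\ C\|\phi\|_{X^k_\varepsilon},$$ where $\ell$ is real. Moreover $\psi_x$ and $\psi_y$ have traces on $\Gamma$ (as functions of $x>0$), and $$\|\varepsilon\,\psi_{x|\Gamma}\|_{X^k_\varepsilon}+\|\psi_{y|\Gamma}\|_{X^k_\varepsilon}\ \le\ C\|\phi\|_{X^k_\varepsilon}.$$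 -/

import Mathlib

open MeasureTheory Set Filter Topology
open scoped ENNReal FourierTransform

noncomputable section

namespace Wedge

/-- A smooth cut-off function on `[0, ∞)` which is `1` on `[0, 1/8]`, vanishes on `[1/4, ∞)` and has
values in `[0, 1]` (its values at negative arguments are never used). -/
structure IsCutoff (ζ : ℝ → ℝ) : Prop where
  smooth : ContDiff ℝ ((⊤ : ℕ∞) : WithTop ℕ∞) ζ
  eq_one : ∀ r ∈ Icc (0 : ℝ) (1 / 8), ζ r = 1
  eq_zero : ∀ r, 1 / 4 ≤ r → ζ r = 0
  mem_Icc : ∀ r, 0 ≤ r → ζ r ∈ Icc (0 : ℝ) 1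

/-- The `ℓ²`-norm of the coefficients of a polynomial in one variable. -/
def polyNorm (P : Polynomial ℝ) : ℝ := √(∑ i ∈ P.support, P.coeff i ^ 2)

/-- The `ℓ²`-norm of the coefficients of a polynomial in two variables. -/
def polyNorm₂ (P : MvPolynomial (Fin 2) ℝ) : ℝ := √(∑ m ∈ P.support, P.coeff m ^ 2)

/-- The line `Re λ = β` is parametrized by `λ = β + 2 π i ξ` with `ξ` real. -/
def line (β ξ : ℝ) : ℂ := (β : ℂ) + 2 * Real.pi * ξ * Complex.I

/-- `G` is the two-sided Laplace transform `∫ e^{-λ u} F(u) du` of `F` on the line `Re λ = β`,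
in the `L²`-sense (that of Plancherel): `e^{-β u} F(u)` is square integrable and
`G(ξ) = ∫ e^{-2 π i ξ u} e^{-β u} F(u) du` is its Fourier transform. -/
def IsLaplaceOnLine (β : ℝ) (F : ℝ → ℝ) (G : ℝ → ℂ) : Prop :=
  ∃ h : MemLp (fun u : ℝ => ((Real.exp (-(β * u)) * F u : ℝ) : ℂ)) 2 volume,
    G =ᵐ[volume] ((𝓕 (h.toLp _) : Lp ℂ 2 (volume : Measure ℝ)) : ℝ → ℂ)

/-- The frequency `μ = min {|λ|, 1/ε}`. -/
def mu (ε : ℝ) (z : ℂ) : ℝ := min ‖z‖ (1 / ε)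

/-- The homogeneous norm `[f]_ℓ`: the `L²`-norm on `Re λ = 3ℓ - 1/2` of `|λ|^{3ℓ+1} μ^ℓ f̂(λ)`,
where `f̂` is the Mellin transform of `f : (0, ∞) → ℝ`, i.e. the Laplace transform of `f(e^u)`.
The transform is unique up to null sets; the value is `∞` if there is none. -/
def xHom (ε : ℝ) (ℓ : ℕ) (f : ℝ → ℝ) : ℝ≥0∞ :=
  ⨅ (G : ℝ → ℂ) (_ : IsLaplaceOnLine (3 * ℓ - 1 / 2) (fun u => f (Real.exp u)) G),
    eLpNorm (fun ξ => ‖line (3 * ℓ - 1 / 2) ξ‖ ^ (3 * ℓ + 1)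
      * mu ε (line (3 * ℓ - 1 / 2) ξ) ^ ℓ * ‖G ξ‖) 2 volume

/-- The norm of `X^k_ε` on `(0, ∞)`: the norm of the Taylor polynomial `P` of order `3k - 1` of `f`
at `x = 0`, plus the norms of the remainder `f₀ = f - ζ P`.  At most one `P` of degree less than
`3k` makes `[f - ζ P]_k` finite (that norm bounds the `L²`-norm of `x^{-3k} (f - ζ P)`), and it is
the Taylor polynomial if `f` is smooth up to `x = 0`; hence the infimum only selects `P`.
A function belongs to `X^k_ε` when the value is finite. -/
def xNorm (ε : ℝ) (ζ : ℝ → ℝ) (k : ℕ) (f : ℝ → ℝ) : ℝ≥0∞ :=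
  ⨅ (P : Polynomial ℝ) (_ : P.degree < (3 * k : ℕ)),
    ENNReal.ofReal (polyNorm P)
      + eLpNorm (fun x => f x - ζ x * P.eval x) 2 (volume.restrict (Ioi 0))
      + ∑ ℓ ∈ Finset.range (k + 1), xHom ε ℓ (fun x => f x - ζ x * P.eval x)

/-- The perturbed profile `h(x) = x + ∫₀ˣ φ`, so that `h' = 1 + φ` and `h(0) = 0`. -/
def profile (φ : ℝ → ℝ) (x : ℝ) : ℝ := x + ∫ s in (0 : ℝ)..x, φ s

/-- The perturbed wedge `K^φ`. -/
def wedgeOf (φ : ℝ → ℝ) : Set (ℝ × ℝ) := {z | 0 < z.1 ∧ 0 < z.2 ∧ z.2 < profile φ z.1}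

/-- The wedge `K = {x > 0, 0 < y < x}`. -/
def wedge : Set (ℝ × ℝ) := {z | 0 < z.1 ∧ 0 < z.2 ∧ z.2 < z.1}

/-- The radius `r` in `(x, ε y) = r (cos θ, sin θ)`. -/
def radius (ε : ℝ) (z : ℝ × ℝ) : ℝ := √(z.1 ^ 2 + ε ^ 2 * z.2 ^ 2)

/-- The coordinates `x = e^u cos (ε v)`, `y = ε⁻¹ e^u sin (ε v)`. -/
def polar (ε u v : ℝ) : ℝ × ℝ :=
  (Real.exp u * Real.cos (ε * v), 1 / ε * (Real.exp u * Real.sin (ε * v)))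

/-- The value of `v` on the upper edge `y = x` of the wedge: `tan (ε v) = ε`. -/
def vTop (ε : ℝ) : ℝ := Real.arctan ε / ε

/-- In the coordinates `(u, v)` the wedge is the strip `0 < v < vTop ε`. -/
theorem polar_mem_wedge {ε u v : ℝ} (hε : 0 < ε) (hv : v ∈ Ioo 0 (vTop ε)) :
    polar ε u v ∈ wedge := by
  obtain ⟨h0, h1⟩ := hv
  have ht : ε * v < Real.arctan ε := by
    rw [vTop, lt_div_iff₀ hε] at h1
    linarith
  have hp : 0 < ε * v := mul_pos hε h0
  have hl : ε * v < Real.pi / 2 := ht.trans (Real.arctan_lt_pi_div_two ε)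
  have hc : 0 < Real.cos (ε * v) := Real.cos_pos_of_mem_Ioo ⟨by linarith, hl⟩
  have hs : 0 < Real.sin (ε * v) := Real.sin_pos_of_pos_of_lt_pi hp (by linarith [Real.pi_pos])
  have htan : Real.tan (ε * v) < ε := by
    have h := Real.tan_lt_tan_of_lt_of_lt_pi_div_two (by linarith)
      (Real.arctan_lt_pi_div_two ε) ht
    rwa [Real.tan_arctan] at h
  rw [Real.tan_eq_sin_div_cos, div_lt_iff₀ hc] at htan
  refine ⟨mul_pos (Real.exp_pos u) hc,
    mul_pos (by positivity) (mul_pos (Real.exp_pos u) hs), ?_⟩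
  show 1 / ε * (Real.exp u * Real.sin (ε * v)) < Real.exp u * Real.cos (ε * v)
  rw [one_div, inv_mul_lt_iff₀ hε]
  nlinarith [Real.exp_pos u]

/-- `G(ξ, v)` is the Laplace transform in `u` of `q(u, v)` on the line `Re λ = β` for every `v` in
the strip, in the version which is smooth in `v` (unique for almost every `ξ`). -/
def IsStripLaplace (ε β : ℝ) (q : ℝ → ℝ → ℝ) (G : ℝ → ℝ → ℂ) : Prop :=
  (∀ v ∈ Ioo 0 (vTop ε), IsLaplaceOnLine β (fun u => q u v) (fun ξ => G ξ v)) ∧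
  ∀ ξ, ContDiffOn ℝ ((⊤ : ℕ∞) : WithTop ℕ∞) (G ξ) (Ioo 0 (vTop ε))

/-- The sum over all `α = (α₁, α₂)` with `α₂ ∈ ℕ`, `α₁ ≥ 0` real and `α₁ + α₂ = s` of the
`L²`-norms on the line `Re λ = β` of
`sup_v e^{ε |λ| (vTop - v) / 2} μ^m |λ^{α₁} (ε⁻¹ ∂_v)^{α₂} q̂(λ, v)|`. -/
def stripNorm (ε β s m : ℝ) (q : ℝ → ℝ → ℝ) : ℝ≥0∞ :=
  ⨅ (G : ℝ → ℝ → ℂ) (_ : IsStripLaplace ε β q G),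
    ∑ j ∈ Finset.range (⌊s⌋₊ + 1),
      (∫⁻ ξ : ℝ, (⨆ v ∈ Ioo 0 (vTop ε),
        ENNReal.ofReal (Real.exp (1 / 2 * ε * ‖line β ξ‖ * (vTop ε - v))
          * mu ε (line β ξ) ^ m * ‖line β ξ‖ ^ (s - j)
          * ((1 / ε) ^ j * ‖iteratedDeriv j (G ξ) v‖))) ^ 2) ^ (1 / 2 : ℝ)

/-- `q` is smooth on the open set `U` and `∂_x² q + ε⁻² ∂_y² q = 0` there. -/
def IsEpsHarmonicOn (ε : ℝ) (q : ℝ × ℝ → ℝ) (U : Set (ℝ × ℝ)) : Prop :=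
  ContDiffOn ℝ ((⊤ : ℕ∞) : WithTop ℕ∞) q U ∧
  ∀ z ∈ U, iteratedDeriv 2 (fun x => q (x, z.2)) z.1
    + (1 / ε) ^ 2 * iteratedDeriv 2 (fun y => q (z.1, y)) z.2 = 0

/-- `Ψ` restricts to a smooth diffeomorphism from the open set `U` onto the open set `V`. -/
def IsDiffeoOn (Ψ : ℝ × ℝ → ℝ × ℝ) (U V : Set (ℝ × ℝ)) : Prop :=
  IsOpen U ∧ IsOpen V ∧ ContDiffOn ℝ ((⊤ : ℕ∞) : WithTop ℕ∞) Ψ U ∧ MapsTo Ψ U V ∧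
  ∃ Ξ : ℝ × ℝ → ℝ × ℝ, ContDiffOn ℝ ((⊤ : ℕ∞) : WithTop ℕ∞) Ξ V ∧ MapsTo Ξ V U ∧
    LeftInvOn Ξ Ψ U ∧ RightInvOn Ξ Ψ V

/-- `g` is the trace of `q` on the upper edge `y = x`, `x > 0`, of the wedge. -/
def IsUpperTrace (q : ℝ × ℝ → ℝ) (g : ℝ → ℝ) : Prop :=
  ∀ x, 0 < x → Tendsto q (𝓝[wedge] (x, x)) (𝓝 (g x))

/-- `g` is the trace of `q` on the lower edge `y = 0`, `x > 0`, of the wedge. -/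
def IsLowerTrace (q : ℝ × ℝ → ℝ) (g : ℝ → ℝ) : Prop :=
  ∀ x, 0 < x → Tendsto q (𝓝[wedge] (x, 0)) (𝓝 (g x))

end Wedge

end

noncomputable section

namespace Wedge

/-! ### The Fourier transform in L² and absolutely convergent integrals. -/

/-- Smooth compactly supported functions are Schwartz functions. This turns identities of tempered
distributions into identities almost everywhere. -/
theorem integral_schwartz_smul_eq {f f' : ℝ → ℂ} (hf : LocallyIntegrable f)
    (hf' : LocallyIntegrable f')
    (h : ∀ g : SchwartzMap ℝ ℂ, ∫ x, g x • f x = ∫ x, g x • f' x) : f =ᵐ[volume] f' := by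
  refine ae_eq_of_integral_contDiff_smul_eq hf hf' fun g hg hc => ?_
  have hg₁ : HasCompactSupport (Complex.ofRealCLM ∘ g) := hc.comp_left rfl
  have hg₂ : ContDiff ℝ ((⊤ : ℕ∞) : WithTop ℕ∞) (Complex.ofRealCLM ∘ g) :=
    Complex.ofRealCLM.contDiff.comp hg
  have := h (hg₁.toSchwartzMap hg₂)
  simpa using this

theorem integral_fourier_smul_comm {f g : ℝ → ℂ} (hf : Integrable f) (hg : Integrable g) :
    ∫ ξ, 𝓕 f ξ • g ξ = ∫ x, f x • 𝓕 g x := by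
  have := VectorFourier.integral_fourierIntegral_smul_eq_flip (L := innerₗ ℝ) (f := f) (g := g)
    (μ := volume) (ν := volume)
    Real.continuous_fourierChar continuous_inner hf hg
  rw [flip_innerₗ] at this
  exact this

theorem locallyIntegrable_fourier {f : ℝ → ℂ} (hf : Integrable f) :
    LocallyIntegrable (𝓕 f) :=
  (VectorFourier.fourierIntegral_continuous Real.continuous_fourierChar continuous_inner
    hf).locallyIntegrable

/-- Paired with a Schwartz function g, both sides equal the pairing of f with the transform of g:
the left by the definition of the distributional transform, the right by Fubini. -/
theorem fourier_toLp_ae_eq {f : ℝ → ℂ} (h1 : Integrable f) (h2 : MemLp f 2) :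
    ((𝓕 (h2.toLp f) : Lp ℂ 2 (volume : Measure ℝ)) : ℝ → ℂ) =ᵐ[volume] 𝓕 f := by
  refine integral_schwartz_smul_eq ((Lp.memLp _).locallyIntegrable (by norm_num))
    (locallyIntegrable_fourier h1) fun g => ?_
  have h := congrArg (fun T => T g) (Lp.fourier_toTemperedDistribution_eq (h2.toLp f))
  simp only [TemperedDistribution.fourier_apply, Lp.toTemperedDistribution_apply] at h
  rw [← h]
  have e := integral_fourier_smul_comm g.integrable h1
  rw [← e]
  refine integral_congr_ae ?_
  filter_upwards [h2.coeFn_toLp] with x hx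
  rw [hx, SchwartzMap.fourier_coe]

theorem fourierInv_toLp_ae_eq {f : ℝ → ℂ} (h1 : Integrable f) (h2 : MemLp f 2) :
    ((𝓕⁻ (h2.toLp f) : Lp ℂ 2 (volume : Measure ℝ)) : ℝ → ℂ) =ᵐ[volume] 𝓕⁻ f := by
  have hc : LocallyIntegrable (𝓕⁻ f) := by
    rw [Real.fourierInv_eq_fourier_comp_neg]
    exact locallyIntegrable_fourier h1.comp_neg
  refine integral_schwartz_smul_eq ((Lp.memLp _).locallyIntegrable (by norm_num)) hc fun g => ?_
  have h := congrArg (fun T => T g) (Lp.fourierInv_toTemperedDistribution_eq (h2.toLp f))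
  simp only [TemperedDistribution.fourierInv_apply, Lp.toTemperedDistribution_apply] at h
  rw [← h]
  have e := integral_fourier_smul_comm g.integrable h1.comp_neg
  rw [Real.fourierInv_eq_fourier_comp_neg, ← e, ← integral_neg_eq_self]
  refine integral_congr_ae ?_
  have := (Measure.measurePreserving_neg
    (volume : Measure ℝ)).quasiMeasurePreserving.ae_eq_comp h2.coeFn_toLp
  filter_upwards [this] with x hx
  simp only [Function.comp] at hx
  rw [hx, SchwartzMap.fourierInv_coe, Real.fourierInv_eq_fourier_neg, neg_neg]

/-- `G` is the Fourier transform of `f` in the sense of Plancherel. -/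
def IsL2Fourier (f G : ℝ → ℂ) : Prop :=
  ∃ h : MemLp f 2 volume,
    G =ᵐ[volume] ((𝓕 (h.toLp _) : Lp ℂ 2 (volume : Measure ℝ)) : ℝ → ℂ)

namespace IsL2Fourier

variable {f f' G G' k : ℝ → ℂ}

theorem memLp (h : IsL2Fourier f G) : MemLp f 2 := h.1

theorem memLp_transform (h : IsL2Fourier f G) : MemLp G 2 :=
  (memLp_congr_ae h.2).2 (Lp.memLp _)

theorem eLpNorm_eq (h : IsL2Fourier f G) : eLpNorm G 2 volume = eLpNorm f 2 volume := by
  obtain ⟨h1, h2⟩ := h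
  rw [eLpNorm_congr_ae h2, ← eLpNorm_congr_ae h1.coeFn_toLp]
  have h3 := Lp.norm_fourier_eq (h1.toLp f)
  rw [Lp.norm_def, Lp.norm_def] at h3
  exact (ENNReal.toReal_eq_toReal_iff' (Lp.eLpNorm_ne_top _) (Lp.eLpNorm_ne_top _)).1 h3

theorem ae_unique (h : IsL2Fourier f G) (h' : IsL2Fourier f G') : G =ᵐ[volume] G' :=
  h.2.trans h'.2.symm

theorem congr (h : IsL2Fourier f G) (hf : f =ᵐ[volume] f') (hG : G =ᵐ[volume] G') :
    IsL2Fourier f' G' := by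
  obtain ⟨h1, h2⟩ := h
  refine ⟨(memLp_congr_ae hf).1 h1, hG.symm.trans ?_⟩
  rwa [← (MemLp.toLp_eq_toLp_iff h1 ((memLp_congr_ae hf).1 h1)).2 hf]

theorem of_memLp (h : MemLp f 2) :
    IsL2Fourier f ((𝓕 (h.toLp _) : Lp ℂ 2 (volume : Measure ℝ)) : ℝ → ℂ) :=
  ⟨h, Filter.EventuallyEq.rfl⟩

theorem add (h : IsL2Fourier f G) (h' : IsL2Fourier f' G') : IsL2Fourier (f + f') (G + G') := by
  obtain ⟨h1, h2⟩ := h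
  obtain ⟨h1', h2'⟩ := h'
  refine ⟨h1.add h1', ?_⟩
  rw [MemLp.toLp_add h1 h1', FourierTransform.fourier_add]
  exact (h2.add h2').trans (Lp.coeFn_add _ _).symm

theorem const_smul (c : ℂ) (h : IsL2Fourier f G) : IsL2Fourier (c • f) (c • G) := by
  obtain ⟨h1, h2⟩ := h
  refine ⟨h1.const_smul c, ?_⟩
  rw [MemLp.toLp_const_smul c h1, FourierTransform.fourier_smul]
  exact (h2.const_smul c).trans (Lp.coeFn_smul _ _).symm

theorem of_integrable (h1 : Integrable f) (h2 : MemLp f 2) : IsL2Fourier f (𝓕 f) :=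
  ⟨h2, (fourier_toLp_ae_eq h1 h2).symm⟩

/-- Inversion takes place in L², so neither continuity of G nor integrability of its inverse
transform is needed. -/
theorem of_integrable_transform (h1 : Integrable G) (h2 : MemLp G 2) :
    IsL2Fourier (𝓕⁻ G) G := by
  have hm := fourierInv_toLp_ae_eq h1 h2
  have h3 : MemLp (𝓕⁻ G) 2 := (memLp_congr_ae hm).1 (Lp.memLp _)
  refine ⟨h3, ?_⟩
  have : h3.toLp (𝓕⁻ G) = 𝓕⁻ (h2.toLp G) := by
    rw [← Lp.toLp_coeFn (𝓕⁻ (h2.toLp G)) (Lp.memLp _)]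
    exact (MemLp.toLp_eq_toLp_iff _ _).2 hm.symm
  rw [this, FourierTransform.fourier_fourierInv_eq]
  exact h2.coeFn_toLp.symm

/-- Parseval's identity. -/
theorem integral_conj_mul (h : IsL2Fourier f G) (h' : IsL2Fourier f' G') :
    ∫ x, f' x * (starRingEnd ℂ) (f x) = ∫ x, G' x * (starRingEnd ℂ) (G x) := by
  obtain ⟨h1, h2⟩ := h
  obtain ⟨h1', h2'⟩ := h'
  have := Lp.inner_fourier_eq (h1.toLp f) (h1'.toLp f')
  rw [MeasureTheory.L2.inner_def, MeasureTheory.L2.inner_def] at this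
  trans ∫ a, inner ℂ ((h1.toLp f : Lp ℂ 2 volume) a) ((h1'.toLp f' : Lp ℂ 2 volume) a)
  · refine integral_congr_ae ?_
    filter_upwards [h1.coeFn_toLp, h1'.coeFn_toLp] with a ha hb
    rw [ha, hb]; rfl
  · rw [← this]
    refine integral_congr_ae ?_
    filter_upwards [h2, h2'] with a ha hb
    rw [ha, hb]; rfl

/-- A convolution with an integrable and square integrable kernel is an absolutely convergent
inverse Fourier integral. -/
theorem integral_kernel_mul (h : IsL2Fourier f G) (k1 : Integrable k) (k2 : MemLp k 2) (u : ℝ) :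
    ∫ s, k (u - s) * f s
      = ∫ ξ : ℝ, Complex.exp (2 * Real.pi * ξ * u * Complex.I) * (𝓕 k ξ * G ξ) := by
  -- The convolution at u is the L² pairing of f with κ, whose transform is the conjugate of
  -- e^{2πiξu} 𝓕 k; Parseval gives the claim.
  set κ : ℝ → ℂ := fun s => (starRingEnd ℂ) (k (u - s)) with hκ
  have κ1 : Integrable κ := by
    have := (k1.comp_sub_left u)
    exact (Complex.conjLIE.integrable_comp_iff).2 this
  have κ2 : MemLp κ 2 := by
    have : MemLp (fun s => k (u - s)) 2 :=
      k2.comp_measurePreserving (Measure.measurePreserving_sub_left volume u)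
    exact this.star
  have hF := integral_conj_mul (of_integrable κ1 κ2) h
  have e1 : ∀ s, k (u - s) * f s = f s * (starRingEnd ℂ) (κ s) := fun s => by
    simp [hκ, mul_comm]
  simp_rw [e1]
  rw [hF]
  congr 1 with ξ
  have : (starRingEnd ℂ) (𝓕 κ ξ) = Complex.exp (2 * Real.pi * ξ * u * Complex.I) * 𝓕 k ξ := by
    rw [Real.fourier_eq', Real.fourier_eq', ← integral_conj, ← integral_const_mul]
    rw [← integral_sub_left_eq_self _ volume u]
    congr 1 with s
    simp only [hκ, smul_eq_mul, map_mul, Complex.conj_conj, sub_sub_cancel, ← Complex.exp_conj,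
      Complex.conj_I, Complex.conj_ofReal]
    rw [← mul_assoc, ← Complex.exp_add]
    congr 2
    simp
    ring
  rw [this]
  ring

end IsL2Fourier

/-! ### Laplace transforms on vertical lines and their inverse integrals. -/

theorem isLaplaceOnLine_iff {β : ℝ} {F : ℝ → ℝ} {G : ℝ → ℂ} :
    IsLaplaceOnLine β F G ↔
      IsL2Fourier (fun u : ℝ => ((Real.exp (-(β * u)) * F u : ℝ) : ℂ)) G := Iff.rfl

@[simp] theorem line_re (β ξ : ℝ) : (line β ξ).re = β := by simp [line]

@[simp] theorem line_im (β ξ : ℝ) : (line β ξ).im = 2 * Real.pi * ξ := by simp [line]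

theorem continuous_line (β : ℝ) : Continuous (line β) := by unfold line; fun_prop

theorem memLp_two_of_bounded {f : ℝ → ℂ} {C : ℝ} (h : Integrable f) (hC : ∀ x, ‖f x‖ ≤ C) :
    MemLp f 2 := by
  rw [memLp_two_iff_integrable_sq_norm h.1]
  refine (h.norm.const_mul C).mono' (h.1.norm.pow 2) (ae_of_all _ fun x => ?_)
  rw [Real.norm_of_nonneg (by positivity), pow_two]
  exact mul_le_mul_of_nonneg_right (hC x) (norm_nonneg _)

theorem integrable_exp_neg_mul_abs {η : ℝ} (hη : 0 < η) :
    Integrable fun u : ℝ => Real.exp (-(η * |u|)) := by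
  rw [← integrableOn_univ, ← Iic_union_Ioi (a := (0 : ℝ))]
  refine IntegrableOn.union ?_ ?_
  · refine (integrableOn_exp_mul_Iic hη 0).congr_fun (fun x hx => ?_) measurableSet_Iic
    rw [abs_of_nonpos hx]; simp
  · refine (integrableOn_exp_mul_Ioi (neg_lt_zero.2 hη) 0).congr_fun (fun x hx => ?_)
      measurableSet_Ioi
    rw [abs_of_pos hx]; simp

/-- The inverse Laplace integral over the line `Re λ = β`. -/
def invL (β : ℝ) (G : ℝ → ℂ) (u : ℝ) : ℂ := ∫ ξ : ℝ, Complex.exp (line β ξ * u) * G ξ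

theorem exp_line_mul (β ξ u : ℝ) : Complex.exp (line β ξ * u)
    = (Real.exp (β * u) : ℂ) * Complex.exp (2 * Real.pi * ξ * u * Complex.I) := by
  rw [Complex.ofReal_exp, ← Complex.exp_add, line]
  congr 1
  push_cast
  ring

theorem norm_exp_line_mul (β ξ u : ℝ) : ‖Complex.exp (line β ξ * u)‖ = Real.exp (β * u) := by
  rw [Complex.norm_exp]; simp

theorem invL_eq (β : ℝ) (G : ℝ → ℂ) (u : ℝ) :
    invL β G u = (Real.exp (β * u) : ℂ) * 𝓕⁻ G u := by
  rw [invL, Real.fourierInv_eq', ← integral_const_mul]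
  congr 1 with ξ
  rw [exp_line_mul, smul_eq_mul, mul_assoc]
  congr 4
  simp
  ring

theorem norm_invL_le (β : ℝ) (G : ℝ → ℂ) (u : ℝ) :
    ‖invL β G u‖ ≤ Real.exp (β * u) * ∫ ξ, ‖G ξ‖ := by
  refine (norm_integral_le_integral_norm _).trans_eq ?_
  rw [← integral_const_mul]
  congr 1 with ξ
  rw [norm_mul, norm_exp_line_mul]

theorem isL2Fourier_invL {β : ℝ} {G : ℝ → ℂ} (h1 : Integrable G) (h2 : MemLp G 2) :
    IsL2Fourier (fun u => (Real.exp (-(β * u)) : ℂ) * invL β G u) G := by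
  have : (fun u => (Real.exp (-(β * u)) : ℂ) * invL β G u) = 𝓕⁻ G := by
    ext u
    rw [invL_eq, ← mul_assoc, ← Complex.ofReal_mul, ← Real.exp_add]
    simp
  rw [this]
  exact IsL2Fourier.of_integrable_transform h1 h2

theorem isLaplaceOnLine_of_invL {β : ℝ} {F : ℝ → ℝ} {G : ℝ → ℂ} (h1 : Integrable G)
    (h2 : MemLp G 2) (hF : ∀ u, (F u : ℂ) = invL β G u) : IsLaplaceOnLine β F G := by
  rw [isLaplaceOnLine_iff]
  have := isL2Fourier_invL (β := β) h1 h2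
  simp_rw [← hF] at this
  simpa using this

/-- The Laplace transform of the primitive. -/
theorem IsLaplaceOnLine.primitive {β : ℝ} (hβ : 0 < β) {f : ℝ → ℝ} {G : ℝ → ℂ}
    (h : IsLaplaceOnLine β f G) (u : ℝ) :
    IntegrableOn f (Iic u) ∧
      ((∫ s in Iic u, f s : ℝ) : ℂ) = invL β (fun ξ => G ξ / line β ξ) u := by
  rw [isLaplaceOnLine_iff] at h
  -- The primitive, multiplied by e^{-βu}, is the convolution of e^{-βs} f(s) with this one-sided
  -- exponential, whose transform is 1/λ on the line. Here β > 0 is essential.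
  set k : ℝ → ℂ := (Ici (0 : ℝ)).indicator fun t => Complex.exp (-β * t) with hk
  have hk1 : Integrable k := by
    rw [hk, integrable_indicator_iff measurableSet_Ici, integrableOn_Ici_iff_integrableOn_Ioi]
    exact integrableOn_exp_mul_complex_Ioi (by simpa using hβ) 0
  have hkb : ∀ x, ‖k x‖ ≤ 1 := by
    intro x
    by_cases hx : 0 ≤ x
    · simp only [hk, indicator, mem_Ici, hx, if_true, Complex.norm_exp, Real.exp_le_one_iff]
      simp
      positivity
    · simp [hk, hx]
  have hk2 : MemLp k 2 := memLp_two_of_bounded hk1 hkb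
  have hkF : ∀ ξ, 𝓕 k ξ = 1 / line β ξ := by
    intro ξ
    have e : ∀ v : ℝ, Complex.exp ((↑(-2 * Real.pi * inner ℝ v ξ) * Complex.I)) • k v
        = (Ici (0 : ℝ)).indicator (fun t : ℝ => Complex.exp (-line β ξ * t)) v := by
      intro v
      by_cases hv : 0 ≤ v
      · simp only [hk, indicator, mem_Ici, hv, if_true, smul_eq_mul, line]
        rw [← Complex.exp_add]
        congr 1
        simp
        ring
      · simp [hk, indicator, hv]
    rw [Real.fourier_eq']
    simp_rw [e]
    rw [integral_indicator measurableSet_Ici, integral_Ici_eq_integral_Ioi,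
      integral_exp_mul_complex_Ioi (by simpa using hβ)]
    simp [neg_div_neg_eq]
  have hmain := h.integral_kernel_mul hk1 hk2 u
  have e1 : ∀ s, k (u - s) * ((Real.exp (-(β * s)) * f s : ℝ) : ℂ)
      = (Real.exp (-(β * u)) : ℂ) * ((Iic u).indicator (fun s => (f s : ℂ)) s) := by
    intro s
    by_cases hs : s ≤ u
    · have h0 : (0 : ℝ) ≤ u - s := by linarith
      simp only [hk, indicator, mem_Ici, mem_Iic, hs, h0, if_true]
      rw [Complex.ofReal_mul, ← mul_assoc, Complex.ofReal_exp, Complex.ofReal_exp,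
        ← Complex.exp_add]
      congr 2
      push_cast; ring
    · have h0 : ¬ (0 : ℝ) ≤ u - s := by linarith
      simp only [hk, indicator, mem_Ici, mem_Iic, hs, h0, if_false, zero_mul, mul_zero]
  have hint : Integrable fun s => k (u - s) * ((Real.exp (-(β * s)) * f s : ℝ) : ℂ) := by
    have : MemLp (fun s => k (u - s)) 2 :=
      hk2.comp_measurePreserving (Measure.measurePreserving_sub_left volume u)
    exact this.integrable_mul h.1
  simp_rw [e1] at hint hmain
  have hc : (Real.exp (-(β * u)) : ℂ) ≠ 0 := by exact_mod_cast (Real.exp_pos _).ne'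
  have hint' := (integrable_const_mul_iff hc.isUnit _).1 hint
  rw [integrable_indicator_iff measurableSet_Iic] at hint'
  refine ⟨by simpa [IntegrableOn] using hint'.re, ?_⟩
  rw [integral_const_mul, integral_indicator measurableSet_Iic, integral_complex_ofReal] at hmain
  rw [← mul_right_inj' hc, hmain, invL, ← integral_const_mul]
  congr 1 with ξ
  have h1 : (Real.exp (-(β * u)) : ℂ) * (Real.exp (β * u) : ℂ) = 1 := by
    rw [← Complex.ofReal_mul, ← Real.exp_add]
    simp
  rw [hkF, exp_line_mul]
  linear_combination (-(Complex.exp (2 * Real.pi * ξ * u * Complex.I) * (G ξ / line β ξ))) * h1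

/-! ### Holomorphic multipliers and independence of the line. -/

/-- A Laplace multiplier: holomorphic on the open strip `a < Re λ < b`, with quadratic decay. -/
structure IsMultiplier (a b : ℝ) (M : ℂ → ℂ) : Prop where
  differentiableOn : DifferentiableOn ℂ M {z | a < z.re ∧ z.re < b}
  exists_bound : ∃ C, ∀ z : ℂ, a < z.re → z.re < b → ‖M z‖ ≤ C / (1 + z.im ^ 2)

theorem one_add_sq_le_line (ξ : ℝ) : 1 + ξ ^ 2 ≤ 1 + (2 * Real.pi * ξ) ^ 2 := by
  have : (1 : ℝ) ≤ (2 * Real.pi) ^ 2 := by nlinarith [Real.pi_gt_three]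
  nlinarith [sq_nonneg ξ]

namespace IsMultiplier

variable {a b β β' : ℝ} {M : ℂ → ℂ}

theorem continuous_line (hM : IsMultiplier a b M) (h1 : a < β) (h2 : β < b) :
    Continuous fun ξ => M (line β ξ) :=
  hM.differentiableOn.continuousOn.comp_continuous (Wedge.continuous_line β)
    fun ξ => by simp [h1, h2]

theorem exists_bound_nonneg (hM : IsMultiplier a b M) :
    ∃ C, 0 ≤ C ∧ ∀ z : ℂ, a < z.re → z.re < b → ‖M z‖ ≤ C / (1 + z.im ^ 2) := by
  obtain ⟨C, hC⟩ := hM.exists_bound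
  refine ⟨|C|, abs_nonneg _, fun z h1 h2 => (hC z h1 h2).trans ?_⟩
  gcongr
  exact le_abs_self C

theorem exists_bound_line (hM : IsMultiplier a b M) :
    ∃ C, 0 ≤ C ∧ ∀ β ξ, a < β → β < b → ‖M (line β ξ)‖ ≤ C * (1 + ξ ^ 2)⁻¹ := by
  obtain ⟨C, h0, hC⟩ := hM.exists_bound_nonneg
  refine ⟨C, h0, fun β ξ h1 h2 => ?_⟩
  have := hC (line β ξ) (by simpa) (by simpa)
  rw [line_im] at this
  rw [← div_eq_mul_inv]
  refine this.trans ?_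
  have := one_add_sq_le_line ξ
  gcongr

theorem exists_bound_const (hM : IsMultiplier a b M) :
    ∃ C, ∀ β ξ, a < β → β < b → ‖M (line β ξ)‖ ≤ C := by
  obtain ⟨C, h0, hC⟩ := hM.exists_bound_line
  refine ⟨C, fun β ξ h1 h2 => (hC β ξ h1 h2).trans ?_⟩
  refine mul_le_of_le_one_right h0 (inv_le_one_of_one_le₀ ?_)
  nlinarith [sq_nonneg ξ]

theorem integrable_line (hM : IsMultiplier a b M) (h1 : a < β) (h2 : β < b) :
    Integrable fun ξ => M (line β ξ) := by
  obtain ⟨C, h0, hC⟩ := hM.exists_bound_line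
  exact (integrable_inv_one_add_sq.const_mul C).mono'
    (hM.continuous_line h1 h2).aestronglyMeasurable (ae_of_all _ fun ξ => hC β ξ h1 h2)

/-- Shift of the contour. -/
theorem invL_eq_of_mem (hM : IsMultiplier a b M) (h1 : a < β) (h2 : β < b) (h1' : a < β')
    (h2' : β' < b) (u : ℝ) :
    invL β (fun ξ => M (line β ξ)) u = invL β' (fun ξ => M (line β' ξ)) u := by
  set f : ℂ → ℂ := fun z => Complex.exp (z * u) * M z with hf
  have hfd : DifferentiableOn ℂ f {z | a < z.re ∧ z.re < b} :=
    (by fun_prop : Differentiable ℂ fun z : ℂ => Complex.exp (z * u)).differentiableOn.mul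
      hM.differentiableOn
  have hinv : ∀ γ, a < γ → γ < b → Integrable (fun y : ℝ => f (γ + y * Complex.I)) ∧
      ∫ y : ℝ, f (γ + y * Complex.I) = 2 * Real.pi * invL γ (fun ξ => M (line γ ξ)) u := by
    intro γ hγ hγ'
    have hp : (2 * Real.pi : ℝ) ≠ 0 := by positivity
    have e : ∀ ξ : ℝ, f (γ + ((2 * Real.pi * ξ : ℝ) : ℂ) * Complex.I)
        = Complex.exp (line γ ξ * u) * M (line γ ξ) := fun ξ => by
      simp only [hf, line]; push_cast; rfl
    constructor
    · rw [← integrable_comp_mul_left_iff _ hp]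
      simp_rw [e]
      refine ((hM.integrable_line hγ hγ').norm.const_mul (Real.exp (γ * u))).mono' ?_
        (ae_of_all _ fun ξ => ?_)
      · exact ((Complex.continuous_exp.comp ((Wedge.continuous_line γ).mul
          continuous_const)).mul (hM.continuous_line hγ hγ')).aestronglyMeasurable
      · rw [norm_mul, norm_exp_line_mul]
    · have := Measure.integral_comp_mul_left (fun y : ℝ => f (γ + y * Complex.I)) (2 * Real.pi)
      simp_rw [e] at this
      rw [invL, this, abs_of_pos (by positivity)]
      simp
      field_simp
      simp_rw [mul_comm Complex.I]
  obtain ⟨i1, e1⟩ := hinv β h1 h2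
  obtain ⟨i2, e2⟩ := hinv β' h1' h2'
  suffices h : ∫ y : ℝ, f (β + y * Complex.I) = ∫ y : ℝ, f (β' + y * Complex.I) by
    rw [e1, e2] at h
    have hp : (2 * Real.pi : ℂ) ≠ 0 := by exact_mod_cast (by positivity : (2 * Real.pi : ℝ) ≠ 0)
    exact mul_left_cancel₀ hp h
  obtain ⟨C, hC0, hC⟩ := hM.exists_bound_nonneg
  have hbot : Tendsto (fun T : ℝ => -T) atTop atBot := tendsto_neg_atTop_atBot
  have t1 := intervalIntegral_tendsto_integral i1 hbot tendsto_id
  have t2 := intervalIntegral_tendsto_integral i2 hbot tendsto_id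
  have hstrip : ∀ x ∈ uIcc β β', a < x ∧ x < b := fun x hx =>
    ⟨lt_of_lt_of_le (lt_min h1 h1') hx.1, lt_of_le_of_lt hx.2 (max_lt h2 h2')⟩
  set E : ℝ := Real.exp (max |β| |β'| * |u|) with hE
  -- The horizontal sides of the rectangle have fixed length, and the quadratic decay of M makes
  -- their contribution vanish as the height grows.
  have hside : ∀ T : ℝ, ‖∫ x : ℝ in β..β', f (x + (T : ℂ) * Complex.I)‖
      ≤ E * (C * (1 + T ^ 2)⁻¹) * |β' - β| := by
    intro T
    refine intervalIntegral.norm_integral_le_of_norm_le_const fun x hx => ?_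
    have hx' := hstrip x (uIoc_subset_uIcc hx)
    have hb := hC (x + (T : ℂ) * Complex.I) (by simpa using hx'.1) (by simpa using hx'.2)
    simp only [hf, norm_mul, Complex.norm_exp]
    have hxa : |x| ≤ max |β| |β'| := by
      have h3 := uIoc_subset_uIcc hx
      have h4 : x ≤ max β β' := h3.2
      have h5 : min β β' ≤ x := h3.1
      refine abs_le.2 ⟨?_, h4.trans (max_le_max (le_abs_self _) (le_abs_self _))⟩
      refine le_trans ?_ h5
      rw [le_min_iff]
      constructor
      · linarith [neg_abs_le β, le_max_left |β| |β'|]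
      · linarith [neg_abs_le β', le_max_right |β| |β'|]
    gcongr
    · rw [hE, Real.exp_le_exp]
      simp only [Complex.mul_re, Complex.add_re, Complex.ofReal_re, Complex.ofReal_im,
        Complex.I_re, Complex.I_im, mul_zero, mul_one, sub_self, add_zero, sub_zero]
      calc x * u ≤ |x * u| := le_abs_self _
        _ = |x| * |u| := abs_mul _ _
        _ ≤ _ := by gcongr
    · simpa [div_eq_mul_inv] using hb
  have hside0 : ∀ g : ℝ → ℝ, (∀ T, g T ^ 2 = T ^ 2) →
      Tendsto (fun T : ℝ => ∫ x : ℝ in β..β', f (x + (g T : ℂ) * Complex.I)) atTop (𝓝 0) := by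
    intro g hg
    refine squeeze_zero_norm (fun T => hside (g T)) ?_
    simp_rw [hg]
    have : Tendsto (fun T : ℝ => (1 + T ^ 2)⁻¹) atTop (𝓝 0) :=
      tendsto_inv_atTop_zero.comp (tendsto_atTop_add_const_left _ _ (tendsto_pow_atTop two_ne_zero))
    simpa using ((this.const_mul C).const_mul E).mul_const |β' - β|
  have hrect : ∀ T : ℝ, (∫ x : ℝ in β..β', f (x + ((-T : ℝ) : ℂ) * Complex.I))
      - (∫ x : ℝ in β..β', f (x + (T : ℂ) * Complex.I))
      + Complex.I • (∫ y : ℝ in (-T)..T, f (β' + y * Complex.I))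
      - Complex.I • (∫ y : ℝ in (-T)..T, f (β + y * Complex.I)) = 0 := by
    intro T
    have := Complex.integral_boundary_rect_eq_zero_of_differentiableOn f ⟨β, -T⟩ ⟨β', T⟩
      (hfd.mono fun z hz => hstrip z.re hz.1)
    simpa using this
  have hlim := (((hside0 (fun T => -T) (fun T => neg_sq T)).sub
    (hside0 id (fun T => rfl))).add (t2.const_smul Complex.I)).sub (t1.const_smul Complex.I)
  have h0 := tendsto_nhds_unique (hlim.congr fun T => hrect T) tendsto_const_nhds
  simp only [sub_zero, zero_add, smul_eq_mul] at h0
  rw [← mul_sub] at h0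
  exact (sub_eq_zero.1 ((mul_eq_zero.1 h0).resolve_left Complex.I_ne_zero)).symm

/-- The convolution kernel `u ↦ ∫ e^{λ u} M(λ)` of a multiplier. -/
theorem invL_mul_eq_integral {γ : ℝ} (hM : IsMultiplier a b M) (hγ : a < γ) (hγ' : γ < b)
    (h1 : a < β) (h2 : β < b) {F : ℝ → ℝ} {G : ℝ → ℂ} (h : IsLaplaceOnLine β F G) (u : ℝ) :
    invL β (fun ξ => M (line β ξ) * G ξ) u
      = ∫ s, invL γ (fun ξ => M (line γ ξ)) (u - s) * F s := by
  -- Only the kernel is moved between lines by Cauchy's theorem; G is known on its own line only and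
  -- is never continued.
  have hp : ∀ β', a < β' → β' < b → invL γ (fun ξ => M (line γ ξ))
      = invL β' (fun ξ => M (line β' ξ)) := fun β' h h' =>
    funext fun u => hM.invL_eq_of_mem hγ hγ' h h' u
  set p := invL γ (fun ξ => M (line γ ξ)) with hpdef
  set m : ℝ → ℂ := fun ξ => M (line β ξ) with hm
  have hmi : Integrable m := hM.integrable_line h1 h2
  have hmc : Continuous m := hM.continuous_line h1 h2
  set k : ℝ → ℂ := 𝓕⁻ m with hk
  have hkp : ∀ u, p u = (Real.exp (β * u) : ℂ) * k u := fun u => by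
    rw [hp β h1 h2, invL_eq]
  have hkc : Continuous k := by
    rw [hk, Real.fourierInv_eq_fourier_comp_neg]
    exact VectorFourier.fourierIntegral_continuous Real.continuous_fourierChar continuous_inner
      hmi.comp_neg
  obtain ⟨C, hC⟩ : ∃ C, ∀ u, ‖k u‖ ≤ C := by
    refine ⟨∫ ξ, ‖m ξ‖, fun u => ?_⟩
    rw [hk, Real.fourierInv_eq_fourier_neg]
    exact VectorFourier.norm_fourierIntegral_le_integral_norm _ _ _ _ _
  -- There is room for the lines β ± η inside the strip. Evaluating the same kernel there gives the
  -- decay e^{-η|u|} of k at both ends, hence its integrability.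
  obtain ⟨η, hη, ha, hb⟩ : ∃ η, 0 < η ∧ a < β - η ∧ β + η < b := by
    refine ⟨min (β - a) (b - β) / 2, ?_, ?_, ?_⟩
    · have := lt_min (sub_pos.2 h1) (sub_pos.2 h2); linarith
    · have := min_le_left (β - a) (b - β); linarith
    · have := min_le_right (β - a) (b - β); linarith
  obtain ⟨C', hC'⟩ : ∃ C', ∀ u, ‖k u‖ ≤ C' * Real.exp (-(η * |u|)) := by
    have key : ∀ β', a < β' → β' < b → ∀ u, ‖k u‖ ≤
        (∫ ξ, ‖M (line β' ξ)‖) * Real.exp ((β' - β) * u) := by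
      intro β' h h' u
      have e : ‖p u‖ = Real.exp (β * u) * ‖k u‖ := by
        rw [hkp, norm_mul, Complex.norm_real, Real.norm_of_nonneg (Real.exp_pos _).le]
      have hb := norm_invL_le β' (fun ξ => M (line β' ξ)) u
      rw [← hp β' h h', e, ← le_div_iff₀' (Real.exp_pos _)] at hb
      refine hb.trans_eq ?_
      rw [mul_comm, mul_div_assoc, ← Real.exp_sub]
      ring_nf
    refine ⟨max (∫ ξ, ‖M (line (β - η) ξ)‖) (∫ ξ, ‖M (line (β + η) ξ)‖), fun u => ?_⟩
    rcases le_total 0 u with hu | hu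
    · refine (key (β - η) ha (by linarith) u).trans ?_
      rw [abs_of_nonneg hu]
      gcongr
      · exact le_max_left _ _
      · linarith
    · refine (key (β + η) (by linarith) hb u).trans ?_
      rw [abs_of_nonpos hu]
      gcongr
      · exact le_max_right _ _
      · linarith
  have hk1 : Integrable k :=
    ((integrable_exp_neg_mul_abs hη).const_mul C').mono' hkc.aestronglyMeasurable (ae_of_all _ hC')
  have hk2 : MemLp k 2 := memLp_two_of_bounded hk1 hC
  -- Fourier inversion applies because the transform of m is the reflection of k, which has just
  -- been shown to be integrable.
  have hkF : 𝓕 k = m := by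
    refine hmc.fourier_fourierInv_eq hmi ?_
    have : 𝓕 m = fun u => k (-u) := by
      ext u
      rw [hk, Real.fourierInv_eq_fourier_neg, neg_neg]
    rw [this]
    exact hk1.comp_neg
  have hmain := IsL2Fourier.integral_kernel_mul h hk1 hk2 u
  rw [hkF] at hmain
  have : ∀ s, p (u - s) * F s = (Real.exp (β * u) : ℂ) *
      (k (u - s) * ((Real.exp (-(β * s)) * F s : ℝ) : ℂ)) := by
    intro s
    rw [hkp, show β * (u - s) = β * u + -(β * s) by ring, Real.exp_add]
    push_cast
    ring
  simp_rw [this]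
  rw [integral_const_mul, hmain, ← integral_const_mul, invL]
  congr 1 with ξ
  rw [exp_line_mul, hm]
  ring

theorem line_neg (β ξ : ℝ) : line β (-ξ) = (starRingEnd ℂ) (line β ξ) := by
  apply Complex.ext <;> simp [line]

/-- In the convolution formula the kernel is taken on one fixed line γ, so β no longer occurs. -/
theorem exists_eq_invL (hM : IsMultiplier a b M) (hab : a < b) (F : ℝ → ℝ) :
    ∃ Q : ℝ → ℂ, ∀ β, a < β → β < b → ∀ G, IsLaplaceOnLine β F G → ∀ u,
      invL β (fun ξ => M (line β ξ) * G ξ) u = Q u := by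
  obtain ⟨γ, hγ, hγ'⟩ := exists_between hab
  exact ⟨_, fun β h1 h2 G h u => hM.invL_mul_eq_integral hγ hγ' h1 h2 h u⟩

/-- The kernel of a multiplier with real symmetry is real. -/
theorem exists_real_eq_invL (hM : IsMultiplier a b M) (hab : a < b)
    (hr : ∀ z, M ((starRingEnd ℂ) z) = (starRingEnd ℂ) (M z)) (F : ℝ → ℝ) :
    ∃ Q : ℝ → ℝ, ∀ β, a < β → β < b → ∀ G, IsLaplaceOnLine β F G → ∀ u,
      invL β (fun ξ => M (line β ξ) * G ξ) u = Q u := by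
  obtain ⟨γ, hγ, hγ'⟩ := exists_between hab
  -- Conjugation reflects the line, ξ ↦ -ξ, and by `hr` the integrand returns to itself.
  have hp : ∀ u, invL γ (fun ξ => M (line γ ξ)) u
      = ((invL γ (fun ξ => M (line γ ξ)) u).re : ℂ) := by
    intro u
    refine (Complex.conj_eq_iff_re.1 ?_).symm
    rw [invL, ← integral_conj, ← integral_neg_eq_self]
    congr 1 with ξ
    rw [map_mul, ← Complex.exp_conj, map_mul, Complex.conj_ofReal, line_neg, Complex.conj_conj,
      ← hr, Complex.conj_conj]
  refine ⟨fun u => ∫ s, (invL γ (fun ξ => M (line γ ξ)) (u - s)).re * F s,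
    fun β h1 h2 G h u => ?_⟩
  rw [hM.invL_mul_eq_integral hγ hγ' h1 h2 h u, ← integral_complex_ofReal]
  congr 1 with s
  rw [hp]
  simp

end IsMultiplier

/-! ### Interpolation of weighted L²-norms between lines. -/

/-- A positive continuous weight which varies at most polynomially. -/
structure IsSlowWeight (N : ℕ) (w : ℝ → ℝ) : Prop where
  continuous : Continuous w
  pos : ∀ ξ, 0 < w ξ
  le_mul : ∀ ξ η, w η ≤ w ξ * (1 + |ξ - η|) ^ N

theorem IsSlowWeight.geom_mean {N : ℕ} {w₀ w₁ : ℝ → ℝ} (h₀ : IsSlowWeight N w₀)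
    (h₁ : IsSlowWeight N w₁) {θ : ℝ} (hθ : θ ∈ Icc (0 : ℝ) 1) :
    IsSlowWeight N fun ξ => w₀ ξ ^ (1 - θ) * w₁ ξ ^ θ where
  continuous := (h₀.continuous.rpow_const fun ξ => Or.inl (h₀.pos ξ).ne').mul
    (h₁.continuous.rpow_const fun ξ => Or.inl (h₁.pos ξ).ne')
  pos ξ := mul_pos (Real.rpow_pos_of_pos (h₀.pos ξ) _) (Real.rpow_pos_of_pos (h₁.pos ξ) _)
  le_mul ξ η := by
    have hθ1 : 0 ≤ 1 - θ := by linarith [hθ.2]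
    have hd : 0 < (1 + |ξ - η|) ^ N := by positivity
    have e : (1 + |ξ - η|) ^ N = ((1 + |ξ - η|) ^ N) ^ (1 - θ) * ((1 + |ξ - η|) ^ N) ^ θ := by
      rw [← Real.rpow_add hd]; simp
    calc w₀ η ^ (1 - θ) * w₁ η ^ θ
        ≤ (w₀ ξ * (1 + |ξ - η|) ^ N) ^ (1 - θ) * (w₁ ξ * (1 + |ξ - η|) ^ N) ^ θ := by
          have := h₀.le_mul ξ η
          have := h₁.le_mul ξ η
          have := (h₀.pos η).le
          have := (h₁.pos η).le
          have := hθ.1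
          gcongr
          exact Real.rpow_nonneg (mul_nonneg (h₀.pos ξ).le hd.le) _
      _ = w₀ ξ ^ (1 - θ) * w₁ ξ ^ θ * (((1 + |ξ - η|) ^ N) ^ (1 - θ) *
            ((1 + |ξ - η|) ^ N) ^ θ) := by
          rw [Real.mul_rpow (h₀.pos ξ).le hd.le, Real.mul_rpow (h₁.pos ξ).le hd.le]
          ring
      _ = _ := by rw [← e]

/-- The square of a weighted `L²`-norm. -/
def wsq (w : ℝ → ℝ) (G : ℝ → ℂ) : ℝ≥0∞ := ∫⁻ ξ, ENNReal.ofReal (w ξ ^ 2 * ‖G ξ‖ ^ 2)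

theorem eLpNorm_two_sq {f : ℝ → ℂ} : eLpNorm f 2 volume ^ 2
    = ∫⁻ ξ, ENNReal.ofReal (‖f ξ‖ ^ 2) := by
  rw [eLpNorm_eq_lintegral_rpow_enorm_toReal two_ne_zero ENNReal.ofNat_ne_top,
    ← ENNReal.rpow_natCast, ← ENNReal.rpow_mul]
  simp only [ENNReal.toReal_ofNat, Nat.cast_ofNat, one_div, ne_eq, OfNat.ofNat_ne_zero,
    not_false_eq_true, inv_mul_cancel₀, ENNReal.rpow_one]
  congr 1 with ξ
  rw [ENNReal.ofReal_pow (norm_nonneg _), ofReal_norm]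
  norm_num

theorem integrable_pow_mul_gaussian (N : ℕ) :
    Integrable fun t : ℝ => (1 + |t|) ^ N * Real.exp (-(8 * Real.pi ^ 2 * t ^ 2)) := by
  refine ((integrable_exp_neg_mul_abs one_pos).const_mul (N.factorial * Real.exp 2)).mono'
    (by fun_prop) (ae_of_all _ fun t => ?_)
  rw [Real.norm_of_nonneg (by positivity)]
  have h1 : (1 + |t|) ^ N ≤ N.factorial * Real.exp (1 + |t|) := by
    have := Real.pow_div_factorial_le_exp (1 + |t|) (by positivity) N
    rwa [div_le_iff₀' (by positivity)] at this
  have h2 : Real.exp (-(8 * Real.pi ^ 2 * t ^ 2)) ≤ Real.exp (1 - 2 * |t|) := by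
    rw [Real.exp_le_exp, ← sq_abs t]
    have : (1 : ℝ) ≤ 8 * Real.pi ^ 2 := by nlinarith [Real.pi_gt_three]
    nlinarith [sq_nonneg (|t| - 1), sq_nonneg |t|]
  calc _ ≤ (N.factorial * Real.exp (1 + |t|)) * Real.exp (1 - 2 * |t|) := by gcongr
    _ = _ := by
      rw [mul_assoc, mul_assoc, ← Real.exp_add, ← Real.exp_add]
      ring_nf

/-- A wave packet concentrated at frequency `2 π η`. -/
def packet (η : ℝ) (z : ℂ) : ℂ := Complex.exp ((z - 2 * Real.pi * η * Complex.I) ^ 2)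

theorem norm_packet (η : ℝ) (z : ℂ) :
    ‖packet η z‖ = Real.exp (z.re ^ 2 - (z.im - 2 * Real.pi * η) ^ 2) := by
  rw [packet, Complex.norm_exp, pow_two]
  congr 1
  simp
  ring

theorem norm_packet_line_sq (η β ξ : ℝ) : ‖packet η (line β ξ)‖ ^ 2
    = Real.exp (2 * β ^ 2) * Real.exp (-(8 * Real.pi ^ 2 * (ξ - η) ^ 2)) := by
  rw [norm_packet, line_re, line_im, ← Real.exp_nat_mul, ← Real.exp_add]
  congr 1
  push_cast
  ring

theorem isMultiplier_packet (η a b : ℝ) : IsMultiplier a b (packet η) where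
  differentiableOn := by
    unfold packet
    exact (by fun_prop : Differentiable ℂ fun z : ℂ =>
      Complex.exp ((z - 2 * Real.pi * η * Complex.I) ^ 2)).differentiableOn
  exists_bound := by
    refine ⟨Real.exp (max |a| |b| ^ 2) * (2 * (1 + (2 * Real.pi * η) ^ 2)), fun z h1 h2 => ?_⟩
    set s := 2 * Real.pi * η
    rw [norm_packet, sub_eq_add_neg, Real.exp_add, mul_div_assoc]
    have hz : |z.re| ≤ max |a| |b| := by
      refine abs_le.2 ⟨?_, ?_⟩
      · linarith [neg_abs_le a, le_max_left |a| |b|]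
      · linarith [le_abs_self b, le_max_right |a| |b|]
    refine mul_le_mul ?_ ?_ (Real.exp_pos _).le (Real.exp_pos _).le
    · rw [Real.exp_le_exp, ← sq_abs z.re]; gcongr
    · rw [le_div_iff₀ (by positivity), Real.exp_neg, inv_mul_le_iff₀ (Real.exp_pos _)]
      have := Real.add_one_le_exp ((z.im - s) ^ 2)
      have h3 : 1 + z.im ^ 2 ≤ ((z.im - s) ^ 2 + 1) * (2 * (1 + s ^ 2)) := by
        nlinarith [sq_nonneg (z.im - 2 * s), mul_nonneg (sq_nonneg (z.im - s)) (sq_nonneg s)]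
      refine h3.trans ?_
      gcongr

theorem IsMultiplier.integrable_mul {a b β : ℝ} {M : ℂ → ℂ} (hM : IsMultiplier a b M)
    (h1 : a < β) (h2 : β < b) {G : ℝ → ℂ} (hG : MemLp G 2) :
    Integrable (fun ξ => M (line β ξ) * G ξ) ∧ MemLp (fun ξ => M (line β ξ) * G ξ) 2 := by
  obtain ⟨C, hC⟩ := hM.exists_bound_const
  have hm : MemLp (fun ξ => M (line β ξ)) 2 :=
    memLp_two_of_bounded (hM.integrable_line h1 h2) fun ξ => hC β ξ h1 h2
  refine ⟨hm.integrable_mul hG, ?_⟩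
  refine hG.of_le_mul (c := C) (hm.1.mul hG.1) (ae_of_all _ fun ξ => ?_)
  rw [norm_mul]
  exact mul_le_mul_of_nonneg_right (hC β ξ h1 h2) (norm_nonneg _)

/-- After multiplication by one packet the inverse integrals on all lines are the same function Q.
By Plancherel each term is a constant times the integral of e^{-2βu} |Q(u)|², and the weights
e^{-2βu} are log-linear in β. So the inequality holds pointwise in u, by the weighted inequality of
arithmetic and geometric means. -/
theorem lintegral_packet_le {η β₀ β₁ θ x₀ x₁ : ℝ} (hθ : θ ∈ Icc (0 : ℝ) 1) (h₀ : 0 < x₀)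
    (h₁ : 0 < x₁) {F : ℝ → ℝ} {G₀ G₁ G : ℝ → ℂ} (hG₀ : IsLaplaceOnLine β₀ F G₀)
    (hG₁ : IsLaplaceOnLine β₁ F G₁) (hG : IsLaplaceOnLine ((1 - θ) * β₀ + θ * β₁) F G) :
    ENNReal.ofReal ((x₀ ^ (1 - θ) * x₁ ^ θ) ^ 2) *
        (∫⁻ ξ, ENNReal.ofReal (‖packet η (line ((1 - θ) * β₀ + θ * β₁) ξ) * G ξ‖ ^ 2))
      ≤ ENNReal.ofReal (x₀ ^ 2) * (∫⁻ ξ, ENNReal.ofReal (‖packet η (line β₀ ξ) * G₀ ξ‖ ^ 2))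
        + ENNReal.ofReal (x₁ ^ 2) *
          (∫⁻ ξ, ENNReal.ofReal (‖packet η (line β₁ ξ) * G₁ ξ‖ ^ 2)) := by
  set β := (1 - θ) * β₀ + θ * β₁ with hβ
  set B := |β₀| + |β₁| + |β| + 1 with hB
  have hM := isMultiplier_packet η (-B) B
  have hBpos : -B < B := by have : 0 < B := by positivity
                            linarith
  obtain ⟨Q, hQ⟩ := hM.exists_eq_invL hBpos F
  have key : ∀ γ, |γ| < B → ∀ G, IsLaplaceOnLine γ F G →
      ∫⁻ ξ, ENNReal.ofReal (‖packet η (line γ ξ) * G ξ‖ ^ 2)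
        = ∫⁻ u, ENNReal.ofReal (Real.exp (-(γ * u)) ^ 2 * ‖Q u‖ ^ 2) := by
    intro γ hγ G hG
    obtain ⟨h1, h2⟩ := abs_lt.1 hγ
    obtain ⟨i1, i2⟩ := hM.integrable_mul h1 h2 (isLaplaceOnLine_iff.1 hG).memLp_transform
    have := (isL2Fourier_invL (β := γ) i1 i2).eLpNorm_eq
    rw [← eLpNorm_two_sq, this, eLpNorm_two_sq]
    congr 1 with u
    rw [hQ γ h1 h2 G hG u, norm_mul, Complex.norm_real, Real.norm_of_nonneg (Real.exp_pos _).le,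
      mul_pow]
  have b0 : |β₀| < B := by linarith [abs_nonneg β₁, abs_nonneg β]
  have b1 : |β₁| < B := by linarith [abs_nonneg β₀, abs_nonneg β]
  have b2 : |β| < B := by linarith [abs_nonneg β₀, abs_nonneg β₁]
  have hQm : AEMeasurable (fun u => ENNReal.ofReal (x₀ ^ 2) *
      ENNReal.ofReal (Real.exp (-(β₀ * u)) ^ 2 * ‖Q u‖ ^ 2)) := by
    obtain ⟨h1, h2⟩ := abs_lt.1 b0
    obtain ⟨i1, i2⟩ := hM.integrable_mul h1 h2 (isLaplaceOnLine_iff.1 hG₀).memLp_transform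
    have := (isL2Fourier_invL (β := β₀) i1 i2).memLp.1
    have h3 := this.norm.aemeasurable.pow_const 2
    refine AEMeasurable.const_mul (AEMeasurable.ennreal_ofReal ?_) _
    refine h3.congr (ae_of_all _ fun u => ?_)
    simp only
    rw [hQ β₀ h1 h2 G₀ hG₀ u, norm_mul, Complex.norm_real, Real.norm_of_nonneg (Real.exp_pos _).le,
      mul_pow]
  rw [key β b2 G hG, key β₀ b0 G₀ hG₀, key β₁ b1 G₁ hG₁,
    ← lintegral_const_mul' _ _ ENNReal.ofReal_ne_top,
    ← lintegral_const_mul' _ _ ENNReal.ofReal_ne_top,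
    ← lintegral_const_mul' _ _ ENNReal.ofReal_ne_top, ← lintegral_add_left' hQm]
  refine lintegral_mono fun u => ?_
  simp only
  rw [← ENNReal.ofReal_mul (by positivity), ← ENNReal.ofReal_mul (by positivity),
    ← ENNReal.ofReal_mul (by positivity), ← ENNReal.ofReal_add (by positivity) (by positivity)]
  refine ENNReal.ofReal_le_ofReal ?_
  rw [← mul_assoc, ← mul_assoc, ← mul_assoc, ← add_mul]
  refine mul_le_mul_of_nonneg_right ?_ (by positivity)
  set y₀ := x₀ ^ 2 * Real.exp (-(β₀ * u)) ^ 2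
  set y₁ := x₁ ^ 2 * Real.exp (-(β₁ * u)) ^ 2
  have hθ1 : 0 ≤ 1 - θ := by linarith [hθ.2]
  have hy0 : 0 ≤ y₀ := by positivity
  have hy1 : 0 ≤ y₁ := by positivity
  have e : (x₀ ^ (1 - θ) * x₁ ^ θ) ^ 2 * Real.exp (-(β * u)) ^ 2 = y₀ ^ (1 - θ) * y₁ ^ θ := by
    simp only [y₀, y₁]
    rw [← mul_pow, ← mul_pow, ← mul_pow, ← Real.rpow_natCast, ← Real.rpow_natCast,
      ← Real.rpow_natCast, ← Real.rpow_mul (by positivity), ← Real.rpow_mul (by positivity),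
      mul_comm _ (1 - θ), mul_comm _ θ, Real.rpow_mul (by positivity), Real.rpow_mul (by positivity),
      ← Real.mul_rpow (by positivity) (by positivity), Real.mul_rpow h₀.le (Real.exp_pos _).le,
      Real.mul_rpow h₁.le (Real.exp_pos _).le, ← Real.exp_mul, ← Real.exp_mul]
    congr 1
    rw [show -(β * u) = -(β₀ * u) * (1 - θ) + -(β₁ * u) * θ by rw [hβ]; ring, Real.exp_add]
    ring
  rw [e]
  have := Real.geom_mean_le_arith_mean2_weighted hθ1 hθ.1 hy0 hy1 (by ring)
  nlinarith [hθ.1, hθ.2]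

/-- Interpolation between weighted `L²`-norms of Laplace transforms on different lines. -/
theorem exists_wsq_interpolation (B : ℝ) (N : ℕ) : ∃ C : ℝ, 0 < C ∧
    ∀ β₀ β₁ θ : ℝ, |β₀| ≤ B → |β₁| ≤ B → θ ∈ Icc (0 : ℝ) 1 → ∀ w₀ w₁ : ℝ → ℝ,
      IsSlowWeight N w₀ → IsSlowWeight N w₁ → ∀ F G₀ G₁ G, IsLaplaceOnLine β₀ F G₀ →
      IsLaplaceOnLine β₁ F G₁ → IsLaplaceOnLine ((1 - θ) * β₀ + θ * β₁) F G →
      wsq (fun ξ => w₀ ξ ^ (1 - θ) * w₁ ξ ^ θ) G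
        ≤ ENNReal.ofReal C * (wsq w₀ G₀ + wsq w₁ G₁) := by
  set g : ℝ → ℝ := fun t => Real.exp (-(8 * Real.pi ^ 2 * t ^ 2)) with hg
  set c₁ : ℝ := ∫ t : ℝ, ((1 + |t|) ^ (2 * N))⁻¹ * g t with hc₁
  set c₂ : ℝ := ∫ t : ℝ, (1 + |t|) ^ (2 * N) * g t with hc₂
  have gpos : ∀ t, 0 < g t := fun t => Real.exp_pos _
  have gc : Continuous g := by fun_prop
  have int₂ : Integrable fun t : ℝ => (1 + |t|) ^ (2 * N) * g t := integrable_pow_mul_gaussian _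
  have int₁ : Integrable fun t : ℝ => ((1 + |t|) ^ (2 * N))⁻¹ * g t := by
    refine int₂.mono' ?_ (ae_of_all _ fun t => ?_)
    · exact (Continuous.mul (Continuous.inv₀ (by fun_prop) fun t => by positivity)
        gc).aestronglyMeasurable
    · rw [Real.norm_of_nonneg (mul_nonneg (by positivity) (gpos t).le)]
      refine mul_le_mul_of_nonneg_right ?_ (gpos t).le
      have : (1 : ℝ) ≤ (1 + |t|) ^ (2 * N) := one_le_pow₀ (by linarith [abs_nonneg t])
      exact (inv_le_one_of_one_le₀ this).trans this
  have c₁pos : 0 < c₁ := by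
    rw [hc₁, integral_pos_iff_support_of_nonneg (fun t => mul_nonneg (by positivity) (gpos t).le)
      int₁]
    have : Function.support (fun t : ℝ => ((1 + |t|) ^ (2 * N))⁻¹ * g t) = univ := by
      ext t
      simp only [Function.mem_support, mem_univ, iff_true]
      exact (mul_pos (by positivity) (gpos t)).ne'
    rw [this]; simp
  have c₂pos : 0 ≤ c₂ := integral_nonneg fun t => mul_nonneg (by positivity) (gpos t).le
  -- averaging over the packets
  have lower : ∀ w, IsSlowWeight N w → ∀ β ξ, ENNReal.ofReal (w ξ ^ 2 * c₁) ≤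
      ∫⁻ η, ENNReal.ofReal (w η ^ 2 * ‖packet η (line β ξ)‖ ^ 2) := by
    intro w hw β ξ
    have e : ENNReal.ofReal (w ξ ^ 2 * c₁) =
        ∫⁻ η, ENNReal.ofReal (w ξ ^ 2 * (((1 + |ξ - η|) ^ (2 * N))⁻¹ * g (ξ - η))) := by
      rw [hc₁, ← integral_const_mul, ofReal_integral_eq_lintegral_ofReal (int₁.const_mul _)
        (ae_of_all _ fun t => mul_nonneg (sq_nonneg _) (mul_nonneg (by positivity) (gpos t).le))]
      exact (lintegral_sub_left_eq_self (fun t => ENNReal.ofReal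
        (w ξ ^ 2 * (((1 + |t|) ^ (2 * N))⁻¹ * g t))) ξ).symm
    rw [e]
    refine lintegral_mono fun η => ENNReal.ofReal_le_ofReal ?_
    rw [norm_packet_line_sq, ← mul_assoc]
    have h1 : w ξ ≤ w η * (1 + |ξ - η|) ^ N := by
      have := hw.le_mul η ξ
      rwa [abs_sub_comm] at this
    have h2 : w ξ ^ 2 * ((1 + |ξ - η|) ^ (2 * N))⁻¹ ≤ w η ^ 2 := by
      rw [← div_eq_mul_inv, div_le_iff₀ (by positivity), mul_comm 2 N, pow_mul, ← mul_pow]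
      exact pow_le_pow_left₀ (hw.pos ξ).le h1 2
    have h3 : (1 : ℝ) ≤ Real.exp (2 * β ^ 2) := Real.one_le_exp (by positivity)
    calc _ ≤ w η ^ 2 * g (ξ - η) := mul_le_mul_of_nonneg_right h2 (gpos _).le
      _ ≤ w η ^ 2 * (Real.exp (2 * β ^ 2) * g (ξ - η)) := by
        gcongr
        exact le_mul_of_one_le_left (gpos _).le h3
  have upper : ∀ w, IsSlowWeight N w → ∀ β ξ, |β| ≤ B →
      ∫⁻ η, ENNReal.ofReal (w η ^ 2 * ‖packet η (line β ξ)‖ ^ 2)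
        ≤ ENNReal.ofReal (w ξ ^ 2 * (Real.exp (2 * B ^ 2) * c₂)) := by
    intro w hw β ξ hβ
    have e : ENNReal.ofReal (w ξ ^ 2 * (Real.exp (2 * B ^ 2) * c₂)) = ∫⁻ η, ENNReal.ofReal
        (w ξ ^ 2 * (Real.exp (2 * B ^ 2) * ((1 + |ξ - η|) ^ (2 * N) * g (ξ - η)))) := by
      rw [hc₂, ← integral_const_mul, ← integral_const_mul, ofReal_integral_eq_lintegral_ofReal
        ((int₂.const_mul _).const_mul _)
        (ae_of_all _ fun t => mul_nonneg (sq_nonneg _) (mul_nonneg (Real.exp_pos _).le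
          (mul_nonneg (by positivity) (gpos t).le)))]
      exact (lintegral_sub_left_eq_self (fun t => ENNReal.ofReal
        (w ξ ^ 2 * (Real.exp (2 * B ^ 2) * ((1 + |t|) ^ (2 * N) * g t)))) ξ).symm
    rw [e]
    refine lintegral_mono fun η => ENNReal.ofReal_le_ofReal ?_
    rw [norm_packet_line_sq]
    have h2 : w η ^ 2 ≤ w ξ ^ 2 * (1 + |ξ - η|) ^ (2 * N) := by
      rw [mul_comm 2 N, pow_mul, ← mul_pow]
      exact pow_le_pow_left₀ (hw.pos η).le (hw.le_mul ξ η) 2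
    have h3 : Real.exp (2 * β ^ 2) ≤ Real.exp (2 * B ^ 2) := by
      rw [Real.exp_le_exp, ← sq_abs β]; gcongr
    calc _ ≤ (w ξ ^ 2 * (1 + |ξ - η|) ^ (2 * N)) * (Real.exp (2 * B ^ 2) * g (ξ - η)) := by
          gcongr
      _ = _ := by ring
  -- By Tonelli the average over packet centres becomes a weight in ξ, which `lower` and `upper`
  -- compare with w(ξ)².
  have swap : ∀ w, IsSlowWeight N w → ∀ β G, MemLp G 2 →
      ∫⁻ η, ENNReal.ofReal (w η ^ 2) * (∫⁻ ξ, ENNReal.ofReal (‖packet η (line β ξ) * G ξ‖ ^ 2))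
        = ∫⁻ ξ, (∫⁻ η, ENNReal.ofReal (w η ^ 2 * ‖packet η (line β ξ)‖ ^ 2)) *
            ENNReal.ofReal (‖G ξ‖ ^ 2) := by
    intro w hw β G hG
    have hpc : Continuous fun p : ℝ × ℝ => w p.1 ^ 2 * ‖packet p.1 (line β p.2)‖ ^ 2 := by
      have := hw.continuous
      have := continuous_line β
      unfold packet
      fun_prop
    have e : ∀ η ξ, ENNReal.ofReal (w η ^ 2) * ENNReal.ofReal (‖packet η (line β ξ) * G ξ‖ ^ 2)
        = ENNReal.ofReal (w η ^ 2 * ‖packet η (line β ξ)‖ ^ 2) * ENNReal.ofReal (‖G ξ‖ ^ 2) := by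
      intro η ξ
      rw [← ENNReal.ofReal_mul (by positivity), ← ENNReal.ofReal_mul (by positivity), norm_mul,
        mul_pow, mul_assoc]
    simp_rw [← lintegral_const_mul' _ _ ENNReal.ofReal_ne_top, e]
    rw [lintegral_lintegral_swap]
    · simp_rw [lintegral_mul_const' _ _ ENNReal.ofReal_ne_top]
    · refine AEMeasurable.mul hpc.measurable.ennreal_ofReal.aemeasurable ?_
      exact AEMeasurable.comp_snd (f := fun ξ => ENNReal.ofReal (‖G ξ‖ ^ 2))
        (hG.1.norm.aemeasurable.pow_const 2).ennreal_ofReal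
  -- The ratio of the upper to the lower constant of the averaging. It depends on B and N only; the
  -- added 1 makes it positive.
  refine ⟨(Real.exp (2 * B ^ 2) * c₂ + 1) / c₁, by positivity, ?_⟩
  intro β₀ β₁ θ hβ₀ hβ₁ hθ w₀ w₁ h₀ h₁ F G₀ G₁ G hG₀ hG₁ hG
  have hw := h₀.geom_mean h₁ hθ
  set w : ℝ → ℝ := fun ξ => w₀ ξ ^ (1 - θ) * w₁ ξ ^ θ with hwdef
  set β := (1 - θ) * β₀ + θ * β₁
  have m₀ := (isLaplaceOnLine_iff.1 hG₀).memLp_transform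
  have m₁ := (isLaplaceOnLine_iff.1 hG₁).memLp_transform
  have m := (isLaplaceOnLine_iff.1 hG).memLp_transform
  have L : ENNReal.ofReal c₁ * wsq w G ≤ ∫⁻ η, ENNReal.ofReal (w η ^ 2) *
      (∫⁻ ξ, ENNReal.ofReal (‖packet η (line β ξ) * G ξ‖ ^ 2)) := by
    rw [swap w hw β G m, wsq, ← lintegral_const_mul' _ _ ENNReal.ofReal_ne_top]
    refine lintegral_mono fun ξ => ?_
    refine le_trans (le_of_eq ?_) (mul_le_mul_left (lower w hw β ξ) _)
    rw [← ENNReal.ofReal_mul c₁pos.le,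
      ← ENNReal.ofReal_mul (mul_nonneg (sq_nonneg _) c₁pos.le)]
    congr 1; ring
  have U : ∀ w, IsSlowWeight N w → ∀ β G, |β| ≤ B → MemLp G 2 →
      ∫⁻ η, ENNReal.ofReal (w η ^ 2) * (∫⁻ ξ, ENNReal.ofReal (‖packet η (line β ξ) * G ξ‖ ^ 2))
        ≤ ENNReal.ofReal (Real.exp (2 * B ^ 2) * c₂) * wsq w G := by
    intro w hw β G hβ hG
    rw [swap w hw β G hG, wsq, ← lintegral_const_mul' _ _ ENNReal.ofReal_ne_top]
    refine lintegral_mono fun ξ => ?_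
    refine (mul_le_mul_left (upper w hw β ξ hβ) _).trans_eq ?_
    rw [← ENNReal.ofReal_mul (by positivity), ← ENNReal.ofReal_mul (by positivity)]
    congr 1; ring
  have main : ENNReal.ofReal c₁ * wsq w G
      ≤ ENNReal.ofReal (Real.exp (2 * B ^ 2) * c₂ + 1) * (wsq w₀ G₀ + wsq w₁ G₁) := by
    refine L.trans ?_
    calc _ ≤ ∫⁻ η, (ENNReal.ofReal (w₀ η ^ 2) *
            (∫⁻ ξ, ENNReal.ofReal (‖packet η (line β₀ ξ) * G₀ ξ‖ ^ 2))
          + ENNReal.ofReal (w₁ η ^ 2) *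
            (∫⁻ ξ, ENNReal.ofReal (‖packet η (line β₁ ξ) * G₁ ξ‖ ^ 2))) :=
          lintegral_mono fun η => lintegral_packet_le hθ (h₀.pos η) (h₁.pos η) hG₀ hG₁ hG
      _ = _ := by
          rw [lintegral_add_left']
          refine AEMeasurable.mul
            (h₀.continuous.measurable.pow_const 2).ennreal_ofReal.aemeasurable ?_
          refine AEMeasurable.lintegral_prod_right' (f := fun p : ℝ × ℝ =>
            ENNReal.ofReal (‖packet p.1 (line β₀ p.2) * G₀ p.2‖ ^ 2)) ?_
          have hpc : Continuous fun p : ℝ × ℝ => packet p.1 (line β₀ p.2) := by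
            have := continuous_line β₀
            unfold packet
            fun_prop
          exact ((hpc.aestronglyMeasurable.mul
            m₀.1.comp_snd).norm.aemeasurable.pow_const 2).ennreal_ofReal
      _ ≤ ENNReal.ofReal (Real.exp (2 * B ^ 2) * c₂) * wsq w₀ G₀
          + ENNReal.ofReal (Real.exp (2 * B ^ 2) * c₂) * wsq w₁ G₁ :=
          add_le_add (U w₀ h₀ β₀ G₀ hβ₀ m₀) (U w₁ h₁ β₁ G₁ hβ₁ m₁)
      _ ≤ _ := by
          rw [← mul_add]
          gcongr
          linarith
  calc wsq w G = ENNReal.ofReal c₁⁻¹ * (ENNReal.ofReal c₁ * wsq w G) := by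
        rw [← mul_assoc, ← ENNReal.ofReal_mul (inv_nonneg.2 c₁pos.le), inv_mul_cancel₀ c₁pos.ne',
          ENNReal.ofReal_one, one_mul]
    _ ≤ _ := by
        rw [div_eq_inv_mul, ENNReal.ofReal_mul (inv_nonneg.2 c₁pos.le), mul_assoc]
        exact mul_le_mul_right main _

/-! ### Lower bounds for the sine and the restriction on ε. -/

theorem norm_cos_le (z : ℂ) : ‖Complex.cos z‖ ≤ Real.exp |z.im| := by
  have h1 : ‖Complex.exp (z * Complex.I)‖ ≤ Real.exp |z.im| := by
    rw [Complex.norm_exp, Real.exp_le_exp]; simpa using neg_le_abs z.im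
  have h2 : ‖Complex.exp (-z * Complex.I)‖ ≤ Real.exp |z.im| := by
    rw [Complex.norm_exp, Real.exp_le_exp]; simpa using le_abs_self z.im
  rw [Complex.cos, norm_div, Complex.norm_ofNat, div_le_iff₀ two_pos]
  linarith [norm_add_le (Complex.exp (z * Complex.I)) (Complex.exp (-z * Complex.I))]

theorem norm_sin_le (z : ℂ) : ‖Complex.sin z‖ ≤ Real.exp |z.im| := by
  have h1 : ‖Complex.exp (z * Complex.I)‖ ≤ Real.exp |z.im| := by
    rw [Complex.norm_exp, Real.exp_le_exp]; simpa using neg_le_abs z.im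
  have h2 : ‖Complex.exp (-z * Complex.I)‖ ≤ Real.exp |z.im| := by
    rw [Complex.norm_exp, Real.exp_le_exp]; simpa using le_abs_self z.im
  rw [Complex.sin, norm_div, norm_mul, Complex.norm_I, mul_one, Complex.norm_ofNat,
    div_le_iff₀ two_pos]
  linarith [norm_sub_le (Complex.exp (-z * Complex.I)) (Complex.exp (z * Complex.I))]

theorem norm_sin_sq (z : ℂ) :
    ‖Complex.sin z‖ ^ 2 = Real.sin z.re ^ 2 + Real.sinh z.im ^ 2 := by
  rw [← Complex.normSq_eq_norm_sq, Complex.sin_eq, Complex.normSq_apply]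
  simp only [← Complex.ofReal_sin, ← Complex.ofReal_cos, ← Complex.ofReal_sinh,
    ← Complex.ofReal_cosh, ← Complex.ofReal_mul, Complex.add_re, Complex.add_im,
    Complex.mul_I_re, Complex.mul_I_im, Complex.ofReal_re, Complex.ofReal_im]
  have h1 := Real.sin_sq_add_cos_sq z.re
  have h2 := Real.cosh_sq z.im
  ring_nf
  rw [h2, Real.cos_sq']
  ring

/-- The sine is bounded below in the strip `0 ≤ Re z ≤ π / 2`. -/
theorem min_mul_exp_le_norm_sin {z : ℂ} (h0 : 0 ≤ z.re) (h1 : z.re ≤ Real.pi / 2) :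
    min ‖z‖ 1 * Real.exp |z.im| ≤ 5 * ‖Complex.sin z‖ := by
  have hsq := norm_sin_sq z
  have hn : 0 ≤ ‖Complex.sin z‖ := norm_nonneg _
  -- For |Im z| ≥ 1 the hyperbolic sine of Im z suffices. Otherwise the exponential is at most e <
  -- 3, and Jordan's inequality sin t ≥ 2t/π bounds the sine below by a multiple of |z|.
  rcases le_total 1 |z.im| with h | h
  · have h2 : Real.sinh |z.im| ≤ ‖Complex.sin z‖ := by
      refine abs_le_of_sq_le_sq' ?_ hn |>.2
      rw [hsq]
      have : Real.sinh |z.im| ^ 2 = Real.sinh z.im ^ 2 := by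
        rcases abs_choice z.im with h | h <;> rw [h]
        rw [Real.sinh_neg, neg_sq]
      rw [this]
      nlinarith [sq_nonneg (Real.sin z.re)]
    have h3 : Real.exp (-|z.im|) ≤ 1 / 2 := by
      have h4 : Real.exp (-|z.im|) ≤ Real.exp (-1) := by rw [Real.exp_le_exp]; linarith
      linarith [Real.exp_neg_one_lt_half]
    have h4 : 2 ≤ Real.exp |z.im| := by linarith [Real.add_one_le_exp |z.im|]
    rw [Real.sinh_eq] at h2
    have h5 : min ‖z‖ 1 * Real.exp |z.im| ≤ 1 * Real.exp |z.im| := by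
      gcongr; exact min_le_right _ _
    linarith
  · have h2 : 2 / Real.pi * z.re ≤ Real.sin z.re := Real.mul_le_sin h0 h1
    have hpi : 3 / 5 ≤ 2 / Real.pi := by
      rw [div_le_div_iff₀ (by norm_num) Real.pi_pos]; linarith [Real.pi_lt_d2]
    have h3 : 3 / 5 * z.re ≤ Real.sin z.re :=
      (mul_le_mul_of_nonneg_right hpi h0).trans h2
    have h4 : z.im ^ 2 ≤ Real.sinh z.im ^ 2 := by
      rw [sq_le_sq, Real.abs_sinh]
      exact Real.self_le_sinh_iff.2 (abs_nonneg _)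
    have h5 : (3 / 5 * ‖z‖) ^ 2 ≤ ‖Complex.sin z‖ ^ 2 := by
      rw [hsq, mul_pow, ← Complex.normSq_eq_norm_sq, Complex.normSq_apply]
      nlinarith [sq_nonneg z.im, mul_nonneg h0 h0]
    have h6 := (abs_le_of_sq_le_sq' h5 hn).2
    have h7 : Real.exp |z.im| ≤ 3 := by
      have : Real.exp |z.im| ≤ Real.exp 1 := Real.exp_le_exp.2 h
      linarith [Real.exp_one_lt_d9]
    calc min ‖z‖ 1 * Real.exp |z.im| ≤ ‖z‖ * 3 := by gcongr; exact min_le_left _ _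
      _ ≤ _ := by linarith

theorem half_le_arctan {x : ℝ} (h0 : 0 ≤ x) (h1 : x ≤ 1) : x / 2 ≤ Real.arctan x := by
  by_contra! h
  have h2 : Real.tan (Real.arctan x) < Real.tan (x / 2) := by
    refine Real.tan_lt_tan_of_lt_of_lt_pi_div_two (Real.neg_pi_div_two_lt_arctan x) ?_ h
    linarith [Real.pi_gt_three]
  rw [Real.tan_arctan] at h2
  have hc : 1 / 2 ≤ Real.cos (x / 2) := by
    have := Real.one_sub_sq_div_two_le_cos (x := x / 2)
    nlinarith
  have hs : Real.sin (x / 2) ≤ x / 2 := Real.sin_le (by linarith)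
  rw [Real.tan_eq_sin_div_cos, lt_div_iff₀ (by linarith)] at h2
  nlinarith

theorem arctan_le {x : ℝ} (h0 : 0 ≤ x) : Real.arctan x ≤ x := by
  by_contra! h
  have := Real.le_tan h0 (h.trans (Real.arctan_lt_pi_div_two x))
  have h2 := Real.tan_lt_tan_of_lt_of_lt_pi_div_two (by linarith [Real.pi_gt_three])
    (Real.arctan_lt_pi_div_two x) h
  rw [Real.tan_arctan] at h2
  linarith

/-- The admissible values of `ε`. -/
structure IsAdmissible (k : ℕ) (ε : ℝ) : Prop where
  one_le : 1 ≤ k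
  pos : 0 < ε
  lt : ε < Real.pi / (3 * (2 * k + 1))

namespace IsAdmissible

variable {k : ℕ} {ε : ℝ}

theorem lt_half (h : IsAdmissible k ε) : ε < 1 / 2 := by
  refine h.lt.trans_le ?_
  have : (1 : ℝ) ≤ k := by exact_mod_cast h.one_le
  rw [div_le_div_iff₀ (by positivity) two_pos]
  linarith [Real.pi_lt_d2]

theorem arctan_pos (h : IsAdmissible k ε) : 0 < Real.arctan ε := Real.arctan_pos.2 h.pos

theorem arctan_le (h : IsAdmissible k ε) : Real.arctan ε ≤ ε := Wedge.arctan_le h.pos.le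

theorem half_le_arctan (h : IsAdmissible k ε) : ε / 2 ≤ Real.arctan ε :=
  Wedge.half_le_arctan h.pos.le (by linarith [h.lt_half])

/-- This is where the bound on ε enters: it implies (3k + 3/2)ε < π/2. Hence Re λ ≤ 3k+1 keeps λ
arctan ε in the half period where the sine has no zero except 0. -/
theorem mul_arctan_le (h : IsAdmissible k ε) {b : ℝ} (hb : b ≤ 3 * k + 1) :
    b * Real.arctan ε ≤ Real.pi / 2 := by
  have h1 : (3 * k + 1) * ε ≤ Real.pi / 2 := by
    have := h.lt.le
    rw [le_div_iff₀ (by positivity)] at this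
    nlinarith [h.pos]
  calc b * Real.arctan ε ≤ (3 * k + 1) * ε := by
        have := h.arctan_le
        have := h.arctan_pos
        gcongr
    _ ≤ _ := h1

end IsAdmissible

variable {k : ℕ} {ε : ℝ}

theorem mu_pos (hε : 0 < ε) {z : ℂ} (hz : z ≠ 0) : 0 < mu ε z :=
  lt_min (norm_pos_iff.2 hz) (by positivity)

/-- Since ε/2 ≤ arctan ε, the quantity min(|λ| arctan ε, 1) in the bound for the sine is at least
εμ/2. Dividing by the sine thus gains a factor μ at the cost of 1/ε, with a constant independent of
ε. -/
theorem mu_mul_exp_le_norm_sin (h : IsAdmissible k ε) {z : ℂ} (h0 : 0 ≤ z.re)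
    (h1 : z.re ≤ 3 * k + 1) :
    ε * mu ε z * Real.exp (Real.arctan ε * |z.im|) ≤ 10 * ‖Complex.sin (z * Real.arctan ε)‖ := by
  set α := Real.arctan ε
  have hα : 0 < α := h.arctan_pos
  have hr : (z * α).re = z.re * α := by simp
  have hi : (z * α).im = z.im * α := by simp
  have key := min_mul_exp_le_norm_sin (z := z * α) (by rw [hr]; positivity)
    (by rw [hr]; exact h.mul_arctan_le h1)
  rw [hi, abs_mul, abs_of_pos hα, norm_mul, Complex.norm_real, Real.norm_of_nonneg hα.le,
    mul_comm |z.im|] at key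
  have : ε * mu ε z ≤ 2 * min (‖z‖ * α) 1 := by
    rw [mul_min_of_nonneg _ _ two_pos.le, mu, mul_min_of_nonneg _ _ h.pos.le]
    refine min_le_min ?_ ?_
    · have := h.half_le_arctan
      nlinarith [norm_nonneg z]
    · rw [mul_one_div_cancel h.pos.ne']; norm_num
  calc _ ≤ 2 * min (‖z‖ * α) 1 * Real.exp (α * |z.im|) := by gcongr
    _ ≤ _ := by linarith

theorem sin_mul_arctan_ne_zero (h : IsAdmissible k ε) {z : ℂ} (h0 : 0 < z.re)
    (h1 : z.re ≤ 3 * k + 1) : Complex.sin (z * Real.arctan ε) ≠ 0 := by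
  have hz : z ≠ 0 := fun h => by simp [h] at h0
  have h2 := mu_mul_exp_le_norm_sin h h0.le h1
  have h3 : 0 < ε * mu ε z * Real.exp (Real.arctan ε * |z.im|) :=
    mul_pos (mul_pos h.pos (mu_pos h.pos hz)) (Real.exp_pos _)
  intro h4
  rw [h4, norm_zero] at h2
  linarith

theorem isMultiplier_of_exp_bound {a b C δ : ℝ} {M : ℂ → ℂ} (hδ : 0 < δ)
    (hd : DifferentiableOn ℂ M {z | a < z.re ∧ z.re < b}) (hC : 0 ≤ C)
    (hM : ∀ z : ℂ, a < z.re → z.re < b → ‖M z‖ ≤ C * Real.exp (-(δ * |z.im|))) :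
    IsMultiplier a b M := by
  refine ⟨hd, C * (1 + 2 / δ ^ 2), fun z h1 h2 => (hM z h1 h2).trans ?_⟩
  rw [mul_div_assoc]
  gcongr
  rw [Real.exp_neg, le_div_iff₀ (by positivity), inv_mul_le_iff₀ (Real.exp_pos _)]
  have h3 := Real.pow_div_factorial_le_exp (δ * |z.im|) (by positivity) 2
  have h4 : 1 ≤ Real.exp (δ * |z.im|) := Real.one_le_exp (by positivity)
  rw [mul_pow, sq_abs] at h3
  norm_num [Nat.factorial] at h3
  have h5 : z.im ^ 2 ≤ Real.exp (δ * |z.im|) * (2 / δ ^ 2) := by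
    rw [mul_div_assoc', le_div_iff₀ (by positivity)]
    linarith
  linarith

/-! ### The multipliers with the sine in the denominator. -/

/-- The logarithm of the ratio between `r` and `x` on the upper edge. -/
def logC (ε : ℝ) : ℝ := Real.log (√(1 + ε ^ 2))

theorem logC_nonneg (ε : ℝ) : 0 ≤ logC ε :=
  Real.log_nonneg (Real.one_le_sqrt.2 (by nlinarith [sq_nonneg ε]))

theorem exp_logC (ε : ℝ) : Real.exp (logC ε) = √(1 + ε ^ 2) :=
  Real.exp_log (by positivity)

/-- The multipliers `e^{-λ a} N(λ) / sin (λ α)`, `α = arctan ε`. -/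
def edgeMul (ε : ℝ) (N : ℂ → ℂ) (z : ℂ) : ℂ :=
  Complex.exp (-(z * logC ε)) * N z / Complex.sin (z * Real.arctan ε)

/-- The sine grows like e^{α|Im λ|}, which is set against the exponential type t of the numerator.
The factor e^{-λ log c} has modulus at most 1 because log c ≥ 0 and Re λ > 0. -/
theorem norm_edgeMul_le (h : IsAdmissible k ε) {N : ℂ → ℂ} {z : ℂ} {t C : ℝ} (h0 : 0 < z.re)
    (h1 : z.re ≤ 3 * k + 1) (hN : ‖N z‖ ≤ C * Real.exp (t * |z.im|)) :
    ε * mu ε z * ‖edgeMul ε N z‖ ≤ 10 * C * Real.exp (-((Real.arctan ε - t) * |z.im|)) := by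
  have hs := sin_mul_arctan_ne_zero h h0 h1
  have h2 := mu_mul_exp_le_norm_sin h h0.le h1
  have he : ‖Complex.exp (-(z * logC ε))‖ ≤ 1 := by
    rw [Complex.norm_exp, Real.exp_le_one_iff]
    simp
    exact mul_nonneg h0.le (logC_nonneg ε)
  have hz : z ≠ 0 := fun h => by simp [h] at h0
  have hμ := mu_pos h.pos hz
  rw [edgeMul, norm_div, norm_mul, mul_div_assoc', div_le_iff₀ (norm_pos_iff.2 hs)]
  have e : Real.exp (-((Real.arctan ε - t) * |z.im|))
      = Real.exp (t * |z.im|) * Real.exp (-(Real.arctan ε * |z.im|)) := by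
    rw [← Real.exp_add]; ring_nf
  have h3 : ε * mu ε z ≤ Real.exp (-(Real.arctan ε * |z.im|)) *
      (10 * ‖Complex.sin (z * Real.arctan ε)‖) := by
    rw [Real.exp_neg, ← div_eq_inv_mul, le_div_iff₀ (Real.exp_pos _)]
    exact h2
  calc ε * mu ε z * (‖Complex.exp (-(z * logC ε))‖ * ‖N z‖)
      ≤ (Real.exp (-(Real.arctan ε * |z.im|)) * (10 * ‖Complex.sin (z * Real.arctan ε)‖)) *
        (1 * (C * Real.exp (t * |z.im|))) := by
        have := h.pos
        gcongr
    _ = _ := by rw [e]; ring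

theorem quarter_le_mu (h : IsAdmissible k ε) {z : ℂ} (h0 : 1 / 4 ≤ z.re) : 1 / 4 ≤ mu ε z := by
  refine le_min (h0.trans (Complex.re_le_norm z)) ?_
  have := h.lt_half
  rw [le_div_iff₀ h.pos]
  linarith

/-- For t < α the quotient decays exponentially, so contours can be shifted; at t = α this decay is
lost. The left end 1/4 leaves room to the left of the line Re λ = 1/2 and away from the zero of the
sine at 0. -/
theorem isMultiplier_edgeMul (h : IsAdmissible k ε) {N : ℂ → ℂ} {t C : ℝ}
    (ht : t < Real.arctan ε) (hC : 0 ≤ C)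
    (hd : DifferentiableOn ℂ N {z | 1 / 4 < z.re ∧ z.re < 3 * k + 1})
    (hN : ∀ z : ℂ, 1 / 4 < z.re → z.re < 3 * k + 1 → ‖N z‖ ≤ C * Real.exp (t * |z.im|)) :
    IsMultiplier (1 / 4) (3 * k + 1) (edgeMul ε N) := by
  refine isMultiplier_of_exp_bound (C := 10 * C * (4 / ε)) (sub_pos.2 ht) ?_
    (by have := h.pos; positivity) fun z h1 h2 => ?_
  · unfold edgeMul
    refine DifferentiableOn.div (DifferentiableOn.mul (by fun_prop) hd) (by fun_prop) fun z hz => ?_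
    exact sin_mul_arctan_ne_zero h (by linarith [hz.1]) hz.2.le
  · have h3 := norm_edgeMul_le h (by linarith) h2.le (hN z h1 h2)
    have h4 := quarter_le_mu h h1.le
    have h5 : ε / 4 * ‖edgeMul ε N z‖ ≤ ε * mu ε z * ‖edgeMul ε N z‖ := by
      have := h.pos
      gcongr
      nlinarith
    have h6 := h5.trans h3
    rw [← le_div_iff₀' (by have := h.pos; positivity)] at h6
    refine h6.trans_eq ?_
    have := h.pos.ne'
    field_simp

theorem edgeMul_conj {N : ℂ → ℂ} (hN : ∀ z, N ((starRingEnd ℂ) z) = (starRingEnd ℂ) (N z)) (z : ℂ) :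
    edgeMul ε N ((starRingEnd ℂ) z) = (starRingEnd ℂ) (edgeMul ε N z) := by
  simp only [edgeMul, map_div₀, map_mul, ← Complex.exp_conj, ← Complex.sin_conj, map_neg,
    Complex.conj_ofReal, hN]

/-! ### Inverse Laplace integrals as holomorphic functions. -/

/-- The inverse Laplace integral at complex points. -/
def expInt (β : ℝ) (D : ℝ → ℂ) (w : ℂ) : ℂ := ∫ ξ : ℝ, Complex.exp (line β ξ * w) * D ξ

/-- `D` decays so fast that `expInt β D` converges for `|Im w| ≤ α`. -/
structure HasExpDecay (α : ℝ) (D : ℝ → ℂ) (g : ℝ → ℝ) : Prop where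
  meas : AEStronglyMeasurable D
  integrable : Integrable g
  bound : ∀ ξ, ‖D ξ‖ ≤ Real.exp (-(α * |2 * Real.pi * ξ|)) * g ξ

namespace HasExpDecay

variable {α β : ℝ} {D : ℝ → ℂ} {g : ℝ → ℝ}

theorem norm_le (h : HasExpDecay α D g) {w : ℂ} (hw : |w.im| ≤ α) (ξ : ℝ) :
    ‖Complex.exp (line β ξ * w) * D ξ‖ ≤ Real.exp (β * w.re) * g ξ := by
  have hg : 0 ≤ g ξ := by
    have := (norm_nonneg _).trans (h.bound ξ)
    exact nonneg_of_mul_nonneg_right this (Real.exp_pos _)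
  rw [norm_mul, Complex.norm_exp, Complex.mul_re, line_re, line_im]
  calc _ ≤ Real.exp (β * w.re + α * |2 * Real.pi * ξ|) *
        (Real.exp (-(α * |2 * Real.pi * ξ|)) * g ξ) := by
        refine mul_le_mul (Real.exp_le_exp.2 ?_) (h.bound ξ) (norm_nonneg _) (Real.exp_pos _).le
        have h1 : -(2 * Real.pi * ξ * w.im) ≤ |2 * Real.pi * ξ| * |w.im| := by
          rw [← abs_mul]; exact neg_le_abs _
        have h2 := mul_le_mul_of_nonneg_left hw (abs_nonneg (2 * Real.pi * ξ))
        linarith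
    _ = _ := by
        rw [← mul_assoc, ← Real.exp_add]
        ring_nf

theorem aestronglyMeasurable (h : HasExpDecay α D g) (w : ℂ) :
    AEStronglyMeasurable fun ξ => Complex.exp (line β ξ * w) * D ξ := by
  have := Wedge.continuous_line β
  exact (by fun_prop : Continuous fun ξ => Complex.exp (line β ξ * w)).aestronglyMeasurable.mul
    h.meas

theorem integrable_exp (h : HasExpDecay α D g) {w : ℂ} (hw : |w.im| ≤ α) :
    Integrable fun ξ => Complex.exp (line β ξ * w) * D ξ :=
  (h.integrable.const_mul _).mono' (h.aestronglyMeasurable w)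
    (ae_of_all _ fun ξ => h.norm_le hw ξ)

theorem g_nonneg (h : HasExpDecay α D g) (ξ : ℝ) : 0 ≤ g ξ :=
  nonneg_of_mul_nonneg_right ((norm_nonneg _).trans (h.bound ξ)) (Real.exp_pos _)

theorem continuousOn (h : HasExpDecay α D g) : ContinuousOn (expInt β D) {w | |w.im| ≤ α} := by
  intro w₀ hw₀
  have hev : ∀ᶠ w in 𝓝[{w : ℂ | |w.im| ≤ α}] w₀, β * w.re ≤ β * w₀.re + 1 := by
    refine nhdsWithin_le_nhds ?_
    have : ContinuousAt (fun w : ℂ => β * w.re) w₀ := by fun_prop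
    exact (this.eventually_lt_const (by simp : β * w₀.re < β * w₀.re + 1)).mono fun _ h => h.le
  refine continuousWithinAt_of_dominated (bound := fun ξ => Real.exp (β * w₀.re + 1) * g ξ)
    (Eventually.of_forall fun w => h.aestronglyMeasurable w) ?_ (h.integrable.const_mul _)
    (ae_of_all _ fun ξ => ?_)
  · filter_upwards [hev, self_mem_nhdsWithin] with w hw hw'
    refine ae_of_all _ fun ξ => (h.norm_le hw' ξ).trans ?_
    have := h.g_nonneg ξ
    gcongr
  · exact (by fun_prop : Continuous fun w : ℂ => Complex.exp (line β ξ * w) * D ξ).continuousWithinAt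

theorem hasDerivAt {D' : ℝ → ℂ} (h : HasExpDecay α D g) {g' : ℝ → ℝ} (h' : HasExpDecay α D' g')
    (hD : ∀ ξ, D' ξ = line β ξ * D ξ) {w₀ : ℂ} (hw₀ : |w₀.im| < α) :
    HasDerivAt (expInt β D) (expInt β D' w₀) w₀ := by
  have hc : ContinuousAt (fun w : ℂ => |w.im|) w₀ := by fun_prop
  have hc' : ContinuousAt (fun w : ℂ => β * w.re) w₀ := by fun_prop
  have hev : ∀ᶠ w in 𝓝 w₀, β * w.re < β * w₀.re + 1 ∧ |w.im| < α :=
    (hc'.eventually_lt_const (by simp)).and (hc.eventually_lt_const hw₀)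
  refine (hasDerivAt_integral_of_dominated_loc_of_deriv_le
    (F := fun w ξ => Complex.exp (line β ξ * w) * D ξ)
    (F' := fun w ξ => Complex.exp (line β ξ * w) * D' ξ)
    (bound := fun ξ => Real.exp (β * w₀.re + 1) * g' ξ) hev
    (Eventually.of_forall fun w => h.aestronglyMeasurable w) (h.integrable_exp hw₀.le)
    (h'.aestronglyMeasurable w₀) (ae_of_all _ fun ξ w hw => ?_) (h'.integrable.const_mul _)
    (ae_of_all _ fun ξ w hw => ?_)).2
  · refine (h'.norm_le hw.2.le ξ).trans ?_
    have := h'.g_nonneg ξ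
    gcongr
    exact hw.1.le
  · have h1 : HasDerivAt (fun w : ℂ => line β ξ * w) (line β ξ) w := by
      simpa using (hasDerivAt_id w).const_mul (line β ξ)
    have h2 := h1.cexp.mul_const (D ξ)
    refine h2.congr_deriv ?_
    rw [hD]; ring

end HasExpDecay

/-! ### Harmonic functions as real parts, and the sector. -/

/-- The complex variable `x + i ε y`. -/
def cvar (ε : ℝ) (z : ℝ × ℝ) : ℂ := (z.1 : ℂ) + ε * z.2 * Complex.I

@[simp] theorem cvar_re (ε : ℝ) (z : ℝ × ℝ) : (cvar ε z).re = z.1 := by simp [cvar]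

@[simp] theorem cvar_im (ε : ℝ) (z : ℝ × ℝ) : (cvar ε z).im = ε * z.2 := by simp [cvar]

theorem continuous_cvar (ε : ℝ) : Continuous (cvar ε) := by unfold cvar; fun_prop

theorem contDiff_cvar (ε : ℝ) {n : WithTop ℕ∞} : ContDiff ℝ n (cvar ε) := by
  unfold cvar
  have : ContDiff ℝ n (fun x : ℝ => (x : ℂ)) := Complex.ofRealCLM.contDiff
  exact (this.comp contDiff_fst).add ((contDiff_const.mul (this.comp contDiff_snd)).mul
    contDiff_const)

theorem hasDerivAt_cvar_fst (ε x y : ℝ) : HasDerivAt (fun x => cvar ε (x, y)) 1 x := by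
  unfold cvar
  simpa using (Complex.ofRealCLM.hasDerivAt (x := x)).add_const (ε * y * Complex.I : ℂ)

theorem hasDerivAt_cvar_snd (ε x y : ℝ) :
    HasDerivAt (fun y => cvar ε (x, y)) (ε * Complex.I) y := by
  unfold cvar
  have := ((Complex.ofRealCLM.hasDerivAt (x := y)).const_mul (ε : ℂ)).mul_const Complex.I
  simpa using this.const_add (x : ℂ)

theorem hasDerivAt_re_comp {A : ℂ → ℂ} {A' c' : ℂ} {c : ℝ → ℂ} {x : ℝ} (hA : HasDerivAt A A' (c x))
    (hc : HasDerivAt c c' x) : HasDerivAt (fun x => (A (c x)).re) (A' * c').re x := by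
  have := hA.comp x hc
  exact Complex.reCLM.hasFDerivAt.comp_hasDerivAt x this

/-- The real part of a sum of a holomorphic function of `x + i ε y` and one of `x - i ε y`. -/
def reSum (ε : ℝ) (A B : ℂ → ℂ) (z : ℝ × ℝ) : ℝ := (A (cvar ε z)).re + (B (cvar (-ε) z)).re

theorem hasDerivAt_reSum_fst {ε x y : ℝ} {A B : ℂ → ℂ} {A' B' : ℂ}
    (hA : HasDerivAt A A' (cvar ε (x, y))) (hB : HasDerivAt B B' (cvar (-ε) (x, y))) :
    HasDerivAt (fun x => reSum ε A B (x, y)) (A'.re + B'.re) x := by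
  have h1 := hasDerivAt_re_comp (c := fun x => cvar ε (x, y)) hA (hasDerivAt_cvar_fst ε x y)
  have h2 := hasDerivAt_re_comp (c := fun x => cvar (-ε) (x, y)) hB (hasDerivAt_cvar_fst (-ε) x y)
  refine (h1.add h2).congr_deriv ?_
  simp

theorem hasDerivAt_reSum_snd {ε x y : ℝ} {A B : ℂ → ℂ} {A' B' : ℂ}
    (hA : HasDerivAt A A' (cvar ε (x, y))) (hB : HasDerivAt B B' (cvar (-ε) (x, y))) :
    HasDerivAt (fun y => reSum ε A B (x, y)) (-(ε * A'.im) + ε * B'.im) y := by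
  have h1 := hasDerivAt_re_comp (c := fun y => cvar ε (x, y)) hA (hasDerivAt_cvar_snd ε x y)
  have h2 := hasDerivAt_re_comp (c := fun y => cvar (-ε) (x, y)) hB (hasDerivAt_cvar_snd (-ε) x y)
  refine (h1.add h2).congr_deriv ?_
  simp
  ring

theorem contDiffOn_reSum {ε : ℝ} {A B : ℂ → ℂ} {S T : Set ℂ} {U : Set (ℝ × ℝ)} (hS : IsOpen S)
    (hT : IsOpen T) (hA : DifferentiableOn ℂ A S) (hB : DifferentiableOn ℂ B T)
    (hUS : ∀ z ∈ U, cvar ε z ∈ S) (hUT : ∀ z ∈ U, cvar (-ε) z ∈ T) {n : WithTop ℕ∞} :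
    ContDiffOn ℝ n (reSum ε A B) U := by
  have h1 : ContDiffOn ℝ n A S := (hA.contDiffOn hS).restrict_scalars ℝ
  have h2 : ContDiffOn ℝ n B T := (hB.contDiffOn hT).restrict_scalars ℝ
  exact (Complex.reCLM.contDiff.comp_contDiffOn
    (h1.comp (contDiff_cvar ε).contDiffOn hUS)).add (Complex.reCLM.contDiff.comp_contDiffOn
    (h2.comp (contDiff_cvar (-ε)).contDiffOn hUT))

/-- Differentiation in y multiplies the holomorphic derivative by ±iε, so the second derivative in y
is -ε² times the one in x. -/
theorem isEpsHarmonicOn_reSum {ε : ℝ} (hε : ε ≠ 0) {A B : ℂ → ℂ} {S T : Set ℂ} {U : Set (ℝ × ℝ)}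
    (hS : IsOpen S) (hT : IsOpen T) (hA : DifferentiableOn ℂ A S) (hB : DifferentiableOn ℂ B T)
    (hUS : ∀ z ∈ U, cvar ε z ∈ S) (hUT : ∀ z ∈ U, cvar (-ε) z ∈ T) :
    IsEpsHarmonicOn ε (reSum ε A B) U := by
  refine ⟨contDiffOn_reSum hS hT hA hB hUS hUT, ?_⟩
  rintro ⟨x, y⟩ hz
  have hA1 : ∀ w ∈ S, HasDerivAt A (deriv A w) w := fun w hw =>
    (hA.differentiableAt (hS.mem_nhds hw)).hasDerivAt
  have hB1 : ∀ w ∈ T, HasDerivAt B (deriv B w) w := fun w hw =>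
    (hB.differentiableAt (hT.mem_nhds hw)).hasDerivAt
  have hA2 : HasDerivAt (deriv A) (deriv (deriv A) (cvar ε (x, y))) (cvar ε (x, y)) :=
    ((hA.deriv hS).differentiableAt (hS.mem_nhds (hUS _ hz))).hasDerivAt
  have hB2 : HasDerivAt (deriv B) (deriv (deriv B) (cvar (-ε) (x, y))) (cvar (-ε) (x, y)) :=
    ((hB.deriv hT).differentiableAt (hT.mem_nhds (hUT _ hz))).hasDerivAt
  have hSx : ∀ᶠ x' in 𝓝 x, cvar ε (x', y) ∈ S ∧ cvar (-ε) (x', y) ∈ T := by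
    have c1 : Continuous fun x' => cvar ε (x', y) :=
      (continuous_cvar ε).comp (by fun_prop)
    have c2 : Continuous fun x' => cvar (-ε) (x', y) :=
      (continuous_cvar (-ε)).comp (by fun_prop)
    exact (c1.continuousAt.eventually (hS.mem_nhds (hUS _ hz))).and
      (c2.continuousAt.eventually (hT.mem_nhds (hUT _ hz)))
  have hSy : ∀ᶠ y' in 𝓝 y, cvar ε (x, y') ∈ S ∧ cvar (-ε) (x, y') ∈ T := by
    have c1 : Continuous fun y' => cvar ε (x, y') :=
      (continuous_cvar ε).comp (by fun_prop)
    have c2 : Continuous fun y' => cvar (-ε) (x, y') :=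
      (continuous_cvar (-ε)).comp (by fun_prop)
    exact (c1.continuousAt.eventually (hS.mem_nhds (hUS _ hz))).and
      (c2.continuousAt.eventually (hT.mem_nhds (hUT _ hz)))
  have ex : iteratedDeriv 2 (fun x => reSum ε A B (x, y)) x
      = (deriv (deriv A) (cvar ε (x, y))).re + (deriv (deriv B) (cvar (-ε) (x, y))).re := by
    rw [iteratedDeriv_succ, iteratedDeriv_one]
    have : deriv (fun x => reSum ε A B (x, y)) =ᶠ[𝓝 x]
        fun x => reSum ε (deriv A) (deriv B) (x, y) := by
      filter_upwards [hSx] with x' hx'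
      exact (hasDerivAt_reSum_fst (hA1 _ hx'.1) (hB1 _ hx'.2)).deriv
    rw [this.deriv_eq]
    exact (hasDerivAt_reSum_fst hA2 hB2).deriv
  have ey : iteratedDeriv 2 (fun y => reSum ε A B (x, y)) y
      = -ε ^ 2 * ((deriv (deriv A) (cvar ε (x, y))).re
        + (deriv (deriv B) (cvar (-ε) (x, y))).re) := by
    rw [iteratedDeriv_succ, iteratedDeriv_one]
    have : deriv (fun y => reSum ε A B (x, y)) =ᶠ[𝓝 y] fun y => reSum ε
        (fun w => (ε * Complex.I) * deriv A w) (fun w => (-ε * Complex.I) * deriv B w) (x, y) := by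
      filter_upwards [hSy] with y' hy'
      rw [(hasDerivAt_reSum_snd (hA1 _ hy'.1) (hB1 _ hy'.2)).deriv]
      simp [reSum]
    rw [this.deriv_eq, (hasDerivAt_reSum_snd (hA2.const_mul _) (hB2.const_mul _)).deriv]
    simp
    ring
  change iteratedDeriv 2 (fun x => reSum ε A B (x, y)) x
    + (1 / ε) ^ 2 * iteratedDeriv 2 (fun y => reSum ε A B (x, y)) y = 0
  rw [ex, ey]
  field_simp
  ring

/-- The open sector of the complex variable which corresponds to the wedge and its reflection. -/
def sector (ε : ℝ) : Set ℂ := {z | 0 < z.re ∧ |z.im| < ε * z.re}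

theorem isOpen_sector (ε : ℝ) : IsOpen (sector ε) :=
  (isOpen_lt continuous_const Complex.continuous_re).inter
    (isOpen_lt (continuous_abs.comp Complex.continuous_im)
      (continuous_const.mul Complex.continuous_re))

theorem isOpen_wedge : IsOpen wedge :=
  (isOpen_lt continuous_const continuous_fst).inter
    ((isOpen_lt continuous_const continuous_snd).inter (isOpen_lt continuous_snd continuous_fst))

theorem cvar_mem_sector {ε : ℝ} (hε : 0 < ε) {z : ℝ × ℝ} (hz : z ∈ wedge) :
    cvar ε z ∈ sector ε ∧ cvar (-ε) z ∈ sector ε := by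
  obtain ⟨h1, h2, h3⟩ := hz
  have : |ε * z.2| < ε * z.1 := by
    rw [abs_of_pos (mul_pos hε h2)]
    exact mul_lt_mul_of_pos_left h3 hε
  exact ⟨⟨by simpa, by simpa using this⟩, ⟨by simpa, by simpa using this⟩⟩

theorem abs_arg_lt_arctan {ε : ℝ} {z : ℂ} (hz : z ∈ sector ε) : |z.arg| < Real.arctan ε := by
  obtain ⟨h1, h2⟩ := hz
  have h3 : |z.arg| < Real.pi / 2 := Complex.abs_arg_lt_pi_div_two_iff.2 (Or.inl h1)
  have h4 : Real.arctan (Real.tan z.arg) = z.arg :=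
    Real.arctan_tan (abs_lt.1 h3).1 (abs_lt.1 h3).2
  rw [Complex.tan_arg] at h4
  rw [← h4, abs_lt, ← Real.arctan_neg]
  rw [abs_lt] at h2
  constructor
  · refine Real.arctan_strictMono ?_
    rw [lt_div_iff₀ h1]; linarith
  · refine Real.arctan_strictMono ?_
    rw [div_lt_iff₀ h1]; linarith

theorem mem_slitPlane_of_re_pos {z : ℂ} (h : 0 < z.re) : z ∈ Complex.slitPlane := Or.inl h

theorem cvar_polar {ε : ℝ} (hε : ε ≠ 0) (u v : ℝ) :
    cvar ε (polar ε u v) = Complex.exp (u + ε * v * Complex.I) := by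
  have hε' : (ε : ℂ) ≠ 0 := by exact_mod_cast hε
  rw [Complex.exp_add, ← Complex.ofReal_mul, Complex.exp_mul_I, ← Complex.ofReal_exp,
    ← Complex.ofReal_cos, ← Complex.ofReal_sin, cvar, polar]
  push_cast
  field_simp

theorem cvar_neg_polar {ε : ℝ} (hε : ε ≠ 0) (u v : ℝ) :
    cvar (-ε) (polar ε u v) = Complex.exp (u - ε * v * Complex.I) := by
  have hε' : (ε : ℂ) ≠ 0 := by exact_mod_cast hε
  rw [sub_eq_add_neg, Complex.exp_add, ← neg_mul, ← Complex.ofReal_mul, ← Complex.ofReal_neg,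
    Complex.exp_mul_I, ← Complex.ofReal_exp,
    ← Complex.ofReal_cos, ← Complex.ofReal_sin, cvar, polar, Real.cos_neg, Real.sin_neg]
  push_cast
  field_simp

/-- The coordinates are u = Re log(x + iεy) and εv = Im log(x + iεy). Together with
`polar_mem_wedge` this identifies the wedge with the strip. -/
theorem exists_polar {ε : ℝ} (hε : 0 < ε) {z : ℝ × ℝ} (hz : z ∈ wedge) :
    ∃ u v, v ∈ Ioo 0 (vTop ε) ∧ polar ε u v = z := by
  have hs := (cvar_mem_sector hε hz).1
  have hne : cvar ε z ≠ 0 := fun h => by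
    have := hs.1
    rw [h] at this
    simp at this
  set w := Complex.log (cvar ε z)
  have hw : Complex.exp w = cvar ε z := Complex.exp_log hne
  have him : w.im = (cvar ε z).arg := Complex.log_im _
  refine ⟨w.re, w.im / ε, ⟨?_, ?_⟩, ?_⟩
  · refine div_pos ?_ hε
    have h0 : 0 ≤ w.im := by
      rw [him, Complex.arg_nonneg_iff, cvar_im]
      exact (mul_pos hε hz.2.1).le
    refine lt_of_le_of_ne h0 fun h => ?_
    rw [him] at h
    have := (Complex.arg_eq_zero_iff.1 h.symm).2
    rw [cvar_im] at this
    exact (mul_pos hε hz.2.1).ne' this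
  · rw [vTop]
    gcongr
    rw [him]
    exact (le_abs_self _).trans_lt (abs_arg_lt_arctan hs)
  · have h1 : cvar ε (polar ε w.re (w.im / ε)) = cvar ε z := by
      rw [cvar_polar hε.ne', ← hw]
      congr 1
      apply Complex.ext <;> simp
      field_simp
    have h2 := congrArg Complex.re h1
    have h3 := congrArg Complex.im h1
    simp only [cvar_re, cvar_im] at h2 h3
    exact Prod.ext h2 (mul_left_cancel₀ hε.ne' h3)

/-! ### The harmonic extension of data on the upper edge. -/

/-- The derivative `f` (in logarithmic coordinates) of the boundary values on the upper edge, with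
its Laplace transforms. -/
structure IsEdgeData (k : ℕ) (ε : ℝ) (f : ℝ → ℝ) (G : ℝ → ℝ → ℂ) : Prop where
  adm : IsAdmissible k ε
  laplace : ∀ β ∈ Icc (1 / 2 : ℝ) (3 * k + 1 / 2), IsLaplaceOnLine β f (G β)
  integrable : ∀ β ∈ Icc (1 / 2 : ℝ) (3 * k + 1 / 2), Integrable (G β)

/-- The boundary multiplier family `N t`, `0 ≤ t ≤ α`. -/
structure IsEdgeFamily (k : ℕ) (ε C : ℝ) (N : ℝ → ℂ → ℂ) : Prop where
  nonneg : 0 ≤ C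
  differentiableOn : ∀ t, DifferentiableOn ℂ (N t) {z | 1 / 4 < z.re ∧ z.re < 3 * k + 1}
  bound : ∀ t, 0 ≤ t → ∀ z : ℂ, 1 / 4 < z.re → z.re < 3 * k + 1 →
    ‖N t z‖ ≤ C * Real.exp (t * |z.im|)
  continuous : ∀ z, Continuous fun t => N t z
  conj : ∀ t z, N t ((starRingEnd ℂ) z) = (starRingEnd ℂ) (N t z)

/-- This and the next two are the numerators of the x-derivative, the y-derivative and the extension
itself at the angle t = εv. The shift λ - 1 in the derivatives arises because differentiating a
function of log z divides by z. -/
theorem isEdgeFamily_sin (k : ℕ) (ε : ℝ) :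
    IsEdgeFamily k ε 1 fun t z => Complex.sin ((z - 1) * t) where
  nonneg := zero_le_one
  differentiableOn t := by fun_prop
  bound t ht z _ _ := by
    refine (norm_sin_le _).trans_eq ?_
    simp [abs_mul, abs_of_nonneg ht, mul_comm]
  continuous z := by fun_prop
  conj t z := by simp [← Complex.sin_conj]

theorem isEdgeFamily_cos (k : ℕ) {ε : ℝ} (hε : 0 ≤ ε) :
    IsEdgeFamily k ε ε fun t z => ε * Complex.cos ((z - 1) * t) where
  nonneg := hε
  differentiableOn t := by fun_prop
  bound t ht z _ _ := by
    rw [norm_mul, Complex.norm_real, Real.norm_of_nonneg hε]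
    refine mul_le_mul_of_nonneg_left ((norm_cos_le _).trans_eq ?_) hε
    simp [abs_mul, abs_of_nonneg ht, mul_comm]
  continuous z := by fun_prop
  conj t z := by simp [← Complex.cos_conj]

theorem isEdgeFamily_sin_div (k : ℕ) (ε : ℝ) :
    IsEdgeFamily k ε 4 fun t z => Complex.sin (z * t) / z where
  nonneg := by norm_num
  differentiableOn t := by
    refine DifferentiableOn.div (by fun_prop) (by fun_prop) fun z hz h => ?_
    have := hz.1
    rw [h] at this
    norm_num at this
  bound t ht z h1 _ := by
    have h2 : 1 / 4 ≤ ‖z‖ := h1.le.trans (Complex.re_le_norm z)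
    have h3 := norm_sin_le (z * t)
    have h4 : |(z * t).im| = t * |z.im| := by simp [abs_mul, abs_of_nonneg ht, mul_comm]
    rw [h4] at h3
    rw [norm_div, div_le_iff₀ (by linarith)]
    nlinarith [Real.exp_pos (t * |z.im|)]
  continuous z := by fun_prop
  conj t z := by simp [← Complex.sin_conj]

theorem half_le_mu {k : ℕ} {ε : ℝ} (h : IsAdmissible k ε) {z : ℂ} (h0 : 1 / 2 ≤ z.re) :
    1 / 2 ≤ mu ε z := by
  refine le_min (h0.trans (Complex.re_le_norm z)) ?_
  have := h.lt_half
  rw [le_div_iff₀ h.pos]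
  linarith

/-- On lines with β ≥ 1/2 one has μ ≥ 1/2, which turns the constant 10 into 20. Only boundedness is
left, and it includes the endpoint t = α. -/
theorem IsEdgeFamily.norm_edgeMul_le {k : ℕ} {ε C : ℝ} {N : ℝ → ℂ → ℂ} (hN : IsEdgeFamily k ε C N)
    (h : IsAdmissible k ε) {t β ξ : ℝ} (ht : t ∈ Icc 0 (Real.arctan ε))
    (hβ : β ∈ Icc (1 / 2 : ℝ) (3 * k + 1 / 2)) :
    ε * ‖edgeMul ε (N t) (line β ξ)‖ ≤ 20 * C := by
  have h1 := Wedge.norm_edgeMul_le h (z := line β ξ) (by rw [line_re]; linarith [hβ.1])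
    (by rw [line_re]; linarith [hβ.2])
    (hN.bound t ht.1 (line β ξ) (by rw [line_re]; linarith [hβ.1])
      (by rw [line_re]; linarith [hβ.2]))
  have h2 := half_le_mu h (z := line β ξ) (by rw [line_re]; exact hβ.1)
  have h3 : Real.exp (-((Real.arctan ε - t) * |(line β ξ).im|)) ≤ 1 := by
    rw [Real.exp_le_one_iff]
    have := mul_nonneg (sub_nonneg.2 ht.2) (abs_nonneg (line β ξ).im)
    linarith
  have h4 := hN.nonneg
  have h5 := mul_le_mul_of_nonneg_left h3 (by positivity : 0 ≤ 10 * C)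
  have h6 : 0 ≤ ε * ‖edgeMul ε (N t) (line β ξ)‖ := mul_nonneg h.pos.le (norm_nonneg _)
  nlinarith

theorem IsEdgeFamily.continuous_edgeMul {k : ℕ} {ε C : ℝ} {N : ℝ → ℂ → ℂ}
    (hN : IsEdgeFamily k ε C N) (h : IsAdmissible k ε) {t β : ℝ}
    (hβ : β ∈ Icc (1 / 2 : ℝ) (3 * k + 1 / 2)) : Continuous fun ξ => edgeMul ε (N t) (line β ξ) := by
  have hd : DifferentiableOn ℂ (edgeMul ε (N t)) {z | 1 / 4 < z.re ∧ z.re < 3 * k + 1} := by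
    unfold edgeMul
    refine DifferentiableOn.div (DifferentiableOn.mul (by fun_prop) (hN.differentiableOn t))
      (by fun_prop) fun z hz => ?_
    exact sin_mul_arctan_ne_zero h (by linarith [hz.1]) hz.2.le
  refine hd.continuousOn.comp_continuous (continuous_line β) fun ξ => ⟨?_, ?_⟩
  · rw [line_re]; linarith [hβ.1]
  · rw [line_re]; linarith [hβ.2]

namespace IsEdgeData

variable {k : ℕ} {ε : ℝ} {f : ℝ → ℝ} {G : ℝ → ℝ → ℂ}

theorem half_mem : (1 / 2 : ℝ) ∈ Icc (1 / 2 : ℝ) (3 * k + 1 / 2) :=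
  ⟨le_rfl, by have : (0 : ℝ) ≤ k := Nat.cast_nonneg k
              linarith⟩

theorem one_mem (h : IsEdgeData k ε f G) : (1 : ℝ) ∈ Icc (1 / 2 : ℝ) (3 * k + 1 / 2) :=
  ⟨by norm_num, by have : (1 : ℝ) ≤ k := by exact_mod_cast h.adm.one_le
                   linarith⟩

theorem memLp (h : IsEdgeData k ε f G) {β : ℝ} (hβ : β ∈ Icc (1 / 2 : ℝ) (3 * k + 1 / 2)) :
    MemLp (G β) 2 := (isLaplaceOnLine_iff.1 (h.laplace β hβ)).memLp_transform

theorem integrable_edgeMul (h : IsEdgeData k ε f G) {C : ℝ} {N : ℝ → ℂ → ℂ}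
    (hN : IsEdgeFamily k ε C N) {t β : ℝ} (ht : t ∈ Icc 0 (Real.arctan ε))
    (hβ : β ∈ Icc (1 / 2 : ℝ) (3 * k + 1 / 2)) :
    Integrable (fun ξ => edgeMul ε (N t) (line β ξ) * G β ξ) ∧
      MemLp (fun ξ => edgeMul ε (N t) (line β ξ) * G β ξ) 2 := by
  have hc := hN.continuous_edgeMul h.adm (t := t) hβ
  have hb : ∀ ξ, ‖edgeMul ε (N t) (line β ξ)‖ ≤ 20 * C / ε := fun ξ => by
    rw [le_div_iff₀' h.adm.pos]
    exact hN.norm_edgeMul_le h.adm ht hβ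
  constructor
  · refine (((h.integrable β hβ).norm.const_mul (20 * C / ε))).mono'
      (hc.aestronglyMeasurable.mul (h.integrable β hβ).1) (ae_of_all _ fun ξ => ?_)
    rw [norm_mul]
    exact mul_le_mul_of_nonneg_right (hb ξ) (norm_nonneg _)
  · refine (h.memLp hβ).of_le_mul (c := 20 * C / ε)
      (hc.aestronglyMeasurable.mul (h.integrable β hβ).1) (ae_of_all _ fun ξ => ?_)
    rw [norm_mul]
    exact mul_le_mul_of_nonneg_right (hb ξ) (norm_nonneg _)

/-- The edge integrals do not depend on the line, and are real. -/
theorem invL_edgeMul_eq (h : IsEdgeData k ε f G) {C : ℝ} {N : ℝ → ℂ → ℂ}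
    (hN : IsEdgeFamily k ε C N) {t : ℝ} (ht : t ∈ Icc 0 (Real.arctan ε)) {β : ℝ}
    (hβ : β ∈ Icc (1 / 2 : ℝ) (3 * k + 1 / 2)) (u : ℝ) :
    invL β (fun ξ => edgeMul ε (N t) (line β ξ) * G β ξ) u
      = ((invL (1 / 2) (fun ξ => edgeMul ε (N t) (line (1 / 2) ξ) * G (1 / 2) ξ) u).re : ℂ) := by
  have hk : (0 : ℝ) ≤ k := Nat.cast_nonneg k
  -- Strictly below the edge the multiplier decays, and both integrals are the convolution of f with
  -- the same real kernel.
  have hlt : ∀ t, 0 ≤ t → t < Real.arctan ε → ∀ β ∈ Icc (1 / 2 : ℝ) (3 * k + 1 / 2),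
      invL β (fun ξ => edgeMul ε (N t) (line β ξ) * G β ξ) u
      = ((invL (1 / 2) (fun ξ => edgeMul ε (N t) (line (1 / 2) ξ) * G (1 / 2) ξ) u).re : ℂ) := by
    intro t ht0 ht β hβ
    have hM := isMultiplier_edgeMul h.adm ht hN.nonneg (hN.differentiableOn t) (hN.bound t ht0)
    obtain ⟨Q, hQ⟩ := hM.exists_real_eq_invL (by linarith) (edgeMul_conj (hN.conj t)) f
    rw [hQ β (by linarith [hβ.1]) (by linarith [hβ.2]) _ (h.laplace β hβ),
      hQ (1 / 2) (by norm_num) (by linarith) _ (h.laplace _ half_mem), Complex.ofReal_re]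
  rcases ht.2.lt_or_eq with ht' | ht'
  · exact hlt t ht.1 ht' β hβ
  -- At t = α the identity is obtained as a limit from below by dominated convergence. The bound
  -- uniform in t and the integrability of G on each line provide the majorant.
  · have hlim : ∀ β ∈ Icc (1 / 2 : ℝ) (3 * k + 1 / 2),
        Tendsto (fun s => invL β (fun ξ => edgeMul ε (N s) (line β ξ) * G β ξ) u)
          (𝓝[Ico 0 (Real.arctan ε)] t)
          (𝓝 (invL β (fun ξ => edgeMul ε (N t) (line β ξ) * G β ξ) u)) := by
      intro β hβ
      have hexp : Continuous fun ξ => Complex.exp (line β ξ * u) := by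
        have := continuous_line β
        fun_prop
      refine tendsto_integral_filter_of_dominated_convergence
        (fun ξ => Real.exp (β * u) * (20 * C / ε * ‖G β ξ‖)) ?_ ?_
        (((h.integrable β hβ).norm.const_mul _).const_mul _) (ae_of_all _ fun ξ => ?_)
      · exact Eventually.of_forall fun s => hexp.aestronglyMeasurable.mul
          ((hN.continuous_edgeMul h.adm hβ).aestronglyMeasurable.mul (h.integrable β hβ).1)
      · filter_upwards [self_mem_nhdsWithin] with s hs
        refine ae_of_all _ fun ξ => ?_
        rw [norm_mul, norm_exp_line_mul, norm_mul]
        gcongr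
        rw [le_div_iff₀' h.adm.pos]
        exact hN.norm_edgeMul_le h.adm ⟨hs.1, hs.2.le⟩ hβ
      · have := hN.continuous (line β ξ)
        have hc : Continuous fun s => Complex.exp (line β ξ * u) *
            (edgeMul ε (N s) (line β ξ) * G β ξ) := by
          unfold edgeMul
          fun_prop
        exact (hc.tendsto t).mono_left nhdsWithin_le_nhds
    have : (𝓝[Ico 0 (Real.arctan ε)] t).NeBot := by
      rw [ht']
      rw [← mem_closure_iff_nhdsWithin_neBot, closure_Ico h.adm.arctan_pos.ne]
      exact right_mem_Icc.2 h.adm.arctan_pos.le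
    refine tendsto_nhds_unique (hlim β hβ) ?_
    have h2 := (Complex.continuous_ofReal.comp Complex.continuous_re).continuousAt.tendsto.comp
      (hlim _ half_mem)
    refine h2.congr' ?_
    filter_upwards [self_mem_nhdsWithin] with s hs
    exact (hlt s hs.1 hs.2 β hβ).symm

end IsEdgeData

/-- The Laplace density of the holomorphic derivative. -/
def edgeDensity (ε : ℝ) (G : ℝ → ℝ → ℂ) (ξ : ℝ) : ℂ :=
  edgeMul ε (fun _ => 1 / (2 * Complex.I)) (line (1 / 2) ξ) * G (1 / 2) ξ

/-- The Laplace density of the holomorphic potential. -/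
def edgeDensity₀ (ε : ℝ) (G : ℝ → ℝ → ℂ) (ξ : ℝ) : ℂ :=
  edgeDensity ε G ξ / line (1 / 2) ξ

/-- The holomorphic potential on the sector. -/
def potential (ε : ℝ) (G : ℝ → ℝ → ℂ) (z : ℂ) : ℂ :=
  expInt (1 / 2) (edgeDensity₀ ε G) (Complex.log z)

/-- The derivative of the holomorphic potential. -/
def potentialDeriv (ε : ℝ) (G : ℝ → ℝ → ℂ) (z : ℂ) : ℂ :=
  expInt (1 / 2) (edgeDensity ε G) (Complex.log z) / z

/-- The harmonic extension to the wedge. -/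
def extension (ε : ℝ) (G : ℝ → ℝ → ℂ) : ℝ × ℝ → ℝ :=
  reSum ε (potential ε G) (fun z => -potential ε G z)

/-- The horizontal derivative of the extension. -/
def extensionX (ε : ℝ) (G : ℝ → ℝ → ℂ) : ℝ × ℝ → ℝ :=
  reSum ε (potentialDeriv ε G) (fun z => -potentialDeriv ε G z)

/-- The vertical derivative of the extension. -/
def extensionY (ε : ℝ) (G : ℝ → ℝ → ℂ) : ℝ × ℝ → ℝ :=
  reSum ε (fun z => ε * Complex.I * potentialDeriv ε G z)
    (fun z => ε * Complex.I * potentialDeriv ε G z)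

theorem line_ne_zero {β : ℝ} (hβ : β ≠ 0) (ξ : ℝ) : line β ξ ≠ 0 := fun h => by
  have := congrArg Complex.re h
  simp at this
  exact hβ this

/-- The closed sector without its vertex. -/
def closedSector (ε : ℝ) : Set ℂ := {z | 0 < z.re ∧ |z.im| ≤ ε * z.re}

/-- Apart from the vertex the closed sector lies in every open sector of larger opening. -/
theorem abs_arg_le_arctan {ε : ℝ} {z : ℂ} (hz : z ∈ closedSector ε) :
    |z.arg| ≤ Real.arctan ε := by
  refine le_of_forall_gt_imp_ge_of_dense fun b hb => ?_
  by_cases hbp : b < Real.pi / 2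
  · have h1 : -(Real.pi / 2) < b := (Real.neg_pi_div_two_lt_arctan ε).trans hb
    have h2 : Real.arctan (Real.tan b) = b := Real.arctan_tan h1 hbp
    rw [← h2] at hb ⊢
    have h3 : ε < Real.tan b := Real.arctan_strictMono.lt_iff_lt.1 hb
    refine (abs_arg_lt_arctan ⟨hz.1, hz.2.trans_lt ?_⟩).le
    exact mul_lt_mul_of_pos_right h3 hz.1
  · exact (Complex.abs_arg_lt_pi_div_two_iff.2 (Or.inl hz.1)).le.trans (not_lt.1 hbp)

namespace IsEdgeData

variable {k : ℕ} {ε : ℝ} {f : ℝ → ℝ} {G : ℝ → ℝ → ℂ}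

/-- The rate is exactly α, without loss. The potential and its derivative therefore extend
continuously to the closed sector away from the vertex, which is what gives the traces. -/
theorem hasExpDecay (h : IsEdgeData k ε f G) :
    HasExpDecay (Real.arctan ε) (edgeDensity ε G) (fun ξ => 20 / ε * ‖G (1 / 2) ξ‖) := by
  have hk : (0 : ℝ) ≤ k := Nat.cast_nonneg k
  have hN : ∀ z : ℂ, 1 / 4 < z.re → z.re < 3 * k + 1 →
      ‖(fun _ : ℂ => 1 / (2 * Complex.I)) z‖ ≤ 1 * Real.exp (0 * |z.im|) := by
    intro z _ _
    simp
    norm_num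
  have hM := isMultiplier_edgeMul h.adm h.adm.arctan_pos zero_le_one (by fun_prop) hN
  refine ⟨?_, (h.integrable _ half_mem).norm.const_mul _, fun ξ => ?_⟩
  · exact (hM.continuous_line (by norm_num) (by linarith)).aestronglyMeasurable.mul
      (h.integrable _ half_mem).1
  · have h1 := norm_edgeMul_le (N := fun _ => 1 / (2 * Complex.I)) (t := 0) (C := 1) h.adm
      (z := line (1 / 2) ξ) (by simp) (by rw [line_re]; linarith)
      (hN _ (by rw [line_re]; norm_num) (by rw [line_re]; linarith))
    have h2 := half_le_mu h.adm (z := line (1 / 2) ξ) (by simp)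
    rw [line_im, sub_zero, mul_one] at h1
    rw [edgeDensity, norm_mul, ← mul_assoc]
    refine mul_le_mul_of_nonneg_right ?_ (norm_nonneg _)
    have hε := h.adm.pos
    rw [mul_div_assoc', le_div_iff₀ hε]
    have h3 : ε * (1 / 2) * ‖edgeMul ε (fun _ => 1 / (2 * Complex.I)) (line (1 / 2) ξ)‖
        ≤ 10 * Real.exp (-(Real.arctan ε * |2 * Real.pi * ξ|)) := by
      refine le_trans ?_ h1
      gcongr
    linarith

theorem hasExpDecay₀ (h : IsEdgeData k ε f G) :
    HasExpDecay (Real.arctan ε) (edgeDensity₀ ε G)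
      (fun ξ => 2 * (20 / ε * ‖G (1 / 2) ξ‖)) := by
  have h1 := h.hasExpDecay
  refine ⟨?_, h1.integrable.const_mul _, fun ξ => ?_⟩
  · exact h1.meas.mul (((continuous_line _).inv₀
      (line_ne_zero (by norm_num))).aestronglyMeasurable)
  · have h2 : (1 / 2 : ℝ) ≤ ‖line (1 / 2) ξ‖ := by
      have := Complex.re_le_norm (line (1 / 2) ξ)
      rwa [line_re] at this
    have h3 := h1.bound ξ
    rw [edgeDensity₀, norm_div, div_le_iff₀ (by linarith)]
    nlinarith [norm_nonneg (edgeDensity ε G ξ)]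

theorem hasDerivAt_potential (h : IsEdgeData k ε f G) {z : ℂ} (hz : z ∈ sector ε) :
    HasDerivAt (potential ε G) (potentialDeriv ε G z) z := by
  have h1 : HasDerivAt (expInt (1 / 2) (edgeDensity₀ ε G))
      (expInt (1 / 2) (edgeDensity ε G) (Complex.log z)) (Complex.log z) := by
    refine h.hasExpDecay₀.hasDerivAt h.hasExpDecay (fun ξ => ?_) ?_
    · rw [edgeDensity₀, mul_div_cancel₀ _ (line_ne_zero (by norm_num) ξ)]
    · rw [Complex.log_im]; exact abs_arg_lt_arctan hz
  have h2 := Complex.hasDerivAt_log (mem_slitPlane_of_re_pos hz.1)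
  exact (h1.comp z h2).congr_deriv (by rw [potentialDeriv, div_eq_mul_inv _ z])

theorem continuousOn_potential (h : IsEdgeData k ε f G) :
    ContinuousOn (potential ε G) (closedSector ε) := by
  refine h.hasExpDecay₀.continuousOn.comp ?_ fun z hz => ?_
  · exact fun z hz => (continuousAt_clog (mem_slitPlane_of_re_pos hz.1)).continuousWithinAt
  · rw [mem_ofPred_eq, Complex.log_im]; exact abs_arg_le_arctan hz

theorem continuousOn_potentialDeriv (h : IsEdgeData k ε f G) :
    ContinuousOn (potentialDeriv ε G) (closedSector ε) := by
  refine ContinuousOn.div (h.hasExpDecay.continuousOn.comp ?_ fun z hz => ?_) continuousOn_id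
    fun z hz => ?_
  · exact fun z hz => (continuousAt_clog (mem_slitPlane_of_re_pos hz.1)).continuousWithinAt
  · rw [mem_ofPred_eq, Complex.log_im]; exact abs_arg_le_arctan hz
  · rintro rfl
    exact lt_irrefl _ hz.1

theorem differentiableOn_potential (h : IsEdgeData k ε f G) :
    DifferentiableOn ℂ (potential ε G) (sector ε) := fun _ hz =>
  (h.hasDerivAt_potential hz).differentiableAt.differentiableWithinAt

theorem isEpsHarmonicOn_extension (h : IsEdgeData k ε f G) :
    IsEpsHarmonicOn ε (extension ε G) wedge :=
  isEpsHarmonicOn_reSum h.adm.pos.ne' (isOpen_sector ε) (isOpen_sector ε)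
    h.differentiableOn_potential h.differentiableOn_potential.neg
    (fun _ hz => (cvar_mem_sector h.adm.pos hz).1) (fun _ hz => (cvar_mem_sector h.adm.pos hz).2)

theorem hasDerivAt_extension_fst (h : IsEdgeData k ε f G) {x y : ℝ} (hz : (x, y) ∈ wedge) :
    HasDerivAt (fun x => extension ε G (x, y)) (extensionX ε G (x, y)) x := by
  obtain ⟨h1, h2⟩ := cvar_mem_sector h.adm.pos hz
  exact (hasDerivAt_reSum_fst (h.hasDerivAt_potential h1) (h.hasDerivAt_potential h2).neg)

theorem hasDerivAt_extension_snd (h : IsEdgeData k ε f G) {x y : ℝ} (hz : (x, y) ∈ wedge) :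
    HasDerivAt (fun y => extension ε G (x, y)) (extensionY ε G (x, y)) y := by
  obtain ⟨h1, h2⟩ := cvar_mem_sector h.adm.pos hz
  refine (hasDerivAt_reSum_snd (h.hasDerivAt_potential h1)
    (h.hasDerivAt_potential h2).neg).congr_deriv ?_
  simp [extensionY, reSum]

theorem continuousOn_reSum_closedSector {A B : ℂ → ℂ} (hA : ContinuousOn A (closedSector ε))
    (hB : ContinuousOn B (closedSector ε)) :
    ContinuousOn (reSum ε A B) {z | 0 < z.1 ∧ |ε * z.2| ≤ ε * z.1} := by
  refine ContinuousOn.add (Complex.continuous_re.comp_continuousOn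
    (hA.comp (continuous_cvar ε).continuousOn ?_)) (Complex.continuous_re.comp_continuousOn
    (hB.comp (continuous_cvar (-ε)).continuousOn ?_))
  · exact fun z hz => ⟨by simpa using hz.1, by simpa using hz.2⟩
  · exact fun z hz => ⟨by simpa using hz.1, by simpa using hz.2⟩

theorem tendsto_reSum (hε : 0 < ε) {A B : ℂ → ℂ} (hA : ContinuousOn A (closedSector ε))
    (hB : ContinuousOn B (closedSector ε)) {x y : ℝ} (hx : 0 < x) (hy : y ∈ Icc 0 x) :
    Tendsto (reSum ε A B) (𝓝[wedge] (x, y)) (𝓝 (reSum ε A B (x, y))) := by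
  have hsub : wedge ⊆ {z : ℝ × ℝ | 0 < z.1 ∧ |ε * z.2| ≤ ε * z.1} := fun z hz => by
    refine ⟨hz.1, ?_⟩
    rw [abs_of_pos (mul_pos hε hz.2.1)]
    exact (mul_lt_mul_of_pos_left hz.2.2 hε).le
  refine (continuousOn_reSum_closedSector hA hB (x, y) ⟨hx, ?_⟩).tendsto.mono_left
    (nhdsWithin_mono _ hsub)
  simp only
  rw [abs_of_nonneg (mul_nonneg hε.le hy.1)]
  exact mul_le_mul_of_nonneg_left hy.2 hε.le

theorem isUpperTrace_extensionX (h : IsEdgeData k ε f G) :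
    IsUpperTrace (extensionX ε G) (fun x => extensionX ε G (x, x)) := fun _ hx =>
  tendsto_reSum h.adm.pos h.continuousOn_potentialDeriv h.continuousOn_potentialDeriv.neg hx
    ⟨hx.le, le_rfl⟩

theorem isUpperTrace_extensionY (h : IsEdgeData k ε f G) :
    IsUpperTrace (extensionY ε G) (fun x => extensionY ε G (x, x)) := fun _ hx =>
  tendsto_reSum h.adm.pos (continuousOn_const.mul h.continuousOn_potentialDeriv)
    (continuousOn_const.mul h.continuousOn_potentialDeriv) hx ⟨hx.le, le_rfl⟩

theorem isUpperTrace_extension (h : IsEdgeData k ε f G) :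
    IsUpperTrace (extension ε G) (fun x => extension ε G (x, x)) := fun _ hx =>
  tendsto_reSum h.adm.pos h.continuousOn_potential h.continuousOn_potential.neg hx
    ⟨hx.le, le_rfl⟩

theorem isLowerTrace_extension (h : IsEdgeData k ε f G) :
    IsLowerTrace (extension ε G) (fun _ => 0) := fun x hx => by
  have := tendsto_reSum h.adm.pos h.continuousOn_potential h.continuousOn_potential.neg hx
    (y := 0) ⟨le_rfl, hx.le⟩
  convert! this using 2
  simp [reSum, cvar]

theorem log_exp_add_mul_I {u t : ℝ} (ht : |t| < Real.pi / 2) :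
    Complex.log (Complex.exp (u + t * Complex.I)) = u + t * Complex.I := by
  obtain ⟨h1, h2⟩ := abs_lt.1 ht
  apply Complex.log_exp <;> simp <;> linarith [Real.pi_pos]

/-- On the exponentials e^{λw} the difference between w = u + it and u - it produces 2i sin(λt). The
factor 1/(2i) in the density is chosen for this. -/
theorem expInt_sub_expInt (h : IsEdgeData k ε f G) {u t : ℝ} (ht : t ∈ Icc 0 (Real.arctan ε)) :
    expInt (1 / 2) (edgeDensity₀ ε G) (u + t * Complex.I)
      - expInt (1 / 2) (edgeDensity₀ ε G) (u + (-t : ℝ) * Complex.I)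
      = invL (1 / 2) (fun ξ => edgeMul ε (fun z => Complex.sin (z * t) / z) (line (1 / 2) ξ)
          * G (1 / 2) ξ) u := by
  have ha : |t| ≤ Real.arctan ε := by rw [abs_of_nonneg ht.1]; exact ht.2
  rw [expInt, expInt, ← integral_sub (h.hasExpDecay₀.integrable_exp (by simpa using ha))
    (h.hasExpDecay₀.integrable_exp (by simpa using ha)), invL]
  congr 1 with ξ
  simp only [edgeDensity₀, edgeDensity, edgeMul]
  generalize line (1 / 2) ξ = l
  have es : Complex.sin (l * t) = (Complex.exp (-(l * t) * Complex.I)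
    - Complex.exp (l * t * Complex.I)) * Complex.I / 2 := rfl
  have hI : 1 / (2 * Complex.I) = -Complex.I / 2 := by
    rw [one_div, mul_inv, Complex.inv_I]; ring
  rw [mul_add, mul_add, Complex.exp_add, Complex.exp_add, es, hI,
    show l * (t * Complex.I) = l * t * Complex.I by ring,
    show l * ((-t : ℝ) * Complex.I) = -(l * t) * Complex.I by push_cast; ring]
  ring

/-- Division by e^w with w = u ± it lowers λ by one in the angular exponential and leaves e^{-u} in
front. Suitable p and q give the sine for the x-derivative and the cosine for the y-derivative. -/
theorem expInt_combination (h : IsEdgeData k ε f G) {u t : ℝ} (ht : t ∈ Icc 0 (Real.arctan ε))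
    (p q : ℂ) {N : ℂ → ℂ} (hN : ∀ z, N z = (p * Complex.exp ((z - 1) * t * Complex.I)
      + q * Complex.exp (-((z - 1) * t * Complex.I))) / (2 * Complex.I)) :
    p * (expInt (1 / 2) (edgeDensity ε G) (u + t * Complex.I) / Complex.exp (u + t * Complex.I))
      + q * (expInt (1 / 2) (edgeDensity ε G) (u + (-t : ℝ) * Complex.I)
        / Complex.exp (u + (-t : ℝ) * Complex.I))
      = Real.exp (-u) * invL (1 / 2) (fun ξ => edgeMul ε N (line (1 / 2) ξ) * G (1 / 2) ξ) u := by
  have ha : |t| ≤ Real.arctan ε := by rw [abs_of_nonneg ht.1]; exact ht.2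
  have i1 := h.hasExpDecay.integrable_exp (β := 1 / 2) (w := u + t * Complex.I) (by simpa using ha)
  have i2 := h.hasExpDecay.integrable_exp (β := 1 / 2) (w := u + (-t : ℝ) * Complex.I)
    (by simpa using ha)
  rw [expInt, expInt, div_eq_mul_inv _ (Complex.exp _), div_eq_mul_inv _ (Complex.exp _),
    ← Complex.exp_neg, ← Complex.exp_neg, ← integral_mul_const, ← integral_mul_const, ← integral_const_mul, ← integral_const_mul,
    ← integral_add ((i1.mul_const _).const_mul _) ((i2.mul_const _).const_mul _), invL,
    ← integral_const_mul]
  congr 1 with ξ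
  set l := line (1 / 2) ξ
  rw [edgeDensity, edgeMul, edgeMul, hN, Complex.ofReal_exp]
  have e1 : Complex.exp (l * (u + t * Complex.I)) * Complex.exp (-(u + t * Complex.I))
      = Complex.exp (l * u) * Complex.exp ((-u : ℝ) : ℂ)
        * Complex.exp ((l - 1) * t * Complex.I) := by
    rw [← Complex.exp_add, ← Complex.exp_add, ← Complex.exp_add]
    congr 1; push_cast; ring
  have e2 : Complex.exp (l * (u + (-t : ℝ) * Complex.I)) *
      Complex.exp (-(u + (-t : ℝ) * Complex.I))
      = Complex.exp (l * u) * Complex.exp ((-u : ℝ) : ℂ)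
        * Complex.exp (-((l - 1) * t * Complex.I)) := by
    rw [← Complex.exp_add, ← Complex.exp_add, ← Complex.exp_add]
    congr 1; push_cast; ring
  linear_combination (p * (Complex.exp (-(l * logC ε)) * (1 / (2 * Complex.I))
      / Complex.sin (l * Real.arctan ε) * G (1 / 2) ξ)) * e1
    + (q * (Complex.exp (-(l * logC ε)) * (1 / (2 * Complex.I))
      / Complex.sin (l * Real.arctan ε) * G (1 / 2) ξ)) * e2

theorem abs_lt_of_mem {ε t : ℝ} (ht : t ∈ Icc 0 (Real.arctan ε)) :
    |t| < Real.pi / 2 := by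
  rw [abs_of_nonneg ht.1]; exact ht.2.trans_lt (Real.arctan_lt_pi_div_two ε)

theorem mul_mem_of_mem (h : IsEdgeData k ε f G) {v : ℝ} (hv : v ∈ Icc 0 (vTop ε)) :
    ε * v ∈ Icc 0 (Real.arctan ε) := by
  refine ⟨mul_nonneg h.adm.pos.le hv.1, ?_⟩
  have := hv.2
  rw [vTop, le_div_iff₀ h.adm.pos] at this
  linarith

theorem cvar_neg_polar' (h : IsEdgeData k ε f G) (u v : ℝ) : cvar (-ε) (polar ε u v)
    = Complex.exp (u + (-(ε * v) : ℝ) * Complex.I) := by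
  rw [cvar_neg_polar h.adm.pos.ne']
  congr 1; push_cast; ring

theorem cvar_polar' (h : IsEdgeData k ε f G) (u v : ℝ) : cvar ε (polar ε u v)
    = Complex.exp (u + (ε * v : ℝ) * Complex.I) := by
  rw [cvar_polar h.adm.pos.ne']
  congr 1; push_cast; ring

/-- The difference of potentials is already real by `invL_edgeMul_eq`, so taking real parts loses
nothing, and the formula holds on every admissible line with the transform G β of that line. -/
theorem extension_polar (h : IsEdgeData k ε f G) (u : ℝ) {v : ℝ} (hv : v ∈ Icc 0 (vTop ε)) {β : ℝ}
    (hβ : β ∈ Icc (1 / 2 : ℝ) (3 * k + 1 / 2)) :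
    (extension ε G (polar ε u v) : ℂ) = invL β (fun ξ =>
      edgeMul ε (fun z => Complex.sin (z * (ε * v : ℝ)) / z) (line β ξ) * G β ξ) u := by
  have ht := h.mul_mem_of_mem hv
  have ha := abs_lt_of_mem ht
  rw [h.invL_edgeMul_eq (isEdgeFamily_sin_div k ε) ht hβ, ← h.expInt_sub_expInt ht,
    extension, reSum, potential, potential, h.cvar_polar', h.cvar_neg_polar',
    log_exp_add_mul_I ha, log_exp_add_mul_I (by rwa [abs_neg])]
  simp [sub_eq_add_neg]

theorem extensionX_polar (h : IsEdgeData k ε f G) (u : ℝ) {v : ℝ} (hv : v ∈ Icc 0 (vTop ε)) {β : ℝ}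
    (hβ : β ∈ Icc (1 / 2 : ℝ) (3 * k + 1 / 2)) :
    (extensionX ε G (polar ε u v) : ℂ) = Real.exp (-u) * invL β (fun ξ =>
      edgeMul ε (fun z => Complex.sin ((z - 1) * (ε * v : ℝ))) (line β ξ) * G β ξ) u := by
  have ht := h.mul_mem_of_mem hv
  have ha := abs_lt_of_mem ht
  have key := h.expInt_combination (u := u) ht 1 (-1)
    (N := fun z => Complex.sin ((z - 1) * (ε * v : ℝ))) (fun z => by
      have hI := Complex.I_sq
      rw [Complex.sin]
      field_simp
      rw [hI]
      ring_nf)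
  have hr := h.invL_edgeMul_eq (isEdgeFamily_sin k ε) ht half_mem u
  rw [h.invL_edgeMul_eq (isEdgeFamily_sin k ε) ht hβ, ← hr, ← key]
  -- The combination is real, hence equal to its own real part, and that real part is the derivative
  -- by definition.
  rw [hr, ← Complex.ofReal_mul] at key
  have key' := congrArg (fun w : ℂ => ((w.re : ℝ) : ℂ)) key
  simp only [Complex.ofReal_re] at key'
  rw [key, ← key', extensionX, reSum, potentialDeriv, potentialDeriv, h.cvar_polar',
    h.cvar_neg_polar', log_exp_add_mul_I ha, log_exp_add_mul_I (by rwa [abs_neg])]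
  simp

theorem extensionY_polar (h : IsEdgeData k ε f G) (u : ℝ) {v : ℝ} (hv : v ∈ Icc 0 (vTop ε)) {β : ℝ}
    (hβ : β ∈ Icc (1 / 2 : ℝ) (3 * k + 1 / 2)) :
    (extensionY ε G (polar ε u v) : ℂ) = Real.exp (-u) * invL β (fun ξ =>
      edgeMul ε (fun z => ε * Complex.cos ((z - 1) * (ε * v : ℝ))) (line β ξ) * G β ξ) u := by
  have ht := h.mul_mem_of_mem hv
  have ha := abs_lt_of_mem ht
  have key := h.expInt_combination (u := u) ht (ε * Complex.I) (ε * Complex.I)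
    (N := fun z => ε * Complex.cos ((z - 1) * (ε * v : ℝ))) (fun z => by
      rw [Complex.cos]
      field_simp)
  have hN := isEdgeFamily_cos k h.adm.pos.le
  have hr := h.invL_edgeMul_eq hN ht half_mem u
  rw [h.invL_edgeMul_eq hN ht hβ, ← hr, ← key]
  rw [hr, ← Complex.ofReal_mul] at key
  have key' := congrArg (fun w : ℂ => ((w.re : ℝ) : ℂ)) key
  simp only [Complex.ofReal_re] at key'
  rw [key, ← key', extensionY, reSum, potentialDeriv, potentialDeriv, h.cvar_polar',
    h.cvar_neg_polar', log_exp_add_mul_I ha, log_exp_add_mul_I (by rwa [abs_neg])]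
  simp

end IsEdgeData

/-! ### The extension and its derivatives on the upper edge. -/

theorem polar_vTop {ε : ℝ} (hε : 0 < ε) (s : ℝ) :
    polar ε (s + logC ε) (vTop ε) = (Real.exp s, Real.exp s) := by
  have h1 : ε * vTop ε = Real.arctan ε := by rw [vTop, mul_div_cancel₀ _ hε.ne']
  have h2 : √(1 + ε ^ 2) ≠ 0 := (by positivity : 0 < √(1 + ε ^ 2)).ne'
  have h3 := hε.ne'
  rw [polar, h1, Real.exp_add, exp_logC, Real.cos_arctan, Real.sin_arctan]
  refine Prod.ext ?_ ?_
  · simp only; field_simp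
  · simp only; field_simp

theorem exp_logC_mul_le {k : ℕ} {ε β : ℝ} (h : IsAdmissible k ε)
    (hβ : β ∈ Icc (1 / 2 : ℝ) (3 * k + 1 / 2)) : Real.exp ((β - 1) * logC ε) ≤ 8 ^ k := by
  have h1 : Real.exp (logC ε) ≤ 2 := by
    rw [exp_logC, Real.sqrt_le_left two_pos.le]
    nlinarith [h.lt_half, h.pos]
  have h2 : (β - 1) * logC ε ≤ ((3 * k : ℕ) : ℝ) * logC ε := by
    refine mul_le_mul_of_nonneg_right ?_ (logC_nonneg ε)
    push_cast
    linarith [hβ.2]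
  calc _ ≤ Real.exp (((3 * k : ℕ) : ℝ) * logC ε) := Real.exp_le_exp.2 h2
    _ = Real.exp (logC ε) ^ (3 * k) := by rw [Real.exp_nat_mul]
    _ ≤ 2 ^ (3 * k) := by gcongr
    _ = 8 ^ k := by rw [pow_mul]; norm_num

/-- The prefactor of the derivatives moves the transform from the line β to β - 1; the shift a will
be log c, relating log r to log x on the edge. -/
theorem exp_neg_mul_invL (β a s : ℝ) (H : ℝ → ℂ) : (Real.exp (-(s + a)) : ℂ) * invL β H (s + a)
    = invL (β - 1) (fun ξ => Complex.exp ((line β ξ - 1) * a) * H ξ) s := by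
  rw [invL, invL, ← integral_const_mul]
  congr 1 with ξ
  have : line (β - 1) ξ = line β ξ - 1 := by simp [line]; ring
  rw [this, Complex.ofReal_exp, ← mul_assoc, ← mul_assoc, ← Complex.exp_add, ← Complex.exp_add]
  congr 2
  push_cast
  ring

namespace IsEdgeData

variable {k : ℕ} {ε : ℝ} {f : ℝ → ℝ} {G : ℝ → ℝ → ℂ}

theorem vTop_pos (h : IsEdgeData k ε f G) : 0 < vTop ε :=
  div_pos h.adm.arctan_pos h.adm.pos

theorem mul_vTop (h : IsEdgeData k ε f G) : ε * vTop ε = Real.arctan ε := by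
  rw [vTop, mul_div_cancel₀ _ h.adm.pos.ne']

/-- The Laplace transform of a derivative of the extension on the upper edge. -/
theorem exists_laplace_trace (h : IsEdgeData k ε f G) {C c : ℝ} {N : ℝ → ℂ → ℂ}
    (hN : IsEdgeFamily k ε C N) {q : ℝ × ℝ → ℝ} (hc : 0 ≤ c) (hcC : c * C ≤ ε)
    (hq : ∀ u, ∀ v ∈ Icc 0 (vTop ε), ∀ β ∈ Icc (1 / 2 : ℝ) (3 * k + 1 / 2),
      (q (polar ε u v) : ℂ) = Real.exp (-u) * invL β (fun ξ =>
        edgeMul ε (N (ε * v)) (line β ξ) * G β ξ) u)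
    {β : ℝ} (hβ : β ∈ Icc (1 / 2 : ℝ) (3 * k + 1 / 2)) :
    ∃ T : ℝ → ℂ, IsLaplaceOnLine (β - 1) (fun s => c * q (Real.exp s, Real.exp s)) T ∧
      ∀ ξ, ‖T ξ‖ ≤ 20 * 8 ^ k * ‖G β ξ‖ := by
  have hα : Real.arctan ε ∈ Icc 0 (Real.arctan ε) := right_mem_Icc.2 h.adm.arctan_pos.le
  obtain ⟨i1, i2⟩ := h.integrable_edgeMul hN hα hβ
  set H : ℝ → ℂ := fun ξ => edgeMul ε (N (Real.arctan ε)) (line β ξ) * G β ξ with hH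
  -- The exponential undoes e^{-λ log c} up to one factor c, since on the edge u = s + log c. Its
  -- modulus c^{β-1} is at most 2^{3k} = 8^k.
  set T : ℝ → ℂ := fun ξ => c * (Complex.exp ((line β ξ - 1) * logC ε) * H ξ) with hT
  have hexp : ∀ ξ, ‖Complex.exp ((line β ξ - 1) * logC ε)‖ ≤ 8 ^ k := fun ξ => by
    rw [Complex.norm_exp]
    simpa using exp_logC_mul_le h.adm hβ
  have hbound : ∀ ξ, ‖T ξ‖ ≤ c * 8 ^ k * ‖H ξ‖ := fun ξ => by
    rw [hT, norm_mul, norm_mul, Complex.norm_real, Real.norm_of_nonneg hc, mul_assoc]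
    have := hexp ξ
    gcongr
  have hTm : AEStronglyMeasurable T := by
    refine aestronglyMeasurable_const.mul (AEStronglyMeasurable.mul ?_ i1.1)
    have := continuous_line β
    exact (by fun_prop : Continuous fun ξ =>
      Complex.exp ((line β ξ - 1) * logC ε)).aestronglyMeasurable
  refine ⟨T, isLaplaceOnLine_of_invL
    ((i1.norm.const_mul (c * 8 ^ k)).mono' hTm (ae_of_all _ hbound))
    (i2.of_le_mul hTm (ae_of_all _ hbound)) fun s => ?_, fun ξ => ?_⟩
  · have h1 := hq (s + logC ε) (vTop ε) (right_mem_Icc.2 h.vTop_pos.le) β hβ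
    rw [polar_vTop h.adm.pos, h.mul_vTop, exp_neg_mul_invL] at h1
    rw [Complex.ofReal_mul, h1, invL, invL, ← integral_const_mul]
    congr 1 with ξ
    rw [hT]; ring
  · have h1 := hN.norm_edgeMul_le h.adm (ξ := ξ) hα hβ
    have h2 : c * ‖edgeMul ε (N (Real.arctan ε)) (line β ξ)‖ ≤ 20 := by
      have h3 := hN.nonneg
      have hε := h.adm.pos
      have h4 : ε * (c * ‖edgeMul ε (N (Real.arctan ε)) (line β ξ)‖) ≤ ε * 20 := by
        calc _ = c * (ε * ‖edgeMul ε (N (Real.arctan ε)) (line β ξ)‖) := by ring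
          _ ≤ c * (20 * C) := by gcongr
          _ ≤ _ := by linarith
      exact le_of_mul_le_mul_left h4 hε
    refine (hbound ξ).trans ?_
    rw [hH, norm_mul]
    calc _ = c * ‖edgeMul ε (N (Real.arctan ε)) (line β ξ)‖ * 8 ^ k * ‖G β ξ‖ := by ring
      _ ≤ _ := by gcongr

theorem exists_laplace_traceX (h : IsEdgeData k ε f G) {β : ℝ}
    (hβ : β ∈ Icc (1 / 2 : ℝ) (3 * k + 1 / 2)) :
    ∃ T : ℝ → ℂ, IsLaplaceOnLine (β - 1)
      (fun s => ε * extensionX ε G (Real.exp s, Real.exp s)) T ∧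
      ∀ ξ, ‖T ξ‖ ≤ 20 * 8 ^ k * ‖G β ξ‖ :=
  h.exists_laplace_trace (isEdgeFamily_sin k ε) h.adm.pos.le (by rw [mul_one])
    (fun u _ hv _ hβ => h.extensionX_polar u hv hβ) hβ

theorem exists_laplace_traceY (h : IsEdgeData k ε f G) {β : ℝ}
    (hβ : β ∈ Icc (1 / 2 : ℝ) (3 * k + 1 / 2)) :
    ∃ T : ℝ → ℂ, IsLaplaceOnLine (β - 1)
      (fun s => extensionY ε G (Real.exp s, Real.exp s)) T ∧
      ∀ ξ, ‖T ξ‖ ≤ 20 * 8 ^ k * ‖G β ξ‖ := by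
  have := h.exists_laplace_trace (c := 1) (isEdgeFamily_cos k h.adm.pos.le) zero_le_one
    (by rw [one_mul]) (fun u _ hv _ hβ => h.extensionY_polar u hv hβ) hβ
  simpa only [one_mul] using this

/-- On the line Re λ = 1 the growth e^u of the inverse integral cancels the prefactor e^{-u}. This
is the scale-invariant line, and it alone gives a bound uniform up to the vertex and to infinity. -/
theorem abs_extensionY_le (h : IsEdgeData k ε f G) {z : ℝ × ℝ} (hz : z ∈ wedge) :
    |extensionY ε G z| ≤ 20 * ∫ ξ, ‖G 1 ξ‖ := by
  obtain ⟨u, v, hv, rfl⟩ := exists_polar h.adm.pos hz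
  have hv' : v ∈ Icc 0 (vTop ε) := Ioo_subset_Icc_self hv
  have h1 := h.extensionY_polar u hv' h.one_mem
  obtain ⟨i1, i2⟩ := h.integrable_edgeMul (isEdgeFamily_cos k h.adm.pos.le)
    (h.mul_mem_of_mem hv') h.one_mem
  have h2 := norm_invL_le 1 (fun ξ => edgeMul ε
    (fun z => ε * Complex.cos ((z - 1) * (ε * v : ℝ))) (line 1 ξ) * G 1 ξ) u
  have h3 : ∫ ξ, ‖edgeMul ε (fun z => ε * Complex.cos ((z - 1) * (ε * v : ℝ))) (line 1 ξ) * G 1 ξ‖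
      ≤ 20 * ∫ ξ, ‖G 1 ξ‖ := by
    rw [← integral_const_mul]
    refine integral_mono i1.norm ((h.integrable _ h.one_mem).norm.const_mul 20) fun ξ => ?_
    have h4 := (isEdgeFamily_cos k h.adm.pos.le).norm_edgeMul_le h.adm (ξ := ξ)
      (h.mul_mem_of_mem hv') h.one_mem
    rw [norm_mul]
    refine mul_le_mul_of_nonneg_right (le_of_mul_le_mul_left ?_ h.adm.pos) (norm_nonneg _)
    linarith
  rw [← Real.norm_eq_abs, ← Complex.norm_real, h1, norm_mul, Complex.norm_real,
    Real.norm_of_nonneg (Real.exp_pos _).le]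
  calc _ ≤ Real.exp (-u) * (Real.exp (1 * u) * (20 * ∫ ξ, ‖G 1 ξ‖)) := by gcongr; exact h2.trans (by gcongr)
    _ = _ := by rw [← mul_assoc, ← Real.exp_add]; simp

/-- At the top of the strip the two sines cancel and so do the factors involving log c. What remains
is G/λ, the transform of the primitive of f that vanishes at -∞. -/
theorem extension_upper (h : IsEdgeData k ε f G) (s : ℝ) :
    IntegrableOn f (Iic s) ∧
      extension ε G (Real.exp s, Real.exp s) = ∫ σ in Iic s, f σ := by
  obtain ⟨h1, h2⟩ := (h.laplace _ half_mem).primitive (by norm_num) s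
  refine ⟨h1, ?_⟩
  have h3 := h.extension_polar (s + logC ε) (right_mem_Icc.2 h.vTop_pos.le) half_mem
  rw [polar_vTop h.adm.pos, h.mul_vTop] at h3
  rw [← Complex.ofReal_inj, h3, h2, invL, invL]
  congr 1 with ξ
  have hs := sin_mul_arctan_ne_zero h.adm (z := line (1 / 2) ξ) (by simp)
    (by rw [line_re]; have : (0 : ℝ) ≤ k := Nat.cast_nonneg k
        linarith)
  rw [edgeMul, Complex.ofReal_add, mul_add, Complex.exp_add, Complex.exp_neg]
  have h4 := Complex.exp_ne_zero (line (1 / 2) ξ * logC ε)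
  have h5 := line_ne_zero (β := 1 / 2) (by norm_num) ξ
  generalize line (1 / 2) ξ = l at *
  generalize Complex.sin (l * (Real.arctan ε : ℂ)) = S at *
  generalize Complex.exp (l * (logC ε : ℂ)) = E at *
  field_simp

end IsEdgeData

/-! ### The weighted estimate in the strip. -/

theorem iteratedDeriv_exp_add_exp (p q κ : ℂ) (j : ℕ) :
    iteratedDeriv j (fun v : ℝ => p * Complex.exp (κ * v) + q * Complex.exp (-(κ * v)))
      = fun v : ℝ => p * κ ^ j * Complex.exp (κ * v) + q * (-κ) ^ j * Complex.exp (-(κ * v)) := by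
  induction j with
  | zero => simp
  | succ j ih =>
    rw [iteratedDeriv_succ, ih]
    ext v
    have h1 : HasDerivAt (fun v : ℝ => κ * (v : ℂ)) κ v := by
      simpa using (Complex.ofRealCLM.hasDerivAt (x := v)).const_mul κ
    have h3 : HasDerivAt (fun v : ℝ => -(κ * (v : ℂ))) (-κ) v := h1.neg
    have h2 := (h1.cexp.const_mul (p * κ ^ j)).add (h3.cexp.const_mul (q * (-κ) ^ j))
    refine h2.deriv.trans ?_
    ring

theorem norm_iteratedDeriv_sin_le (c κ : ℂ) (j : ℕ) {v : ℝ} (hv : 0 ≤ v) :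
    ‖iteratedDeriv j (fun v : ℝ => c * Complex.sin (κ * v)) v‖
      ≤ ‖c‖ * ‖κ‖ ^ j * Real.exp (v * |κ.im|) := by
  have e : (fun v : ℝ => c * Complex.sin (κ * v)) = fun v : ℝ =>
      (-(c * Complex.I / 2)) * Complex.exp (κ * Complex.I * v)
        + c * Complex.I / 2 * Complex.exp (-(κ * Complex.I * v)) := by
    ext v
    rw [Complex.sin, show -(κ * v) * Complex.I = -(κ * Complex.I * v) by ring,
      show κ * v * Complex.I = κ * Complex.I * v by ring]
    ring
  rw [e, iteratedDeriv_exp_add_exp]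
  have h1 : ‖Complex.exp (κ * Complex.I * v)‖ ≤ Real.exp (v * |κ.im|) := by
    rw [Complex.norm_exp, Real.exp_le_exp]
    simp
    nlinarith [neg_abs_le κ.im]
  have h2 : ‖Complex.exp (-(κ * Complex.I * v))‖ ≤ Real.exp (v * |κ.im|) := by
    rw [Complex.norm_exp, Real.exp_le_exp]
    simp
    nlinarith [le_abs_self κ.im]
  refine (norm_add_le _ _).trans ?_
  simp only [norm_mul, norm_pow, norm_neg, norm_div, Complex.norm_I, mul_one, Complex.norm_ofNat]
  have h3 : 0 ≤ ‖c‖ / 2 * ‖κ‖ ^ j := by positivity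
  nlinarith [mul_le_mul_of_nonneg_left h1 h3, mul_le_mul_of_nonneg_left h2 h3]

namespace IsEdgeData

variable {k : ℕ} {ε : ℝ} {f : ℝ → ℝ} {G : ℝ → ℝ → ℂ}

/-- The Laplace transform of `ε` times the extension in the strip. -/
def stripTransform (ε β : ℝ) (G : ℝ → ℝ → ℂ) (ξ v : ℝ) : ℂ :=
  ε * (Complex.exp (-(line β ξ * logC ε)) / (line β ξ * Complex.sin (line β ξ * Real.arctan ε))
    * G β ξ) * Complex.sin (line β ξ * ε * v)

theorem isStripLaplace (h : IsEdgeData k ε f G) {β : ℝ}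
    (hβ : β ∈ Icc (1 / 2 : ℝ) (3 * k + 1 / 2)) :
    IsStripLaplace ε β (fun u v => ε * extension ε G (polar ε u v)) (stripTransform ε β G) := by
  constructor
  · intro v hv
    have hv' : v ∈ Icc 0 (vTop ε) := Ioo_subset_Icc_self hv
    obtain ⟨i1, i2⟩ := h.integrable_edgeMul (isEdgeFamily_sin_div k ε) (h.mul_mem_of_mem hv') hβ
    have e : (fun ξ => stripTransform ε β G ξ v) = fun ξ => (ε : ℂ) *
        (edgeMul ε (fun z => Complex.sin (z * (ε * v : ℝ)) / z) (line β ξ) * G β ξ) := by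
      ext ξ
      rw [stripTransform, edgeMul, Complex.ofReal_mul, ← mul_assoc (line β ξ) (ε : ℂ) (v : ℂ)]
      ring
    rw [e]
    refine isLaplaceOnLine_of_invL (i1.const_mul _) (i2.const_mul _) fun u => ?_
    rw [Complex.ofReal_mul, h.extension_polar u hv' hβ, invL, invL, ← integral_const_mul]
    congr 1 with ξ
    ring
  · intro ξ
    refine ContDiff.contDiffOn ?_
    unfold stripTransform
    have h1 : ContDiff ℝ ((⊤ : ℕ∞) : WithTop ℕ∞) (fun v : ℝ => (v : ℂ)) :=
      Complex.ofRealCLM.contDiff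
    have h2 : ContDiff ℝ ((⊤ : ℕ∞) : WithTop ℕ∞) (fun v : ℝ => line β ξ * ε * (v : ℂ)) :=
      contDiff_const.mul h1
    have h3 : ContDiff ℝ ((⊤ : ℕ∞) : WithTop ℕ∞) Complex.sin := Complex.contDiff_sin.restrict_scalars ℝ
    exact contDiff_const.mul (h3.comp h2)

/-- Each (1/ε)∂_v contributes a factor of modulus |λ|, so that all j give the same power |λ|^s; one
power is cancelled by the 1/λ of the primitive. Division by the sine consumes one μ and the
prefactor ε, together with the exponential growth. -/
theorem stripTransform_bound (h : IsEdgeData k ε f G) {β ℓ s : ℝ}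
    (hβ : β ∈ Icc (1 / 2 : ℝ) (3 * k + 1 / 2)) (j : ℕ) (ξ : ℝ) {v : ℝ} (hv : v ∈ Ioo 0 (vTop ε)) :
    Real.exp (1 / 2 * ε * ‖line β ξ‖ * (vTop ε - v)) * mu ε (line β ξ) ^ (ℓ + 1)
      * ‖line β ξ‖ ^ (s - j) * ((1 / ε) ^ j * ‖iteratedDeriv j (stripTransform ε β G ξ) v‖)
      ≤ 30 * (‖line β ξ‖ ^ (s - 1) * mu ε (line β ξ) ^ ℓ * ‖G β ξ‖) := by
  have hε := h.adm.pos
  have h1 := norm_iteratedDeriv_sin_le (ε * (Complex.exp (-(line β ξ * logC ε)) /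
    (line β ξ * Complex.sin (line β ξ * Real.arctan ε)) * G β ξ)) (line β ξ * ε) j hv.1.le
  have hs := sin_mul_arctan_ne_zero h.adm (z := line β ξ) (by rw [line_re]; linarith [hβ.1])
    (by rw [line_re]; linarith [hβ.2])
  have h2 := mu_mul_exp_le_norm_sin h.adm (z := line β ξ) (by rw [line_re]; linarith [hβ.1])
    (by rw [line_re]; linarith [hβ.2])
  have hl := line_ne_zero (β := β) (by linarith [hβ.1]) ξ
  have hμ := mu_pos hε hl
  have he : ‖Complex.exp (-(line β ξ * logC ε))‖ ≤ 1 := by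
    rw [Complex.norm_exp, Real.exp_le_one_iff]
    simp
    exact mul_nonneg (by linarith [hβ.1]) (logC_nonneg ε)
  have hn : ‖line β ξ‖ ≤ β + |(line β ξ).im| := by
    have := Complex.norm_le_abs_re_add_abs_im (line β ξ)
    rwa [line_re, abs_of_nonneg (by linarith [hβ.1] : (0 : ℝ) ≤ β)] at this
  have hvT := h.mul_vTop
  have hab := h.adm.mul_arctan_le (b := β) (by linarith [hβ.2])
  simp only [Complex.im_mul_ofReal, abs_mul, abs_of_pos hε, norm_mul, norm_div, Complex.norm_real,
    Real.norm_of_nonneg hε.le] at h1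
  set I := |(line β ξ).im| with hI
  set L := ‖line β ξ‖ with hL
  set m := mu ε (line β ξ) with hm
  set S := ‖Complex.sin (line β ξ * Real.arctan ε)‖ with hS
  have hLpos : 0 < L := norm_pos_iff.2 hl
  have hSpos : 0 < S := norm_pos_iff.2 hs
  have hIpos : 0 ≤ I := abs_nonneg _
  have hpi : Real.exp (Real.pi / 4) ≤ 3 := by
    have : Real.exp (Real.pi / 4) ≤ Real.exp 1 := by
      rw [Real.exp_le_exp]; linarith [Real.pi_lt_four]
    linarith [Real.exp_one_lt_d9]
  -- Use |λ| ≤ β + |Im λ|. The part with β is at most βα/2 ≤ π/4 in the exponent. The part with |Im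
  -- λ| sums to at most εω|Im λ| = α|Im λ|, because half of the distance to the top is spent on the
  -- weight.
  have hexp : Real.exp (1 / 2 * ε * L * (vTop ε - v)) * Real.exp (v * (I * ε))
      ≤ 3 * Real.exp (Real.arctan ε * I) := by
    have : Real.exp (1 / 2 * ε * L * (vTop ε - v)) * Real.exp (v * (I * ε))
        ≤ Real.exp (Real.pi / 4) * Real.exp (Real.arctan ε * I) := by
      rw [← Real.exp_add, ← Real.exp_add, Real.exp_le_exp]
      have a1 : 0 ≤ vTop ε - v := by linarith [hv.2]
      have a2 : 1 / 2 * ε * L * (vTop ε - v) ≤ 1 / 2 * ε * (β + I) * (vTop ε - v) := by gcongr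
      have a3 : 0 ≤ I * (ε * (vTop ε - v)) := by positivity
      have a4 : 0 ≤ β * (ε * v) := mul_nonneg (by linarith [hβ.1]) (mul_nonneg hε.le hv.1.le)
      have a5 : β * (ε * vTop ε) ≤ Real.pi / 2 := by rw [hvT]; exact hab
      rw [← hvT]
      nlinarith
    refine this.trans ?_
    gcongr
  have hpow : L ^ (s - j) * L ^ j = L ^ (s - 1) * L := by
    rw [← Real.rpow_natCast, ← Real.rpow_add hLpos, ← Real.rpow_add_one hLpos.ne']
    congr 1; ring
  have hmpow : m ^ (ℓ + 1) = m ^ ℓ * m := Real.rpow_add_one hμ.ne' ℓ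
  have hεj : (1 / ε) ^ j * (L * ε) ^ j = L ^ j := by
    rw [← mul_pow]
    congr 1
    field_simp
  set E := Real.exp (1 / 2 * ε * L * (vTop ε - v))
  have hE : 0 < E := Real.exp_pos _
  have hA : 0 < Real.exp (Real.arctan ε * I) := Real.exp_pos _
  calc E * m ^ (ℓ + 1) * L ^ (s - j) * ((1 / ε) ^ j * ‖iteratedDeriv j (stripTransform ε β G ξ) v‖)
      ≤ E * m ^ (ℓ + 1) * L ^ (s - j) * ((1 / ε) ^ j * (ε * (1 / (L * S) * ‖G β ξ‖) *
          (L * ε) ^ j * Real.exp (v * (I * ε)))) := by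
        gcongr
        refine h1.trans ?_
        gcongr
    _ = (E * Real.exp (v * (I * ε))) * (m ^ ℓ * m) * (L ^ (s - j) * ((1 / ε) ^ j * (L * ε) ^ j)) *
          (ε * (1 / (L * S) * ‖G β ξ‖)) := by rw [hmpow]; ring
    _ ≤ (3 * Real.exp (Real.arctan ε * I)) * (m ^ ℓ * m) * (L ^ (s - 1) * L) *
          (ε * (1 / (L * S) * ‖G β ξ‖)) := by
        rw [hεj, hpow]
        gcongr
    _ = 3 * (ε * m * Real.exp (Real.arctan ε * I) / S) * (L ^ (s - 1) * m ^ ℓ * ‖G β ξ‖) := by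
        field_simp
    _ ≤ 3 * 10 * (L ^ (s - 1) * m ^ ℓ * ‖G β ξ‖) := by
        gcongr
        rw [div_le_iff₀ hSpos]
        exact h2
    _ = _ := by ring

end IsEdgeData

/-! ### Inhomogeneous weights and their comparison with the norms of the statement. -/

/-- The `L²`-norm of `w G`. -/
def wnorm (w : ℝ → ℝ) (G : ℝ → ℂ) : ℝ≥0∞ := eLpNorm (fun ξ => w ξ * ‖G ξ‖) 2 volume

theorem wnorm_sq {w : ℝ → ℝ} {G : ℝ → ℂ} : wnorm w G ^ 2 = wsq w G := by
  have h : wnorm w G = eLpNorm (fun ξ => ((w ξ * ‖G ξ‖ : ℝ) : ℂ)) 2 volume := by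
    refine eLpNorm_congr_norm_ae (ae_of_all _ fun ξ => ?_)
    rw [Complex.norm_real]
  rw [h, eLpNorm_two_sq, wsq]
  congr 1 with ξ
  rw [Complex.norm_real, Real.norm_eq_abs, sq_abs, mul_pow]

theorem wnorm_congr_ae {w : ℝ → ℝ} {G G' : ℝ → ℂ} (h : G =ᵐ[volume] G') :
    wnorm w G = wnorm w G' :=
  eLpNorm_congr_ae (h.mono fun ξ hξ => by simp only [hξ])

theorem wnorm_le_of_le {w : ℝ → ℝ} {G G' : ℝ → ℂ} {c : ℝ} (hw : ∀ ξ, 0 ≤ w ξ)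
    (h : ∀ ξ, ‖G ξ‖ ≤ c * ‖G' ξ‖) : wnorm w G ≤ ENNReal.ofReal c * wnorm w G' := by
  refine eLpNorm_le_mul_eLpNorm_of_ae_le_mul (ae_of_all _ fun ξ => ?_) 2
  rw [Real.norm_of_nonneg (mul_nonneg (hw ξ) (norm_nonneg _)),
    Real.norm_of_nonneg (mul_nonneg (hw ξ) (norm_nonneg _)), mul_left_comm]
  exact mul_le_mul_of_nonneg_left (h ξ) (hw ξ)

/-- The frequency `1 + |ξ|` truncated at `1 / ε`. -/
def cutFreq (ε ξ : ℝ) : ℝ := min (1 + |ξ|) (1 / ε)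

/-- The inhomogeneous version of the weight `|λ|^{3s+1} μ^s`. -/
def wt (ε s ξ : ℝ) : ℝ := (1 + |ξ|) ^ (3 * s + 1) * cutFreq ε ξ ^ s

theorem continuous_cutFreq (ε : ℝ) : Continuous (cutFreq ε) := by unfold cutFreq; fun_prop

theorem one_le_cutFreq {ε : ℝ} (h0 : 0 < ε) (h1 : ε ≤ 1) (ξ : ℝ) : 1 ≤ cutFreq ε ξ :=
  le_min (by linarith [abs_nonneg ξ]) (by rw [le_div_iff₀ h0]; linarith)

theorem cutFreq_pos {ε : ℝ} (h0 : 0 < ε) (ξ : ℝ) : 0 < cutFreq ε ξ :=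
  lt_min (by positivity) (by positivity)

theorem wt_pos {ε : ℝ} (h0 : 0 < ε) (s ξ : ℝ) : 0 < wt ε s ξ :=
  mul_pos (Real.rpow_pos_of_pos (by positivity) _) (Real.rpow_pos_of_pos (cutFreq_pos h0 ξ) _)

theorem continuous_wt {ε : ℝ} (h0 : 0 < ε) (s : ℝ) : Continuous (wt ε s) := by
  refine Continuous.mul ?_ ?_
  · exact Continuous.rpow_const (by fun_prop) fun ξ => Or.inl (by positivity)
  · exact (continuous_cutFreq ε).rpow_const fun ξ => Or.inl (cutFreq_pos h0 ξ).ne'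

theorem wt_natCast (ε : ℝ) (n : ℕ) (ξ : ℝ) :
    wt ε n ξ = (1 + |ξ|) ^ (3 * n + 1) * cutFreq ε ξ ^ n := by
  rw [wt, Real.rpow_natCast, ← Real.rpow_natCast (1 + |ξ|)]
  push_cast
  rfl

/-- One full power of 1 + |ξ| is available for every s ≥ 0, which is what makes weighted square
integrable transforms integrable. -/
theorem le_wt {ε s : ℝ} (h0 : 0 < ε) (h1 : ε ≤ 1) (hs : 0 ≤ s) (ξ : ℝ) : 1 + |ξ| ≤ wt ε s ξ := by
  have h2 : (1 + |ξ|) ≤ (1 + |ξ|) ^ (3 * s + 1) :=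
    Real.self_le_rpow_of_one_le (by linarith [abs_nonneg ξ]) (by linarith)
  have h3 : 1 ≤ cutFreq ε ξ ^ s := Real.one_le_rpow (one_le_cutFreq h0 h1 ξ) hs
  have h4 : 0 ≤ (1 + |ξ|) ^ (3 * s + 1) := by positivity
  rw [wt]
  nlinarith

theorem one_add_abs_le (ξ η : ℝ) : 1 + |η| ≤ (1 + |ξ|) * (1 + |ξ - η|) := by
  have h : |η| ≤ |ξ| + |ξ - η| := by
    have := abs_sub_abs_le_abs_sub η ξ
    rw [abs_sub_comm] at this
    linarith
  nlinarith [abs_nonneg ξ, abs_nonneg (ξ - η), mul_nonneg (abs_nonneg ξ) (abs_nonneg (ξ - η))]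

theorem cutFreq_le {ε : ℝ} (h0 : 0 < ε) (ξ η : ℝ) :
    cutFreq ε η ≤ cutFreq ε ξ * (1 + |ξ - η|) := by
  have h1 : (1 : ℝ) ≤ 1 + |ξ - η| := by linarith [abs_nonneg (ξ - η)]
  rw [cutFreq, cutFreq, min_mul_of_nonneg _ _ (by positivity)]
  refine min_le_min (one_add_abs_le ξ η) ?_
  exact le_mul_of_one_le_right (by positivity) h1

theorem isSlowWeight_wt {ε : ℝ} (h0 : 0 < ε) {n k : ℕ} (h : n ≤ k) :
    IsSlowWeight (4 * k + 1) (wt ε n) where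
  continuous := continuous_wt h0 n
  pos := wt_pos h0 n
  le_mul ξ η := by
    have h1 : (1 : ℝ) ≤ 1 + |ξ - η| := by linarith [abs_nonneg (ξ - η)]
    rw [wt_natCast, wt_natCast]
    calc (1 + |η|) ^ (3 * n + 1) * cutFreq ε η ^ n
        ≤ ((1 + |ξ|) * (1 + |ξ - η|)) ^ (3 * n + 1) * (cutFreq ε ξ * (1 + |ξ - η|)) ^ n := by
          have := one_add_abs_le ξ η
          have := cutFreq_le h0 ξ η
          have := (cutFreq_pos h0 η).le
          have := cutFreq_pos h0 ξ
          gcongr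
      _ = (1 + |ξ|) ^ (3 * n + 1) * cutFreq ε ξ ^ n * (1 + |ξ - η|) ^ (4 * n + 1) := by
          rw [mul_pow, mul_pow]; ring
      _ ≤ _ := by
          have := (cutFreq_pos h0 ξ).le
          gcongr

/-- The logarithm of the weight is affine in s, so interpolation between the end points s = 0 and s
= k reproduces the family. -/
theorem wt_geom_mean {ε : ℝ} (h0 : 0 < ε) {k : ℕ} (θ ξ : ℝ) :
    wt ε (0 : ℕ) ξ ^ (1 - θ) * wt ε k ξ ^ θ = wt ε (θ * k) ξ := by
  have hc := cutFreq_pos h0 ξ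
  have hr : 0 < 1 + |ξ| := by positivity
  rw [wt, wt, wt, Real.mul_rpow (by positivity) (by positivity),
    Real.mul_rpow (by positivity) (by positivity), ← Real.rpow_mul hr.le, ← Real.rpow_mul hr.le,
    ← Real.rpow_mul hc.le, ← Real.rpow_mul hc.le]
  calc _ = ((1 + |ξ|) ^ ((3 * ((0 : ℕ) : ℝ) + 1) * (1 - θ)) * (1 + |ξ|) ^ ((3 * k + 1) * θ)) *
        (cutFreq ε ξ ^ (((0 : ℕ) : ℝ) * (1 - θ)) * cutFreq ε ξ ^ (k * θ)) := by ring
    _ = _ := by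
      rw [← Real.rpow_add hr, ← Real.rpow_add hc]
      push_cast
      congr 2 <;> ring

/-- The norm of the transforms on the two extreme lines. -/
def dataNorm (k : ℕ) (ε : ℝ) (G : ℝ → ℝ → ℂ) : ℝ≥0∞ :=
  wnorm (wt ε (0 : ℕ)) (G (1 / 2)) + wnorm (wt ε k) (G (3 * k + 1 / 2))

/-- The parameter is θ = ℓ/k, for which both the line 3ℓ + 1/2 and the weight are the interpolated
ones. The constant is independent of ε because the growth exponent 4k+1 of the weights is. -/
theorem exists_wnorm_interpolation {k : ℕ} (hk : 1 ≤ k) : ∃ C : ℝ, 0 < C ∧ ∀ ε : ℝ, 0 < ε →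
    ∀ (f : ℝ → ℝ) (G : ℝ → ℝ → ℂ),
    (∀ β ∈ Icc (1 / 2 : ℝ) (3 * k + 1 / 2), IsLaplaceOnLine β f (G β)) → ∀ ℓ ∈ Icc (0 : ℝ) k,
      wnorm (wt ε ℓ) (G (3 * ℓ + 1 / 2)) ≤ ENNReal.ofReal C * dataNorm k ε G := by
  obtain ⟨C, hC, h⟩ := exists_wsq_interpolation (3 * k + 1 / 2) (4 * k + 1)
  refine ⟨√C, Real.sqrt_pos.2 hC, fun ε hε f G hG ℓ hℓ => ?_⟩
  have hk' : (0 : ℝ) < k := by exact_mod_cast hk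
  have hθ : ℓ / k ∈ Icc (0 : ℝ) 1 := ⟨div_nonneg hℓ.1 hk'.le, by rw [div_le_one hk']; exact hℓ.2⟩
  have hβ : (1 - ℓ / k) * (1 / 2) + ℓ / k * (3 * k + 1 / 2) = 3 * ℓ + 1 / 2 := by
    field_simp; ring
  have h1 := h (1 / 2) (3 * k + 1 / 2) (ℓ / k) (by rw [abs_of_pos] <;> linarith)
    (by rw [abs_of_pos]; positivity) hθ _ _ (isSlowWeight_wt hε (Nat.zero_le k))
    (isSlowWeight_wt hε le_rfl) f (G (1 / 2)) (G (3 * k + 1 / 2)) (G (3 * ℓ + 1 / 2))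
    (hG _ ⟨le_rfl, by linarith⟩) (hG _ ⟨by linarith, le_rfl⟩)
    (by rw [hβ]; exact hG _ ⟨by linarith [hℓ.1], by linarith [hℓ.2]⟩)
  simp only [wt_geom_mean hε, div_mul_cancel₀ _ hk'.ne', ← wnorm_sq] at h1
  refine (ENNReal.pow_le_pow_left_iff two_ne_zero).1 ?_
  refine h1.trans ?_
  rw [mul_pow, ← ENNReal.ofReal_pow (Real.sqrt_nonneg _), Real.sq_sqrt hC.le, dataNorm]
  gcongr
  rw [add_sq]
  exact add_le_add_left le_self_add _

/-- Homogeneous and inhomogeneous weights are comparable only on lines that stay away from λ = 0. -/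
theorem one_add_abs_le_norm_line {β : ℝ} (hβ : 1 / 2 ≤ |β|) (ξ : ℝ) :
    1 + |ξ| ≤ 3 * ‖line β ξ‖ := by
  have h1 := Complex.abs_re_le_norm (line β ξ)
  have h2 := Complex.abs_im_le_norm (line β ξ)
  rw [line_re] at h1
  rw [line_im, abs_mul, abs_of_pos Real.two_pi_pos] at h2
  nlinarith [Real.pi_gt_three, abs_nonneg ξ]

theorem norm_line_le {k : ℕ} {β : ℝ} (hβ : |β| ≤ 3 * k + 1 / 2) (ξ : ℝ) :
    ‖line β ξ‖ ≤ (3 * k + 8) * (1 + |ξ|) := by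
  have h1 := Complex.norm_le_abs_re_add_abs_im (line β ξ)
  rw [line_re, line_im, abs_mul, abs_of_pos Real.two_pi_pos] at h1
  have : (0 : ℝ) ≤ k := Nat.cast_nonneg k
  nlinarith [Real.pi_lt_four, abs_nonneg ξ, mul_nonneg this (abs_nonneg ξ)]

theorem mu_line_le {k : ℕ} {β ε : ℝ} (hε : 0 < ε) (hβ : |β| ≤ 3 * k + 1 / 2) (ξ : ℝ) :
    mu ε (line β ξ) ≤ (3 * k + 8) * cutFreq ε ξ := by
  have : (0 : ℝ) ≤ k := Nat.cast_nonneg k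
  rw [mu, cutFreq, mul_min_of_nonneg _ _ (by positivity)]
  refine min_le_min (norm_line_le hβ ξ) ?_
  exact le_mul_of_one_le_left (by positivity) (by linarith)

theorem cutFreq_le_mu {β ε : ℝ} (hε : 0 < ε) (hβ : 1 / 2 ≤ |β|) (ξ : ℝ) :
    cutFreq ε ξ ≤ 3 * mu ε (line β ξ) := by
  rw [mu, cutFreq, mul_min_of_nonneg _ _ (by norm_num)]
  refine min_le_min (one_add_abs_le_norm_line hβ ξ) ?_
  exact le_mul_of_one_le_left (by positivity) (by norm_num)

theorem homWeight_le {k : ℕ} {β ε ℓ : ℝ} (hε : 0 < ε) (hβ : |β| ≤ 3 * k + 1 / 2)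
    (hℓ : ℓ ∈ Icc (0 : ℝ) k) (ξ : ℝ) : ‖line β ξ‖ ^ (3 * ℓ + 1) * mu ε (line β ξ) ^ ℓ
      ≤ (3 * k + 8) ^ (4 * k + 1) * wt ε ℓ ξ := by
  have hk : (0 : ℝ) ≤ k := Nat.cast_nonneg k
  have hm : 0 ≤ mu ε (line β ξ) := le_min (norm_nonneg _) (by positivity)
  have hc := cutFreq_pos hε ξ
  have h0 := hℓ.1
  calc _ ≤ ((3 * k + 8) * (1 + |ξ|)) ^ (3 * ℓ + 1) * ((3 * k + 8) * cutFreq ε ξ) ^ ℓ := by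
        have := norm_line_le hβ ξ
        have := mu_line_le hε hβ ξ
        gcongr
    _ = (3 * k + 8 : ℝ) ^ (4 * ℓ + 1) * wt ε ℓ ξ := by
        rw [wt, Real.mul_rpow (by positivity) (by positivity),
          Real.mul_rpow (by positivity) (by positivity),
          show 4 * ℓ + 1 = 3 * ℓ + 1 + ℓ by ring,
          Real.rpow_add (by positivity : (0 : ℝ) < 3 * k + 8) (3 * ℓ + 1)]
        generalize (3 * k + 8 : ℝ) ^ (3 * ℓ + 1) = a
        ring
    _ ≤ _ := by
        have := (wt_pos hε ℓ ξ).le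
        gcongr
        rw [← Real.rpow_natCast]
        refine Real.rpow_le_rpow_of_exponent_le (by linarith) ?_
        push_cast
        linarith [hℓ.2]

theorem homWeight_le_nat {k n : ℕ} {β ε : ℝ} (hε : 0 < ε) (hβ : |β| ≤ 3 * k + 1 / 2)
    (hn : n ≤ k) (ξ : ℝ) : ‖line β ξ‖ ^ (3 * n + 1) * mu ε (line β ξ) ^ n
      ≤ (3 * k + 8) ^ (4 * k + 1) * wt ε n ξ := by
  have h := homWeight_le hε hβ (ℓ := n) ⟨Nat.cast_nonneg n, by exact_mod_cast hn⟩ ξ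
  rw [Real.rpow_natCast] at h
  rw [← Real.rpow_natCast ‖line β ξ‖]
  push_cast
  exact h

theorem wt_le_homWeight {n : ℕ} {β ε : ℝ} (hε : 0 < ε) (hβ : 1 / 2 ≤ |β|) (ξ : ℝ) :
    wt ε n ξ ≤ 3 ^ (4 * n + 1) * (‖line β ξ‖ ^ (3 * n + 1) * mu ε (line β ξ) ^ n) := by
  have hc := (cutFreq_pos hε ξ).le
  rw [wt_natCast]
  calc _ ≤ (3 * ‖line β ξ‖) ^ (3 * n + 1) * (3 * mu ε (line β ξ)) ^ n := by
        have := one_add_abs_le_norm_line hβ ξ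
        have := cutFreq_le_mu hε hβ ξ
        gcongr
    _ = _ := by rw [mul_pow, mul_pow]; ring

/-- The transform is unique almost everywhere, so the infimum ranges over equal values. -/
theorem xHom_eq {ε : ℝ} {ℓ : ℕ} {f : ℝ → ℝ} {G : ℝ → ℂ}
    (h : IsLaplaceOnLine (3 * ℓ - 1 / 2) (fun u => f (Real.exp u)) G) :
    xHom ε ℓ f = eLpNorm (fun ξ => ‖line (3 * ℓ - 1 / 2) ξ‖ ^ (3 * ℓ + 1)
      * mu ε (line (3 * ℓ - 1 / 2) ξ) ^ ℓ * ‖G ξ‖) 2 volume := by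
  refine le_antisymm (iInf₂_le G h) (le_iInf₂ fun G' h' => le_of_eq ?_)
  refine eLpNorm_congr_ae ?_
  filter_upwards [IsL2Fourier.ae_unique (isLaplaceOnLine_iff.1 h) (isLaplaceOnLine_iff.1 h')]
    with ξ hξ
  rw [hξ]

theorem exists_of_xHom_ne_top {ε : ℝ} {ℓ : ℕ} {f : ℝ → ℝ} (h : xHom ε ℓ f ≠ ⊤) :
    ∃ G, IsLaplaceOnLine (3 * ℓ - 1 / 2) (fun u => f (Real.exp u)) G := by
  by_contra! hc
  exact h (iInf₂_eq_top.2 fun G hG => (hc G hG).elim)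

theorem xHom_le {ε : ℝ} (hε : 0 < ε) {k n : ℕ} (hn : n ≤ k) {f : ℝ → ℝ} {G : ℝ → ℂ}
    (h : IsLaplaceOnLine (3 * n - 1 / 2) (fun u => f (Real.exp u)) G) :
    xHom ε n f ≤ ENNReal.ofReal ((3 * k + 8) ^ (4 * k + 1)) * wnorm (wt ε n) G := by
  rw [xHom_eq h]
  refine eLpNorm_le_mul_eLpNorm_of_ae_le_mul (ae_of_all _ fun ξ => ?_) 2
  have hm : 0 ≤ mu ε (line (3 * n - 1 / 2) ξ) := le_min (norm_nonneg _) (by positivity)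
  have hβ : |(3 * n - 1 / 2 : ℝ)| ≤ 3 * k + 1 / 2 := by
    have : (n : ℝ) ≤ k := by exact_mod_cast hn
    have : (0 : ℝ) ≤ n := Nat.cast_nonneg n
    rw [abs_le]
    constructor <;> linarith
  rw [Real.norm_of_nonneg (by positivity),
    Real.norm_of_nonneg (mul_nonneg (wt_pos hε _ _).le (norm_nonneg _)), ← mul_assoc]
  exact mul_le_mul_of_nonneg_right (homWeight_le_nat hε hβ hn ξ) (norm_nonneg _)

theorem half_le_abs (n : ℕ) : 1 / 2 ≤ |(3 * n - 1 / 2 : ℝ)| := by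
  rcases Nat.eq_zero_or_pos n with rfl | h
  · norm_num
  · have : (1 : ℝ) ≤ n := by exact_mod_cast h
    rw [abs_of_pos] <;> linarith

theorem wnorm_le_xHom {ε : ℝ} (hε : 0 < ε) {n : ℕ} {f : ℝ → ℝ} {G : ℝ → ℂ}
    (h : IsLaplaceOnLine (3 * n - 1 / 2) (fun u => f (Real.exp u)) G) :
    wnorm (wt ε n) G ≤ ENNReal.ofReal (3 ^ (4 * n + 1)) * xHom ε n f := by
  rw [xHom_eq h]
  refine eLpNorm_le_mul_eLpNorm_of_ae_le_mul (ae_of_all _ fun ξ => ?_) 2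
  have hm : 0 ≤ mu ε (line (3 * n - 1 / 2) ξ) := le_min (norm_nonneg _) (by positivity)
  rw [Real.norm_of_nonneg (mul_nonneg (wt_pos hε _ _).le (norm_nonneg _)),
    Real.norm_of_nonneg (by positivity), ← mul_assoc]
  exact mul_le_mul_of_nonneg_right (wt_le_homWeight hε (half_le_abs n) ξ) (norm_nonneg _)

theorem memLp_inv_one_add_abs : MemLp (fun ξ : ℝ => (1 + |ξ|)⁻¹) 2 := by
  rw [memLp_two_iff_integrable_sq (by fun_prop (disch := intros; positivity))]
  have h : Continuous fun ξ : ℝ => ((1 + |ξ|)⁻¹) ^ 2 := by fun_prop (disch := intros; positivity)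
  refine (integrable_inv_one_add_sq.mono' h.aestronglyMeasurable (ae_of_all _ fun ξ => ?_))
  rw [Real.norm_of_nonneg (by positivity), inv_pow]
  gcongr
  nlinarith [sq_abs ξ, abs_nonneg ξ]

/-- A bound for the `L²`-norm of `1 / (1 + |ξ|)`. -/
def invFreqNorm : ℝ := (eLpNorm (fun ξ : ℝ => (1 + |ξ|)⁻¹) 2 volume).toReal

/-- Cauchy–Schwarz with the square integrable function 1/(1 + |ξ|). -/
theorem eLpNorm_one_le_wnorm {ε s : ℝ} (h0 : 0 < ε) (h1 : ε ≤ 1) (hs : 0 ≤ s) {G : ℝ → ℂ}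
    (hG : AEStronglyMeasurable G) :
    eLpNorm G 1 volume ≤ ENNReal.ofReal invFreqNorm * wnorm (wt ε s) G := by
  rw [invFreqNorm, ENNReal.ofReal_toReal memLp_inv_one_add_abs.2.ne]
  have h := eLpNorm_smul_le_mul_eLpNorm (p := 2) (q := 2) (r := 1) (μ := (volume : Measure ℝ))
    (f := fun ξ => wt ε s ξ * ‖G ξ‖) (φ := fun ξ : ℝ => (1 + |ξ|)⁻¹)
    ((continuous_wt h0 s).aestronglyMeasurable.mul hG.norm) memLp_inv_one_add_abs.1
  refine le_trans (eLpNorm_mono fun ξ => ?_) h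
  have := le_wt h0 h1 hs ξ
  have hw := (wt_pos h0 s ξ).le
  rw [Pi.smul_apply', smul_eq_mul, Real.norm_of_nonneg (by positivity), ← mul_assoc,
    inv_mul_eq_div]
  refine le_mul_of_one_le_left (norm_nonneg _) ?_
  rw [le_div_iff₀ (by positivity)]
  linarith

theorem integrable_of_wnorm {ε s : ℝ} (h0 : 0 < ε) (h1 : ε ≤ 1) (hs : 0 ≤ s) {G : ℝ → ℂ}
    (hG : AEStronglyMeasurable G) (h : wnorm (wt ε s) G ≠ ⊤) : Integrable G := by
  rw [← memLp_one_iff_integrable]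
  exact ⟨hG, (eLpNorm_one_le_wnorm h0 h1 hs hG).trans_lt
    (ENNReal.mul_lt_top ENNReal.ofReal_lt_top h.lt_top)⟩

theorem ofReal_integral_norm_le {ε s : ℝ} (h0 : 0 < ε) (h1 : ε ≤ 1) (hs : 0 ≤ s) {G : ℝ → ℂ}
    (hG : AEStronglyMeasurable G) (h : wnorm (wt ε s) G ≠ ⊤) :
    ENNReal.ofReal (∫ ξ, ‖G ξ‖) ≤ ENNReal.ofReal invFreqNorm * wnorm (wt ε s) G := by
  refine le_trans (le_of_eq ?_) (eLpNorm_one_le_wnorm h0 h1 hs hG)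
  rw [ofReal_integral_norm_eq_lintegral_enorm (integrable_of_wnorm h0 h1 hs hG h),
    eLpNorm_one_eq_lintegral_enorm]

theorem wnorm_add_le {w : ℝ → ℝ} (hw : Continuous w) (hw0 : ∀ ξ, 0 ≤ w ξ) {G G' : ℝ → ℂ}
    (h : AEStronglyMeasurable G) (h' : AEStronglyMeasurable G') :
    wnorm w (G + G') ≤ wnorm w G + wnorm w G' := by
  have h1 : AEStronglyMeasurable (fun ξ => w ξ * ‖G ξ‖) volume :=
    hw.aestronglyMeasurable.mul h.norm
  have h2 : AEStronglyMeasurable (fun ξ => w ξ * ‖G' ξ‖) volume :=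
    hw.aestronglyMeasurable.mul h'.norm
  have h3 := eLpNorm_add_le (p := 2) h1 h2 one_le_two
  refine le_trans ?_ h3
  unfold wnorm
  refine eLpNorm_mono fun ξ => ?_
  have h4 := hw0 ξ
  rw [Pi.add_apply, Pi.add_apply, Real.norm_of_nonneg (by positivity),
    Real.norm_of_nonneg (by positivity), ← mul_add]
  exact mul_le_mul_of_nonneg_left (norm_add_le _ _) h4

/-- The pointwise bound does not depend on v, so the supremum inside the integral costs nothing.
There are ⌊3ℓ+2⌋ + 1 ≤ 3k + 3 summands. -/
theorem IsEdgeData.stripNorm_le {k : ℕ} {ε : ℝ} {f : ℝ → ℝ} {G : ℝ → ℝ → ℂ}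
    (h : IsEdgeData k ε f G) {ℓ : ℝ} (hℓ : ℓ ∈ Icc (0 : ℝ) k) :
    stripNorm ε (3 * ℓ + 1 / 2) (3 * ℓ + 2) (ℓ + 1) (fun u v => ε * extension ε G (polar ε u v))
      ≤ ENNReal.ofReal ((3 * k + 3) * (30 * (3 * k + 8) ^ (4 * k + 1))) *
        wnorm (wt ε ℓ) (G (3 * ℓ + 1 / 2)) := by
  have hk : (0 : ℝ) ≤ k := Nat.cast_nonneg k
  have hβ : 3 * ℓ + 1 / 2 ∈ Icc (1 / 2 : ℝ) (3 * k + 1 / 2) :=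
    ⟨by linarith [hℓ.1], by linarith [hℓ.2]⟩
  have hβ' : |3 * ℓ + 1 / 2| ≤ 3 * k + 1 / 2 := by
    rw [abs_of_pos] <;> linarith [hβ.1, hβ.2]
  refine (iInf₂_le _ (h.isStripLaplace hβ)).trans ?_
  refine (Finset.sum_le_card_nsmul _ _ (ENNReal.ofReal (30 * (3 * k + 8) ^ (4 * k + 1)) *
    wnorm (wt ε ℓ) (G (3 * ℓ + 1 / 2))) fun j _ => ?_).trans ?_
  · set c : ℝ := 30 * (3 * k + 8) ^ (4 * k + 1) with hc
    have e : eLpNorm (fun ξ => c * (wt ε ℓ ξ * ‖G (3 * ℓ + 1 / 2) ξ‖)) 2 volume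
        ≤ ENNReal.ofReal c * wnorm (wt ε ℓ) (G (3 * ℓ + 1 / 2)) := by
      refine eLpNorm_le_mul_eLpNorm_of_ae_le_mul (ae_of_all _ fun ξ => ?_) 2
      rw [norm_mul, Real.norm_of_nonneg (by positivity : 0 ≤ c)]
    refine le_trans ?_ e
    rw [eLpNorm_eq_lintegral_rpow_enorm_toReal two_ne_zero ENNReal.ofNat_ne_top]
    simp only [ENNReal.toReal_ofNat]
    refine ENNReal.rpow_le_rpow (lintegral_mono fun ξ => ?_) (by norm_num)
    rw [← ENNReal.rpow_natCast, Nat.cast_ofNat]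
    refine ENNReal.rpow_le_rpow (iSup₂_le fun v hv => ?_) (by norm_num)
    have hw := (wt_pos h.adm.pos ℓ ξ).le
    rw [Real.enorm_of_nonneg (by positivity)]
    refine ENNReal.ofReal_le_ofReal ((h.stripTransform_bound hβ j ξ hv).trans ?_)
    rw [show 3 * ℓ + 2 - 1 = 3 * ℓ + 1 by ring, hc, mul_assoc, mul_assoc]
    have h1 := homWeight_le h.adm.pos hβ' hℓ ξ
    have h2 := mul_le_mul_of_nonneg_right h1 (norm_nonneg (G (3 * ℓ + 1 / 2) ξ))
    linarith
  · rw [Finset.card_range, nsmul_eq_mul,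
      ENNReal.ofReal_mul (p := 3 * (k : ℝ) + 3) (by positivity), mul_assoc]
    gcongr
    rw [← ENNReal.ofReal_natCast]
    refine ENNReal.ofReal_le_ofReal ?_
    push_cast
    have := Nat.floor_le (a := 3 * ℓ + 2) (by linarith [hℓ.1])
    linarith [hℓ.2]

/-! ### Decay of transforms of smooth, compactly supported functions; errors of the cut-off. -/

theorem integrable_section {V : Type*} [TopologicalSpace V] {R : ℝ} {F : V × ℝ → ℂ} (hF : Continuous F)
    {p : V} (h0 : ∀ u, R < |u| → F (p, u) = 0) :
    Integrable fun u => F (p, u) := by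
  refine (hF.comp (by fun_prop) : Continuous fun u => F (p, u)).integrable_of_hasCompactSupport ?_
  refine HasCompactSupport.of_support_subset_isCompact (isCompact_Icc (a := -R) (b := R))
    fun u hu => ?_
  by_contra hc
  refine hu (h0 u ?_)
  rw [mem_Icc, ← abs_le, not_le] at hc
  exact hc

section Parametric

variable {V : Type*} [NormedAddCommGroup V] [NormedSpace ℝ V] {K : Set V} {R : ℝ}

/-- Each differentiation in u gains a power of the frequency and preserves both smoothness in all
variables and the support. Compactness of the parameter set makes the constant uniform. -/
theorem exists_fourier_pow_bound (hK : IsCompact K) (N : ℕ) :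
    ∀ F : V × ℝ → ℂ, ContDiff ℝ ((⊤ : ℕ∞) : WithTop ℕ∞) F →
      (∀ p ∈ K, ∀ u, R < |u| → F (p, u) = 0) →
      ∃ C : ℝ, ∀ p ∈ K, ∀ ξ : ℝ, (2 * Real.pi * |ξ|) ^ N * ‖𝓕 (fun u => F (p, u)) ξ‖ ≤ C := by
  induction N with
  | zero =>
    intro F hF h0
    obtain ⟨C, hC⟩ := (hK.prod (isCompact_Icc (a := -R) (b := R))).exists_bound_of_continuousOn
      hF.continuous.continuousOn
    refine ⟨C * volume.real (Icc (-R) R), fun p hp ξ => ?_⟩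
    rw [pow_zero, one_mul, Real.fourier_eq]
    refine (norm_integral_le_integral_norm _).trans ?_
    simp only [Circle.norm_smul]
    have h1 : ∫ u in Icc (-R) R, ‖F (p, u)‖ = ∫ u, ‖F (p, u)‖ := by
      refine setIntegral_eq_integral_of_forall_compl_eq_zero fun u hu => ?_
      rw [mem_Icc, ← abs_le, not_le] at hu
      rw [h0 p hp u hu, norm_zero]
    rw [← h1]
    refine (Real.le_norm_self _).trans
      (norm_setIntegral_le_of_norm_le_const (by simp) fun u hu => ?_)
    rw [norm_norm]
    exact hC (p, u) ⟨hp, hu⟩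
  | succ N ih =>
    intro F hF h0
    set F' : V × ℝ → ℂ := fun z => fderiv ℝ F z (0, 1) with hF'
    have hd : ∀ p u, HasDerivAt (fun u => F (p, u)) (F' (p, u)) u := fun p u => by
      have h1 := (hF.differentiable (by simp) (p, u)).hasFDerivAt
      have h2 : HasDerivAt (fun u : ℝ => (p, u)) (0, 1) u :=
        (hasDerivAt_const u p).prodMk (hasDerivAt_id u)
      exact h1.comp_hasDerivAt u h2
    have hs : ContDiff ℝ ((⊤ : ℕ∞) : WithTop ℕ∞) F' :=
      (hF.fderiv_right (by simp)).clm_apply contDiff_const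
    have h0' : ∀ p ∈ K, ∀ u, R < |u| → F' (p, u) = 0 := fun p hp u hu => by
      rw [← (hd p u).deriv]
      have : (fun u => F (p, u)) =ᶠ[𝓝 u] fun _ => 0 := by
        filter_upwards [(isOpen_lt continuous_const continuous_abs).mem_nhds hu] with v hv
        exact h0 p hp v hv
      rw [this.deriv_eq, deriv_const]
    obtain ⟨C, hC⟩ := ih F' hs h0'
    refine ⟨C, fun p hp ξ => le_trans (le_of_eq ?_) (hC p hp ξ)⟩
    have e : deriv (fun u => F (p, u)) = fun u => F' (p, u) := funext fun u => (hd p u).deriv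
    have h3 := Real.fourier_deriv (integrable_section hF.continuous (h0 p hp))
      (fun u => (hd p u).differentiableAt)
      (by rw [e]; exact integrable_section hs.continuous (h0' p hp))
    rw [e] at h3
    rw [h3, norm_smul, pow_succ, mul_assoc]
    congr 2
    simp [abs_of_pos Real.pi_pos]

end Parametric

/-- `F` has on the line `Re λ = β` a Laplace transform with decay of order `N`. -/
def HasLaplaceDecay (β : ℝ) (N : ℕ) (F : ℝ → ℝ) (C : ℝ) : Prop :=
  ∃ T : ℝ → ℂ, IsLaplaceOnLine β F T ∧ ∀ ξ, (1 + |ξ|) ^ N * ‖T ξ‖ ≤ C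

theorem IsLaplaceOnLine.add {β : ℝ} {F F' : ℝ → ℝ} {T T' : ℝ → ℂ}
    (h : IsLaplaceOnLine β F T) (h' : IsLaplaceOnLine β F' T') : IsLaplaceOnLine β (fun u => F u + F' u) (T + T') := by
  have := (isLaplaceOnLine_iff.1 h).add (isLaplaceOnLine_iff.1 h')
  refine isLaplaceOnLine_iff.2 (this.congr (ae_of_all _ fun u => ?_) Filter.EventuallyEq.rfl)
  simp [mul_add]

theorem IsLaplaceOnLine.const_mul {β : ℝ} {F : ℝ → ℝ} {T : ℝ → ℂ} (c : ℝ)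
    (h : IsLaplaceOnLine β F T) : IsLaplaceOnLine β (fun u => c * F u) ((c : ℂ) • T) := by
  have := (isLaplaceOnLine_iff.1 h).const_smul (c : ℂ)
  refine isLaplaceOnLine_iff.2 (this.congr (ae_of_all _ fun u => ?_) Filter.EventuallyEq.rfl)
  simp [mul_left_comm]

theorem IsLaplaceOnLine.zero (β : ℝ) : IsLaplaceOnLine β (fun _ => 0) 0 := by
  have h : IsL2Fourier 0 (𝓕 (0 : ℝ → ℂ)) :=
    .of_integrable (integrable_zero _ _ _) MemLp.zero'
  refine isLaplaceOnLine_iff.2 (h.congr (ae_of_all _ fun u => by simp) (ae_of_all _ fun ξ => ?_))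
  simp [Real.fourier_eq]

namespace HasLaplaceDecay

variable {β C C' : ℝ} {N : ℕ} {F F' : ℝ → ℝ}

theorem add (h : HasLaplaceDecay β N F C) (h' : HasLaplaceDecay β N F' C') :
    HasLaplaceDecay β N (fun u => F u + F' u) (C + C') := by
  obtain ⟨T, h1, h2⟩ := h
  obtain ⟨T', h1', h2'⟩ := h'
  refine ⟨_, h1.add h1', fun ξ => ?_⟩
  calc _ ≤ (1 + |ξ|) ^ N * (‖T ξ‖ + ‖T' ξ‖) := by gcongr; exact norm_add_le _ _
    _ ≤ _ := by rw [mul_add]; exact add_le_add (h2 ξ) (h2' ξ)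

theorem const_mul (c : ℝ) (h : HasLaplaceDecay β N F C) :
    HasLaplaceDecay β N (fun u => c * F u) (|c| * C) := by
  obtain ⟨T, h1, h2⟩ := h
  refine ⟨_, h1.const_mul c, fun ξ => ?_⟩
  rw [Pi.smul_apply, norm_smul, Complex.norm_real, Real.norm_eq_abs, mul_left_comm]
  exact mul_le_mul_of_nonneg_left (h2 ξ) (abs_nonneg c)

theorem mono (h : HasLaplaceDecay β N F C) (hC : C ≤ C') : HasLaplaceDecay β N F C' :=
  h.imp fun _ h => ⟨h.1, fun ξ => (h.2 ξ).trans hC⟩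

theorem sum {n : ℕ} {F : ℕ → ℝ → ℝ} (h : ∀ m ∈ Finset.range n, HasLaplaceDecay β N (F m) C) :
    HasLaplaceDecay β N (fun u => ∑ m ∈ Finset.range n, F m u) (n * C) := by
  induction n with
  | zero => exact ⟨0, by simpa using IsLaplaceOnLine.zero β, fun ξ => by simp⟩
  | succ n ih =>
    simp only [Finset.sum_range_succ]
    have := (ih fun m hm => h m (Finset.mem_range.2 (by
      have := Finset.mem_range.1 hm; omega))).add (h n (by simp))
    refine this.mono (le_of_eq ?_)
    push_cast
    ring

end HasLaplaceDecay

/-- The line β is treated as a further compact parameter besides a. With a = log c this yields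
constants that do not depend on ε. -/
theorem exists_hasLaplaceDecay {g : ℝ × ℝ → ℝ} (hg : ContDiff ℝ ((⊤ : ℕ∞) : WithTop ℕ∞) g) {R : ℝ}
    (h0 : ∀ a ∈ Icc (0 : ℝ) 1, ∀ u, R < |u| → g (a, u) = 0) (B : ℝ) (N : ℕ) :
    ∃ C : ℝ, 0 ≤ C ∧ ∀ a ∈ Icc (0 : ℝ) 1, ∀ β, |β| ≤ B →
      HasLaplaceDecay β N (fun u => g (a, u)) C := by
  set F : (ℝ × ℝ) × ℝ → ℂ := fun z => ((Real.exp (-(z.1.2 * z.2)) * g (z.1.1, z.2) : ℝ) : ℂ)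
    with hF
  have hs : ContDiff ℝ ((⊤ : ℕ∞) : WithTop ℕ∞) F := by
    refine Complex.ofRealCLM.contDiff.comp (ContDiff.mul ?_ ?_)
    · exact Real.contDiff_exp.comp (by fun_prop)
    · exact hg.comp (by fun_prop)
  have h0' : ∀ p ∈ Icc (0 : ℝ) 1 ×ˢ Icc (-B) B, ∀ u, R < |u| → F (p, u) = 0 := fun p hp u hu => by
    simp [hF, h0 p.1 hp.1 u hu]
  have hK : IsCompact (Icc (0 : ℝ) 1 ×ˢ Icc (-B) B) := isCompact_Icc.prod isCompact_Icc
  obtain ⟨C₀, hC₀⟩ := exists_fourier_pow_bound hK 0 F hs h0'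
  obtain ⟨C₁, hC₁⟩ := exists_fourier_pow_bound hK N F hs h0'
  refine ⟨max 0 (2 ^ N * (C₀ + C₁)), le_max_left _ _, fun a ha β hβ => ?_⟩
  have hp : (a, β) ∈ Icc (0 : ℝ) 1 ×ˢ Icc (-B) B := ⟨ha, abs_le.1 hβ⟩
  have hi := integrable_section hs.continuous (h0' _ hp)
  obtain ⟨M, hM⟩ := ((hK.prod (isCompact_Icc (a := -R) (b := R)))).exists_bound_of_continuousOn
    hs.continuous.continuousOn
  refine ⟨𝓕 fun u => F ((a, β), u), isLaplaceOnLine_iff.2 (.of_integrable hi ?_), fun ξ => ?_⟩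
  · refine memLp_two_of_bounded (C := max M 0) hi fun u => ?_
    rcases le_or_gt |u| R with h | h
    · exact (hM ((a, β), u) ⟨hp, abs_le.1 h⟩).trans (le_max_left _ _)
    · show ‖F ((a, β), u)‖ ≤ _
      rw [h0' _ hp u h, norm_zero]
      exact le_max_right _ _
  · refine le_trans ?_ (le_max_right _ _)
    have h1 : (1 + |ξ|) ^ N ≤ 2 ^ N * (1 + (2 * Real.pi * |ξ|) ^ N) := by
      have h2 : |ξ| ≤ 2 * Real.pi * |ξ| := by
        nlinarith [Real.pi_gt_three, abs_nonneg ξ]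
      have h3 : (1 + |ξ|) ^ N ≤ (2 * max 1 |ξ|) ^ N := by
        gcongr
        linarith [le_max_left 1 |ξ|, le_max_right 1 |ξ|]
      refine h3.trans ?_
      rw [mul_pow]
      gcongr
      rcases le_total 1 |ξ| with h | h
      · rw [max_eq_right h]
        have : |ξ| ^ N ≤ (2 * Real.pi * |ξ|) ^ N := by gcongr
        linarith
      · rw [max_eq_left h, one_pow]
        have : 0 ≤ (2 * Real.pi * |ξ|) ^ N := by positivity
        linarith
    have h4 := hC₀ _ hp ξ
    have h5 := hC₁ _ hp ξ
    rw [pow_zero, one_mul] at h4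
    calc _ ≤ 2 ^ N * (1 + (2 * Real.pi * |ξ|) ^ N) * ‖𝓕 (fun u => F ((a, β), u)) ξ‖ := by gcongr
      _ = 2 ^ N * (‖𝓕 (fun u => F ((a, β), u)) ξ‖ +
          (2 * Real.pi * |ξ|) ^ N * ‖𝓕 (fun u => F ((a, β), u)) ξ‖) := by ring
      _ ≤ _ := by gcongr

namespace IsCutoff

variable {ζ : ℝ → ℝ}

theorem contDiff_deriv (hζ : IsCutoff ζ) : ContDiff ℝ ((⊤ : ℕ∞) : WithTop ℕ∞) (deriv ζ) :=
  (contDiff_infty_iff_deriv.1 hζ.smooth).2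

theorem deriv_eq_zero_of_lt (hζ : IsCutoff ζ) {r : ℝ} (h0 : 0 < r) (h1 : r < 1 / 8) :
    deriv ζ r = 0 := by
  have : ζ =ᶠ[𝓝 r] fun _ => 1 := by
    filter_upwards [Ioo_mem_nhds h0 h1] with s hs
    exact hζ.eq_one s (Ioo_subset_Icc_self hs)
  rw [this.deriv_eq, deriv_const]

theorem deriv_eq_zero_of_gt (hζ : IsCutoff ζ) {r : ℝ} (h1 : 1 / 4 < r) : deriv ζ r = 0 := by
  have : ζ =ᶠ[𝓝 r] fun _ => 0 := by
    filter_upwards [lt_mem_nhds h1] with s hs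
    exact hζ.eq_zero s (le_of_lt hs)
  rw [this.deriv_eq, deriv_const]

end IsCutoff

theorem exp_lt_of_lt_neg {t : ℝ} (h : t < -4) : Real.exp t < 1 / 8 := by
  have h1 : Real.exp t < Real.exp (-4) := Real.exp_lt_exp.2 h
  have h2 : (8 : ℝ) ≤ Real.exp 4 := by
    have : Real.exp 4 = Real.exp 1 ^ 4 := by rw [← Real.exp_nat_mul]; norm_num
    rw [this]
    have h3 : (2 : ℝ) ≤ Real.exp 1 := by linarith [Real.exp_one_gt_d9]
    calc (8 : ℝ) ≤ 2 ^ 4 := by norm_num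
      _ ≤ _ := by gcongr
  rw [Real.exp_neg] at h1
  refine h1.trans_le ?_
  rw [one_div]
  exact inv_anti₀ (by norm_num) h2

/-- The errors caused by moving the cut-off from `x` to the radius `c x` on the upper edge. -/
def cutoffError (ζ : ℝ → ℝ) (n : ℕ) (c : ℝ) (κ κ' : ℕ → ℝ) (x : ℝ) : ℝ :=
  ∑ m ∈ Finset.range n,
    (κ m * (deriv ζ (c * x) * x ^ (m + 1)) + κ' m * ((ζ (c * x) - ζ x) * x ^ m))

/-- The cut-offs at x and at cx agree near the vertex and far away, so in the variable log x every
summand is smooth and supported in a fixed interval, for all c between 1 and e. -/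
theorem exists_hasLaplaceDecay_cutoffError {ζ : ℝ → ℝ} (hζ : IsCutoff ζ) (n : ℕ) (B : ℝ) (N : ℕ) :
    ∃ C : ℝ, 0 ≤ C ∧ ∀ a ∈ Icc (0 : ℝ) 1, ∀ β, |β| ≤ B → ∀ (κ κ' : ℕ → ℝ) (M : ℝ),
      (∀ m < n, |κ m| ≤ M) → (∀ m < n, |κ' m| ≤ M) →
      HasLaplaceDecay β N (fun u => cutoffError ζ n (Real.exp a) κ κ' (Real.exp u)) (C * M) := by
  have e1 : ContDiff ℝ ((⊤ : ℕ∞) : WithTop ℕ∞) fun z : ℝ × ℝ => Real.exp z.1 * Real.exp z.2 :=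
    ContDiff.mul (Real.contDiff_exp.comp contDiff_fst) (Real.contDiff_exp.comp contDiff_snd)
  have e2 : ContDiff ℝ ((⊤ : ℕ∞) : WithTop ℕ∞) fun z : ℝ × ℝ => Real.exp z.2 :=
    Real.contDiff_exp.comp contDiff_snd
  -- The bound 5 is 4 + 1: e^{-4} < 1/8, and the shift a is at most 1.
  have l1 : ∀ a ∈ Icc (0 : ℝ) 1, ∀ u : ℝ, 5 < |u| →
      (Real.exp a * Real.exp u < 1 / 8 ∧ Real.exp u < 1 / 8) ∨
      (1 / 4 < Real.exp a * Real.exp u ∧ 1 / 4 < Real.exp u) := fun a ha u hu => by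
    rw [← Real.exp_add]
    rcases lt_abs.1 hu with h | h
    · right
      constructor <;> linarith [Real.add_one_le_exp (a + u), Real.add_one_le_exp u, ha.1]
    · left
      exact ⟨exp_lt_of_lt_neg (by linarith [ha.2]), exp_lt_of_lt_neg (by linarith)⟩
  have h1 : ∀ m : ℕ, ∃ C : ℝ, 0 ≤ C ∧ ∀ a ∈ Icc (0 : ℝ) 1, ∀ β, |β| ≤ B → HasLaplaceDecay β N
      (fun u => deriv ζ (Real.exp a * Real.exp u) * Real.exp u ^ (m + 1)) C := fun m => by
    refine exists_hasLaplaceDecay (g := fun z : ℝ × ℝ =>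
      deriv ζ (Real.exp z.1 * Real.exp z.2) * Real.exp z.2 ^ (m + 1)) (R := 5)
      ((hζ.contDiff_deriv.comp e1).mul (e2.pow _)) (fun a ha u hu => ?_) B N
    rcases l1 a ha u hu with h | h
    · rw [hζ.deriv_eq_zero_of_lt (by positivity) h.1, zero_mul]
    · rw [hζ.deriv_eq_zero_of_gt h.1, zero_mul]
  have h2 : ∀ m : ℕ, ∃ C : ℝ, 0 ≤ C ∧ ∀ a ∈ Icc (0 : ℝ) 1, ∀ β, |β| ≤ B → HasLaplaceDecay β N
      (fun u => (ζ (Real.exp a * Real.exp u) - ζ (Real.exp u)) * Real.exp u ^ m) C := fun m => by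
    refine exists_hasLaplaceDecay (g := fun z : ℝ × ℝ =>
      (ζ (Real.exp z.1 * Real.exp z.2) - ζ (Real.exp z.2)) * Real.exp z.2 ^ m) (R := 5)
      (((hζ.smooth.comp e1).sub (hζ.smooth.comp e2)).mul (e2.pow _)) (fun a ha u hu => ?_) B N
    have p1 := Real.exp_pos u
    have p2 := mul_pos (Real.exp_pos a) p1
    rcases l1 a ha u hu with h | h
    · simp only
      rw [hζ.eq_one _ ⟨p2.le, h.1.le⟩, hζ.eq_one _ ⟨p1.le, h.2.le⟩, sub_self, zero_mul]
    · simp only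
      rw [hζ.eq_zero _ h.1.le, hζ.eq_zero _ h.2.le, sub_self, zero_mul]
  choose C₁ hC₁ h1 using h1
  choose C₂ hC₂ h2 using h2
  set S : ℝ := ∑ m ∈ Finset.range n, (C₁ m + C₂ m) with hS
  have hS0 : 0 ≤ S := Finset.sum_nonneg fun m _ => add_nonneg (hC₁ m) (hC₂ m)
  refine ⟨n * S, by positivity, fun a ha β hβ κ κ' M hκ hκ' => ?_⟩
  refine (HasLaplaceDecay.sum (C := M * S) fun m hm => ?_).mono (by rw [mul_assoc, mul_comm M])
  have hm' := Finset.mem_range.1 hm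
  have hM : 0 ≤ M := (abs_nonneg _).trans (hκ m hm')
  refine (((h1 m a ha β hβ).const_mul (κ m)).add ((h2 m a ha β hβ).const_mul (κ' m))).mono ?_
  have h5 : C₁ m + C₂ m ≤ S :=
    Finset.single_le_sum (f := fun m => C₁ m + C₂ m) (fun i _ => add_nonneg (hC₁ i) (hC₂ i)) hm
  calc _ ≤ M * C₁ m + M * C₂ m :=
        add_le_add (mul_le_mul_of_nonneg_right (hκ m hm') (hC₁ m))
          (mul_le_mul_of_nonneg_right (hκ' m hm') (hC₂ m))
    _ = M * (C₁ m + C₂ m) := by ring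
    _ ≤ _ := by gcongr

/-- The weighted norm of a transform with decay. -/
theorem wnorm_le_of_decay {ε : ℝ} (hε : 0 < ε) {n k : ℕ} (hn : n ≤ k) {T : ℝ → ℂ} {C : ℝ}
    (hT : ∀ ξ, (1 + |ξ|) ^ (4 * k + 2) * ‖T ξ‖ ≤ C) :
    wnorm (wt ε n) T ≤ ENNReal.ofReal (C * invFreqNorm) := by
  have hC : 0 ≤ C := (by positivity : 0 ≤ (1 + |(0 : ℝ)|) ^ (4 * k + 2) * ‖T 0‖).trans (hT 0)
  rw [ENNReal.ofReal_mul hC, invFreqNorm, ENNReal.ofReal_toReal memLp_inv_one_add_abs.2.ne]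
  refine eLpNorm_le_mul_eLpNorm_of_ae_le_mul (ae_of_all _ fun ξ => ?_) 2
  have hw := (wt_pos hε n ξ).le
  have hc := (cutFreq_pos hε ξ).le
  rw [Real.norm_of_nonneg (by positivity), Real.norm_of_nonneg (by positivity), ← div_eq_mul_inv,
    le_div_iff₀ (by positivity)]
  refine le_trans ?_ (hT ξ)
  rw [wt_natCast]
  have h1 : (1 : ℝ) ≤ 1 + |ξ| := by linarith [abs_nonneg ξ]
  -- The order 4k + 2 consists of 3n+1 and n powers from the weight, both with n ≤ k, and one more
  -- for square integrability.
  calc (1 + |ξ|) ^ (3 * n + 1) * cutFreq ε ξ ^ n * ‖T ξ‖ * (1 + |ξ|)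
      ≤ (1 + |ξ|) ^ (3 * n + 1) * (1 + |ξ|) ^ n * ‖T ξ‖ * (1 + |ξ|) := by
        gcongr
        exact min_le_left _ _
    _ = (1 + |ξ|) ^ (4 * n + 2) * ‖T ξ‖ := by ring
    _ ≤ _ := by gcongr

/-! ### Reduction of the boundary data. -/

theorem exp_image_univ : Real.exp '' univ = Ioi 0 := by rw [image_univ, Real.range_exp]

theorem exp_image_Iic (s : ℝ) : Real.exp '' Iic s = Ioc 0 (Real.exp s) := by
  ext x
  constructor
  · rintro ⟨t, ht, rfl⟩
    exact ⟨Real.exp_pos t, Real.exp_le_exp.2 ht⟩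
  · rintro ⟨h0, h1⟩
    exact ⟨Real.log x, (Real.log_le_iff_le_exp h0).2 h1, Real.exp_log h0⟩

/-- The `L²`-norm on `(0, ∞)` is that of the Mellin transform on `Re λ = -1/2`. -/
theorem eLpNorm_Ioi_eq (g : ℝ → ℝ) : eLpNorm g 2 (volume.restrict (Ioi 0))
    = eLpNorm (fun u => ((Real.exp (-((-1 / 2) * u)) * g (Real.exp u) : ℝ) : ℂ)) 2 volume := by
  rw [eLpNorm_eq_lintegral_rpow_enorm_toReal two_ne_zero ENNReal.ofNat_ne_top,
    eLpNorm_eq_lintegral_rpow_enorm_toReal two_ne_zero ENNReal.ofNat_ne_top, ← exp_image_univ,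
    lintegral_image_eq_lintegral_abs_deriv_mul MeasurableSet.univ
      (fun x _ => (Real.hasDerivAt_exp x).hasDerivWithinAt) Real.exp_injective.injOn,
    setLIntegral_univ]
  congr 2 with u
  rw [Complex.ofReal_mul, enorm_mul, ENNReal.mul_rpow_of_nonneg _ _ (by norm_num)]
  have e : ∀ t : ℝ, ‖(t : ℂ)‖ₑ = ‖t‖ₑ := fun t => by
    rw [← ofReal_norm, Complex.norm_real, ofReal_norm]
  rw [e, e]
  congr 1
  rw [Real.enorm_of_nonneg (Real.exp_pos _).le, abs_of_pos (Real.exp_pos u),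
    ENNReal.ofReal_rpow_of_nonneg (Real.exp_pos _).le (by norm_num), ← Real.exp_mul]
  congr 2
  simp
  ring

theorem IsLaplaceOnLine.eLpNorm_Ioi {g : ℝ → ℝ} {T : ℝ → ℂ}
    (h : IsLaplaceOnLine (-1 / 2) (fun u => g (Real.exp u)) T) :
    eLpNorm g 2 (volume.restrict (Ioi 0)) = eLpNorm T 2 volume := by
  rw [eLpNorm_Ioi_eq, (isLaplaceOnLine_iff.1 h).eLpNorm_eq]

theorem eLpNorm_le_wnorm {ε s : ℝ} (h0 : 0 < ε) (h1 : ε ≤ 1) (hs : 0 ≤ s) (T : ℝ → ℂ) :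
    eLpNorm T 2 volume ≤ wnorm (wt ε s) T := by
  refine eLpNorm_mono fun ξ => ?_
  have := le_wt h0 h1 hs ξ
  rw [norm_mul, norm_norm, Real.norm_of_nonneg (wt_pos h0 s ξ).le]
  exact le_mul_of_one_le_left (norm_nonneg _) (by linarith [abs_nonneg ξ])

theorem IsLaplaceOnLine.exp_mul {β : ℝ} {g : ℝ → ℝ} {T : ℝ → ℂ} (h : IsLaplaceOnLine (β - 1) g T) :
    IsLaplaceOnLine β (fun s => Real.exp s * g s) T := by
  refine isLaplaceOnLine_iff.2 ((isLaplaceOnLine_iff.1 h).congr (ae_of_all _ fun s => ?_)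
    Filter.EventuallyEq.rfl)
  simp only
  rw [← mul_assoc, ← Real.exp_add]
  ring_nf

/-- For β between β₀ and β₁ the factor e^{-βu} is bounded by e^{-β₀u} + e^{-β₁u}. Thus the two
extreme lines give a transform on each line between them. -/
theorem IsLaplaceOnLine.exists_of_mem_Icc {β₀ β₁ β : ℝ} {F : ℝ → ℝ} {G₀ G₁ : ℝ → ℂ}
    (h₀ : IsLaplaceOnLine β₀ F G₀) (h₁ : IsLaplaceOnLine β₁ F G₁) (hβ : β ∈ Icc β₀ β₁) :
    ∃ G, IsLaplaceOnLine β F G := by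
  have m₀ := (isLaplaceOnLine_iff.1 h₀).memLp
  have m₁ := (isLaplaceOnLine_iff.1 h₁).memLp
  have e : ∀ u : ℝ, ((Real.exp (-(β * u)) * F u : ℝ) : ℂ)
      = (Real.exp ((β₀ - β) * u) : ℝ) * ((Real.exp (-(β₀ * u)) * F u : ℝ) : ℂ) := fun u => by
    rw [← Complex.ofReal_mul, ← mul_assoc, ← Real.exp_add]
    ring_nf
  have hm : AEStronglyMeasurable (fun u => ((Real.exp (-(β * u)) * F u : ℝ) : ℂ)) volume := by
    simp only [e]
    exact AEStronglyMeasurable.mul (Continuous.aestronglyMeasurable (by fun_prop)) m₀.1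
  have : MemLp (fun u => ((Real.exp (-(β * u)) * F u : ℝ) : ℂ)) 2 := by
    refine (m₀.norm.add m₁.norm).mono' hm (ae_of_all _ fun u => ?_)
    simp only [Pi.add_apply, Complex.norm_real, norm_mul, Real.norm_of_nonneg (Real.exp_pos _).le,
      ← add_mul]
    refine mul_le_mul_of_nonneg_right ?_ (norm_nonneg _)
    rcases le_total 0 u with h | h
    · exact (Real.exp_le_exp.2 (by nlinarith [hβ.1])).trans
        (le_add_of_nonneg_right (Real.exp_pos _).le)
    · exact (Real.exp_le_exp.2 (by nlinarith [hβ.2])).trans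
        (le_add_of_nonneg_left (Real.exp_pos _).le)
  exact ⟨_, isLaplaceOnLine_iff.2 (.of_memLp this)⟩

theorem abs_coeff_le_polyNorm (P : Polynomial ℝ) (m : ℕ) : |P.coeff m| ≤ polyNorm P := by
  rw [polyNorm]
  by_cases h : m ∈ P.support
  · refine Real.abs_le_sqrt ?_
    exact Finset.single_le_sum (f := fun i => P.coeff i ^ 2) (fun i _ => sq_nonneg _) h
  · rw [Polynomial.notMem_support_iff.1 h, abs_zero]
    exact Real.sqrt_nonneg _

theorem polyNorm_nonneg (P : Polynomial ℝ) : 0 ≤ polyNorm P := Real.sqrt_nonneg _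

theorem eval_eq_sum_range {n : ℕ} {P : Polynomial ℝ} (hn : 0 < n) (hP : P.degree < n) (x : ℝ) :
    P.eval x = ∑ m ∈ Finset.range n, P.coeff m * x ^ m :=
  Polynomial.eval_eq_sum_range' (by
    rcases eq_or_ne P 0 with rfl | h
    · simpa using hn
    · exact (Polynomial.natDegree_lt_iff_degree_lt h).2 hP) x

/-- The primitive of `P` which vanishes at `0`. -/
def primitive (n : ℕ) (P : Polynomial ℝ) (x : ℝ) : ℝ :=
  ∑ m ∈ Finset.range n, P.coeff m / (m + 1) * x ^ (m + 1)

theorem hasDerivAt_primitive {n : ℕ} {P : Polynomial ℝ} (hn : 0 < n) (hP : P.degree < n) (x : ℝ) :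
    HasDerivAt (primitive n P) (P.eval x) x := by
  rw [eval_eq_sum_range hn hP]
  refine HasDerivAt.fun_sum fun m _ => ?_
  refine ((hasDerivAt_pow (m + 1) x).const_mul _).congr_deriv ?_
  have : (m : ℝ) + 1 ≠ 0 := by positivity
  push_cast
  field_simp

theorem primitive_zero (n : ℕ) (P : Polynomial ℝ) : primitive n P 0 = 0 :=
  Finset.sum_eq_zero fun m _ => by simp

/-- `φ` without the derivative of `ζ(c x) Q(x)`, where `Q` is the primitive of `P`. -/
def reducedData (ζ : ℝ → ℝ) (n : ℕ) (c : ℝ) (φ : ℝ → ℝ) (P : Polynomial ℝ) (x : ℝ) : ℝ :=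
  (φ x - ζ x * P.eval x)
    + cutoffError ζ n c (fun m => -(c * (P.coeff m / (m + 1)))) (fun m => -P.coeff m) x

/-- In this form the subtracted term is visibly the derivative of ζ(cx) times the primitive of P.
The definition displays it instead as φ - ζP, whose norm is given, plus the harmless errors. -/
theorem reducedData_eq (ζ : ℝ → ℝ) {n : ℕ} (hn : 0 < n) (c : ℝ) (φ : ℝ → ℝ) {P : Polynomial ℝ}
    (hP : P.degree < n) (x : ℝ) : reducedData ζ n c φ P x
      = φ x - (deriv ζ (c * x) * c * primitive n P x + ζ (c * x) * P.eval x) := by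
  rw [reducedData, cutoffError, primitive, eval_eq_sum_range hn hP, Finset.mul_sum, Finset.mul_sum,
    Finset.mul_sum, ← Finset.sum_add_distrib, sub_add, sub_right_inj, ← Finset.sum_sub_distrib]
  refine Finset.sum_congr rfl fun m _ => ?_
  ring

/-- The primitive of P vanishes at 0, so the subtracted derivative integrates without a boundary
term there; the rest is the substitution x = e^σ. -/
theorem integral_eq_integral_reducedData {ζ : ℝ → ℝ} (hζ : IsCutoff ζ) {n : ℕ} (hn : 0 < n) (c : ℝ)
    (φ : ℝ → ℝ) {P : Polynomial ℝ} (hP : P.degree < n) {s : ℝ}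
    (h : IntegrableOn (fun σ => Real.exp σ * reducedData ζ n c φ P (Real.exp σ)) (Iic s)) :
    ∫ x in (0 : ℝ)..Real.exp s, φ x = (∫ σ in Iic s, Real.exp σ * reducedData ζ n c φ P (Real.exp σ))
      + ζ (c * Real.exp s) * primitive n P (Real.exp s) := by
  set q := reducedData ζ n c φ P with hq
  have hd : ∀ x ∈ Iic s, HasDerivWithinAt Real.exp (Real.exp x) (Iic s) x :=
    fun x _ => (Real.hasDerivAt_exp x).hasDerivWithinAt
  have h1 : IntegrableOn q (Ioc 0 (Real.exp s)) := by
    rw [← exp_image_Iic, integrableOn_image_iff_integrableOn_abs_deriv_smul measurableSet_Iic hd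
      Real.exp_injective.injOn]
    simpa only [abs_of_pos (Real.exp_pos _), smul_eq_mul] using h
  have h2 : ∫ x in (0 : ℝ)..Real.exp s, q x = ∫ σ in Iic s, Real.exp σ * q (Real.exp σ) := by
    rw [intervalIntegral.integral_of_le (Real.exp_pos s).le, ← exp_image_Iic,
      integral_image_eq_integral_abs_deriv_smul measurableSet_Iic hd Real.exp_injective.injOn]
    simp only [abs_of_pos (Real.exp_pos _), smul_eq_mul]
  have hder : ∀ x, HasDerivAt (fun x => ζ (c * x) * primitive n P x)
      (deriv ζ (c * x) * c * primitive n P x + ζ (c * x) * P.eval x) x := fun x => by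
    have h3 := ((hζ.smooth.differentiable (by simp)) (c * x)).hasDerivAt
    have h4 : HasDerivAt (fun x => c * x) c x := by simpa using (hasDerivAt_id x).const_mul c
    exact (h3.comp x h4).mul (hasDerivAt_primitive hn hP x)
  have hcont : Continuous fun x =>
      deriv ζ (c * x) * c * primitive n P x + ζ (c * x) * P.eval x := by
    have c1 := hζ.contDiff_deriv.continuous
    have c2 := hζ.smooth.continuous
    have c3 : Continuous (primitive n P) := by unfold primitive; fun_prop
    have c4 : Continuous fun x => P.eval x := P.continuous
    fun_prop
  have h5 := intervalIntegral.integral_eq_sub_of_hasDerivAt (fun x _ => hder x)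
    (hcont.intervalIntegrable 0 (Real.exp s))
  rw [primitive_zero, mul_zero, sub_zero] at h5
  rw [← h2, ← h5, ← intervalIntegral.integral_add
    ((intervalIntegrable_iff_integrableOn_Ioc_of_le (Real.exp_pos s).le).2 h1)
    (hcont.intervalIntegrable _ _)]
  refine intervalIntegral.integral_congr fun x _ => ?_
  simp only [hq, reducedData_eq ζ hn c φ hP x]
  ring

theorem logC_mem_Icc {k : ℕ} {ε : ℝ} (h : IsAdmissible k ε) : logC ε ∈ Icc (0 : ℝ) 1 := by
  refine ⟨logC_nonneg ε, ?_⟩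
  rw [← Real.exp_le_exp, exp_logC, Real.sqrt_le_left (Real.exp_pos 1).le]
  nlinarith [h.lt_half, h.pos, Real.exp_one_gt_d9]

theorem exp_logC_le_two {k : ℕ} {ε : ℝ} (h : IsAdmissible k ε) : Real.exp (logC ε) ≤ 2 := by
  rw [exp_logC, Real.sqrt_le_left two_pos.le]
  nlinarith [h.lt_half, h.pos]

/-- Only the seminorms with ℓ = 0 and ℓ = k are needed: they give the transforms on the extreme
lines, and everything between is interpolated. The factor e^s moves the line 3ℓ - 1/2 to 3ℓ + 1/2.
-/
theorem exists_isEdgeData {k : ℕ} (hk : 1 ≤ k) {ζ : ℝ → ℝ} (hζ : IsCutoff ζ) :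
    ∃ C : ℝ, 0 < C ∧ ∀ ε, IsAdmissible k ε → ∀ (φ : ℝ → ℝ) (P : Polynomial ℝ),
      xHom ε 0 (fun x => φ x - ζ x * P.eval x) ≠ ⊤ → xHom ε k (fun x => φ x - ζ x * P.eval x) ≠ ⊤ →
      ∃ G, IsEdgeData k ε (fun s => Real.exp s *
          reducedData ζ (3 * k) (Real.exp (logC ε)) φ P (Real.exp s)) G ∧
        dataNorm k ε G ≤ ENNReal.ofReal C * (ENNReal.ofReal (polyNorm P)
          + xHom ε 0 (fun x => φ x - ζ x * P.eval x)
          + xHom ε k (fun x => φ x - ζ x * P.eval x)) := by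
  obtain ⟨C₁, hC₁, hint⟩ := exists_wnorm_interpolation hk
  obtain ⟨C₂, hC₂, herr⟩ := exists_hasLaplaceDecay_cutoffError hζ (3 * k) (3 * k) (4 * k + 2)
  set A : ℝ := C₂ * 2 * invFreqNorm with hA
  have hinv : 0 ≤ invFreqNorm := ENNReal.toReal_nonneg
  have hA0 : 0 ≤ A := by positivity
  refine ⟨2 * A + 3 ^ (4 * k + 1), by positivity, fun ε hε φ P h0 hk0 => ?_⟩
  have hkR : (1 : ℝ) ≤ k := by exact_mod_cast hk
  set φ₀ : ℝ → ℝ := fun x => φ x - ζ x * P.eval x with hφ₀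
  have hp := abs_coeff_le_polyNorm P
  have hpn := polyNorm_nonneg P
  set c := Real.exp (logC ε) with hc
  have hc0 : 0 < c := Real.exp_pos _
  have hc2 : c ≤ 2 := exp_logC_le_two hε
  have key : ∀ n : ℕ, n ≤ k → xHom ε n φ₀ ≠ ⊤ → ∃ G, IsLaplaceOnLine (3 * n + 1 / 2)
      (fun s => Real.exp s * reducedData ζ (3 * k) c φ P (Real.exp s)) G ∧
      wnorm (wt ε n) G ≤ ENNReal.ofReal A * ENNReal.ofReal (polyNorm P)
        + ENNReal.ofReal (3 ^ (4 * k + 1)) * xHom ε n φ₀ := fun n hn hx => by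
    obtain ⟨G₀, hG₀⟩ := exists_of_xHom_ne_top hx
    have hnR : (n : ℝ) ≤ k := by exact_mod_cast hn
    have hn0 : (0 : ℝ) ≤ n := Nat.cast_nonneg n
    obtain ⟨T, hT, hTb⟩ := herr (logC ε) (logC_mem_Icc hε) (3 * n - 1 / 2)
      (by rw [abs_le]; constructor <;> linarith)
      (fun m => -(c * (P.coeff m / (m + 1)))) (fun m => -P.coeff m) (2 * polyNorm P)
      (fun m _ => by
        rw [abs_neg, abs_mul, abs_of_pos hc0, abs_div, abs_of_pos (by positivity : (0:ℝ) < m + 1)]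
        refine mul_le_mul hc2 ((div_le_self (abs_nonneg _) ?_).trans (hp m)) (by positivity)
          two_pos.le
        linarith [(Nat.cast_nonneg m : (0 : ℝ) ≤ m)])
      (fun m _ => by rw [abs_neg]; linarith [hp m])
    refine ⟨G₀ + T, IsLaplaceOnLine.exp_mul ?_, ?_⟩
    · rw [show (3 * n + 1 / 2 - 1 : ℝ) = 3 * n - 1 / 2 by ring]
      exact hG₀.add hT
    · refine (wnorm_add_le (continuous_wt hε.pos n) (fun ξ => (wt_pos hε.pos n ξ).le)
        (isLaplaceOnLine_iff.1 hG₀).memLp_transform.1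
        (isLaplaceOnLine_iff.1 hT).memLp_transform.1).trans ?_
      rw [add_comm]
      refine add_le_add ((wnorm_le_of_decay hε.pos hn hTb).trans (le_of_eq ?_))
        ((wnorm_le_xHom hε.pos hG₀).trans ?_)
      · rw [← ENNReal.ofReal_mul hA0, hA]
        ring_nf
      · gcongr
        norm_num
  obtain ⟨G₀, hG₀, hb₀⟩ := key 0 (Nat.zero_le k) h0
  obtain ⟨G₁, hG₁, hb₁⟩ := key k le_rfl hk0
  rw [Nat.cast_zero, mul_zero, zero_add] at hG₀
  have hex : ∀ β, ∃ G, β ∈ Icc (1 / 2 : ℝ) (3 * k + 1 / 2) → IsLaplaceOnLine β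
      (fun s => Real.exp s * reducedData ζ (3 * k) c φ P (Real.exp s)) G := fun β => by
    by_cases hβ : β ∈ Icc (1 / 2 : ℝ) (3 * k + 1 / 2)
    · obtain ⟨G, hG⟩ := hG₀.exists_of_mem_Icc hG₁ hβ
      exact ⟨G, fun _ => hG⟩
    · exact ⟨0, fun h => (hβ h).elim⟩
  choose G hG using hex
  have e₀ : G (1 / 2) =ᵐ[volume] G₀ :=
    (isLaplaceOnLine_iff.1 (hG _ ⟨le_rfl, by linarith⟩)).ae_unique (isLaplaceOnLine_iff.1 hG₀)
  have e₁ : G (3 * k + 1 / 2) =ᵐ[volume] G₁ :=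
    (isLaplaceOnLine_iff.1 (hG _ ⟨by linarith, le_rfl⟩)).ae_unique (isLaplaceOnLine_iff.1 hG₁)
  have hnorm : dataNorm k ε G ≤ ENNReal.ofReal (2 * A + 3 ^ (4 * k + 1)) *
      (ENNReal.ofReal (polyNorm P) + xHom ε 0 φ₀ + xHom ε k φ₀) := by
    rw [dataNorm, wnorm_congr_ae e₀, wnorm_congr_ae e₁]
    refine (add_le_add hb₀ hb₁).trans ?_
    rw [ENNReal.ofReal_add (by positivity) (by positivity), ENNReal.ofReal_mul two_pos.le,
      ENNReal.ofReal_ofNat]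
    generalize ENNReal.ofReal A = a
    generalize ENNReal.ofReal (3 ^ (4 * k + 1)) = b
    generalize ENNReal.ofReal (polyNorm P) = x
    generalize xHom ε 0 φ₀ = y
    generalize xHom ε k φ₀ = z
    calc a * x + b * y + (a * x + b * z) = 2 * a * x + b * (y + z) := by ring
      _ ≤ 2 * a * (x + y + z) + b * (x + y + z) := by
        refine add_le_add (mul_le_mul_right ?_ _) (mul_le_mul_right ?_ _)
        · rw [add_assoc]; exact le_self_add
        · rw [add_assoc]; exact le_add_self
      _ = _ := by ring
  refine ⟨G, ⟨hε, hG, fun β hβ => ?_⟩, hnorm⟩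
  -- Integrability on an intermediate line comes from interpolation at the real order ℓ with 3ℓ +
  -- 1/2 = β.
  have hℓ : (β - 1 / 2) / 3 ∈ Icc (0 : ℝ) k := ⟨by linarith [hβ.1], by linarith [hβ.2]⟩
  have h1 := hint ε hε.pos _ G hG _ hℓ
  rw [show 3 * ((β - 1 / 2) / 3) + 1 / 2 = β by ring] at h1
  refine integrable_of_wnorm hε.pos (by linarith [hε.lt_half]) hℓ.1
    (isLaplaceOnLine_iff.1 (hG β hβ)).memLp_transform.1 (h1.trans_lt ?_).ne
  refine ENNReal.mul_lt_top ENNReal.ofReal_lt_top (hnorm.trans_lt ?_)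
  exact ENNReal.mul_lt_top ENNReal.ofReal_lt_top (ENNReal.add_lt_top.2
    ⟨ENNReal.add_lt_top.2 ⟨ENNReal.ofReal_lt_top, h0.lt_top⟩, hk0.lt_top⟩)

/-! ### A Taylor polynomial which nearly attains the infimum. -/

/-- The sum in the infimum which defines `xNorm`. -/
def xNormOf (ε : ℝ) (ζ : ℝ → ℝ) (k : ℕ) (f : ℝ → ℝ) (P : Polynomial ℝ) : ℝ≥0∞ :=
  ENNReal.ofReal (polyNorm P)
    + eLpNorm (fun x => f x - ζ x * P.eval x) 2 (volume.restrict (Ioi 0))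
    + ∑ ℓ ∈ Finset.range (k + 1), xHom ε ℓ (fun x => f x - ζ x * P.eval x)

theorem polyNorm_le_xNormOf (ε : ℝ) (ζ : ℝ → ℝ) (k : ℕ) (f : ℝ → ℝ) (P : Polynomial ℝ) :
    ENNReal.ofReal (polyNorm P) ≤ xNormOf ε ζ k f P := by
  rw [xNormOf, add_assoc]
  exact le_self_add

theorem xHom_le_xNormOf (ε : ℝ) (ζ : ℝ → ℝ) {k ℓ : ℕ} (hℓ : ℓ ≤ k) (f : ℝ → ℝ) (P : Polynomial ℝ) :
    xHom ε ℓ (fun x => f x - ζ x * P.eval x) ≤ xNormOf ε ζ k f P := by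
  refine le_trans ?_ le_add_self
  exact Finset.single_le_sum (f := fun ℓ => xHom ε ℓ (fun x => f x - ζ x * P.eval x))
    (fun _ _ => zero_le) (Finset.mem_range.2 (by omega))

theorem memLp_exp_half : MemLp (fun u : ℝ => Real.exp (u / 2) * (Iic (0 : ℝ)).indicator 1 u) 2 := by
  rw [memLp_two_iff_integrable_sq]
  · have h : IntegrableOn Real.exp (Iic 0) := integrableOn_exp_Iic 0
    rw [← integrable_indicator_iff measurableSet_Iic] at h
    refine h.congr (ae_of_all _ fun u => ?_)
    by_cases hu : u ∈ Iic (0 : ℝ)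
    · simp only [indicator_of_mem hu, Pi.one_apply, mul_one, ← Real.exp_nat_mul]
      congr 1; push_cast; ring
    · simp [indicator_of_notMem hu]
  · exact (Real.continuous_exp.comp (by fun_prop)).aestronglyMeasurable.mul
      (measurable_one.indicator measurableSet_Iic).aestronglyMeasurable

theorem xNormOf_zero_of_ae {ε : ℝ} {ζ : ℝ → ℝ} {k : ℕ} {f : ℝ → ℝ}
    (h : ∀ᵐ u : ℝ, f (Real.exp u) = 0) : xNormOf ε ζ k f 0 = 0 := by
  have hl : ∀ β, IsLaplaceOnLine β (fun u => f (Real.exp u) - ζ (Real.exp u) *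
      (0 : Polynomial ℝ).eval (Real.exp u)) 0 := fun β => by
    refine isLaplaceOnLine_iff.2 ((isLaplaceOnLine_iff.1 (IsLaplaceOnLine.zero β)).congr ?_
      Filter.EventuallyEq.rfl)
    filter_upwards [h] with u hu
    simp [hu]
  rw [xNormOf, (hl (-1 / 2)).eLpNorm_Ioi (g := fun x => f x - ζ x * (0 : Polynomial ℝ).eval x)]
  have h2 : ∀ ℓ : ℕ, xHom ε ℓ (fun x => f x - ζ x * (0 : Polynomial ℝ).eval x) = 0 := fun ℓ => by
    rw [xHom_eq (hl _)]
    simp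
  simp only [h2, Finset.sum_const_zero, add_zero, eLpNorm_zero]
  simp [polyNorm]

/-- A positive finite infimum is attained up to the factor 2. If it vanishes, this argument fails,
and instead f(e^u) is shown to be 0 almost everywhere, so that P = 0 attains it. -/
theorem exists_xNormOf_le {ε : ℝ} {ζ : ℝ → ℝ} (hζ : IsCutoff ζ) {k : ℕ} (hk : 1 ≤ k)
    {f : ℝ → ℝ} (hf : xNorm ε ζ k f ≠ ⊤) :
    ∃ P : Polynomial ℝ, P.degree < (3 * k : ℕ) ∧ xNormOf ε ζ k f P ≤ 2 * xNorm ε ζ k f := by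
  have happrox : ∀ x, xNorm ε ζ k f < x → ∃ P : Polynomial ℝ, P.degree < (3 * k : ℕ) ∧
      xNormOf ε ζ k f P < x := fun x hx => by
    obtain ⟨P, hP⟩ := iInf_lt_iff.1 hx
    obtain ⟨hd, hP⟩ := iInf_lt_iff.1 hP
    exact ⟨P, hd, hP⟩
  rcases eq_or_ne (xNorm ε ζ k f) 0 with h0 | h0
  · refine ⟨0, by rw [Polynomial.degree_zero]; exact WithBot.bot_lt_coe _, ?_⟩
    rw [h0, mul_zero, nonpos_iff_eq_zero]
    refine xNormOf_zero_of_ae ?_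
    set F : ℝ → ℂ := fun u => ((Real.exp (-((-1 / 2) * u)) * f (Real.exp u) : ℝ) : ℂ) with hF
    set E : ℝ → ℝ := fun u => Real.exp (u / 2) * (Iic (0 : ℝ)).indicator 1 u with hE
    -- With any admissible P the L²-norm of f itself is bounded, because ζP lives on x ≤ 1 and is
    -- controlled by the coefficients. Letting the sum tend to 0 over P gives f = 0.
    have key : ∀ P : Polynomial ℝ, P.degree < (3 * k : ℕ) → xNormOf ε ζ k f P ≠ ⊤ →
        AEStronglyMeasurable F volume ∧ eLpNorm F 2 volume ≤ (1 + ENNReal.ofReal (3 * k) *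
          eLpNorm E 2 volume) * xNormOf ε ζ k f P := fun P hP ht => by
      obtain ⟨G, hG⟩ := exists_of_xHom_ne_top
        (ne_top_of_le_ne_top ht (xHom_le_xNormOf ε ζ (Nat.zero_le k) f P))
      rw [show (3 * ((0 : ℕ) : ℝ) - 1 / 2) = -1 / 2 by norm_num] at hG
      have h1 := (isLaplaceOnLine_iff.1 hG).memLp
      set F₀ : ℝ → ℂ := fun u => ((Real.exp (-((-1 / 2) * u)) *
        (f (Real.exp u) - ζ (Real.exp u) * P.eval (Real.exp u)) : ℝ) : ℂ) with hF₀
      set F₁ : ℝ → ℂ := fun u => ((Real.exp (-((-1 / 2) * u)) *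
        (ζ (Real.exp u) * P.eval (Real.exp u)) : ℝ) : ℂ) with hF₁
      have e : F = F₀ + F₁ := by
        ext u
        rw [hF, hF₀, hF₁, Pi.add_apply, ← Complex.ofReal_add]
        ring_nf
      have hm : AEStronglyMeasurable F₁ volume := by
        have c2 := hζ.smooth.continuous
        have c4 : Continuous fun x => P.eval x := P.continuous
        exact Continuous.aestronglyMeasurable (by fun_prop)
      have hb : eLpNorm F₁ 2 volume ≤ ENNReal.ofReal (3 * k * polyNorm P) * eLpNorm E 2 volume := by
        refine eLpNorm_le_mul_eLpNorm_of_ae_le_mul (ae_of_all _ fun u => ?_) 2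
        have hx := Real.exp_pos u
        have hp := polyNorm_nonneg P
        rw [hF₁, hE, Complex.norm_real, norm_mul, norm_mul, Real.norm_of_nonneg (Real.exp_pos _).le,
          show -(-1 / 2 * u) = u / 2 by ring, norm_mul, Real.norm_of_nonneg (Real.exp_pos _).le]
        by_cases hu : u ∈ Iic (0 : ℝ)
        · have hx1 : Real.exp u ≤ 1 := Real.exp_le_one_iff.2 hu
          rw [indicator_of_mem hu, Pi.one_apply, norm_one, mul_one, mul_comm]
          refine mul_le_mul_of_nonneg_right ?_ (Real.exp_pos _).le
          have h3 := hζ.mem_Icc _ hx.le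
          have h4 : ‖P.eval (Real.exp u)‖ ≤ 3 * k * polyNorm P := by
            rw [eval_eq_sum_range (by omega) hP]
            refine (norm_sum_le _ _).trans ((Finset.sum_le_card_nsmul _ _ (polyNorm P)
              fun m _ => ?_).trans (le_of_eq ?_))
            · rw [norm_mul, norm_pow, Real.norm_of_nonneg hx.le, Real.norm_eq_abs]
              exact (mul_le_of_le_one_right (abs_nonneg _) (pow_le_one₀ hx.le hx1)).trans
                (abs_coeff_le_polyNorm P m)
            · rw [Finset.card_range, nsmul_eq_mul]
              push_cast
              ring
          rw [Real.norm_of_nonneg h3.1]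
          exact (mul_le_of_le_one_left (norm_nonneg _) h3.2).trans h4
        · have hx1 : 1 / 4 ≤ Real.exp u := by
            have := Real.one_lt_exp_iff.2 (not_le.1 hu)
            linarith
          rw [hζ.eq_zero _ hx1, norm_zero, zero_mul, mul_zero]
          positivity
      rw [e]
      refine ⟨h1.1.add hm, (eLpNorm_add_le h1.1 hm one_le_two).trans ?_⟩
      rw [add_mul, one_mul]
      refine add_le_add ?_ (hb.trans ?_)
      · rw [← eLpNorm_Ioi_eq (fun x => f x - ζ x * P.eval x), xNormOf]
        exact (le_add_self).trans le_self_add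
      · rw [ENNReal.ofReal_mul (by positivity), mul_assoc, mul_assoc, mul_comm (eLpNorm E 2 volume)]
        gcongr
        exact polyNorm_le_xNormOf ε ζ k f P
    have hB : (1 + ENNReal.ofReal (3 * k) * eLpNorm E 2 volume) ≠ ⊤ :=
      ENNReal.add_ne_top.2 ⟨ENNReal.one_ne_top,
        ENNReal.mul_ne_top ENNReal.ofReal_ne_top memLp_exp_half.2.ne⟩
    obtain ⟨P₁, hP₁, hx₁⟩ := happrox 1 (by rw [h0]; exact one_pos)
    have hz : eLpNorm F 2 volume = 0 := by
      by_contra hne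
      obtain ⟨P, hP, hx⟩ := happrox (eLpNorm F 2 volume /
        (1 + ENNReal.ofReal (3 * k) * eLpNorm E 2 volume)) (by
          rw [h0]; exact ENNReal.div_pos hne hB)
      have := (key P hP (ne_top_of_lt hx)).2
      rw [ENNReal.lt_div_iff_mul_lt (Or.inl (by simp)) (Or.inl hB), mul_comm] at hx
      exact absurd this (not_le.2 hx)
    have := (eLpNorm_eq_zero_iff (key P₁ hP₁ (ne_top_of_lt hx₁)).1 two_ne_zero).1 hz
    filter_upwards [this] with u hu
    rw [hF, Pi.zero_apply, Complex.ofReal_eq_zero] at hu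
    exact (mul_eq_zero.1 hu).resolve_left (Real.exp_pos _).ne'
  · obtain ⟨P, hP, hx⟩ := happrox (2 * xNorm ε ζ k f) (by
      rw [two_mul]; exact ENNReal.lt_add_right hf h0)
    exact ⟨P, hP, hx.le⟩

/-! ### The harmonic polynomial with prescribed values on the upper edge. -/

theorem polyNorm_le {n : ℕ} {P : Polynomial ℝ} (hP : P.degree < n) {B : ℝ} (hB : 0 ≤ B)
    (h : ∀ m, |P.coeff m| ≤ B) : polyNorm P ≤ n * B := by
  rw [polyNorm, Real.sqrt_le_left (by positivity)]
  have hc : P.support.card ≤ n := by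
    refine (Finset.card_le_card (t := Finset.range n) fun m hm => ?_).trans_eq (Finset.card_range n)
    rw [Finset.mem_range]
    have := (Polynomial.le_degree_of_mem_supp m hm).trans_lt hP
    exact_mod_cast this
  calc _ ≤ P.support.card • B ^ 2 := Finset.sum_le_card_nsmul _ _ _ fun m _ => by
        rw [← sq_abs]; have := h m; gcongr
    _ ≤ n * B ^ 2 := by rw [nsmul_eq_mul]; gcongr
    _ ≤ (n : ℝ) ^ 2 * B ^ 2 := by
        gcongr
        exact_mod_cast Nat.le_self_pow two_ne_zero n
    _ = _ := by ring

theorem polyNorm₂_le {n : ℕ} {P : MvPolynomial (Fin 2) ℝ} (hP : P.totalDegree ≤ n) {B : ℝ}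
    (hB : 0 ≤ B) (h : ∀ m, |P.coeff m| ≤ B) : polyNorm₂ P ≤ (n + 1) * B := by
  rw [polyNorm₂, Real.sqrt_le_left (by positivity)]
  have hc : P.support.card ≤ (n + 1) * (n + 1) := by
    have h1 : P.support.card ≤ (Finset.range (n + 1) ×ˢ Finset.range (n + 1)).card := by
      refine Finset.card_le_card_of_injOn (fun m => (m 0, m 1)) (fun m hm => ?_)
        fun m _ m' _ hmm => ?_
      · have h2 := (MvPolynomial.le_totalDegree hm).trans hP
        rw [Finsupp.sum_fintype _ _ (fun _ => rfl), Fin.sum_univ_two] at h2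
        simp only [Finset.coe_product, Finset.coe_range, mem_prod, mem_Iio]
        omega
      · ext i
        simp only [Prod.mk.injEq] at hmm
        fin_cases i
        · exact hmm.1
        · exact hmm.2
    simpa using h1
  calc _ ≤ P.support.card • B ^ 2 := Finset.sum_le_card_nsmul _ _ _ fun m _ => by
        rw [← sq_abs]; have := h m; gcongr
    _ ≤ ((n + 1) * (n + 1) : ℕ) * B ^ 2 := by rw [nsmul_eq_mul]; gcongr
    _ = _ := by push_cast; ring

/-- The imaginary part of `(1 + i ε)^n`. -/
def edgeIm (ε : ℝ) (n : ℕ) : ℝ := ((1 + ε * Complex.I) ^ n).im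

theorem one_add_mul_I_eq (ε : ℝ) : (1 + ε * Complex.I : ℂ)
    = (√(1 + ε ^ 2) : ℝ) * Complex.exp (Real.arctan ε * Complex.I) := by
  have h : √(1 + ε ^ 2) ≠ 0 := (by positivity : 0 < √(1 + ε ^ 2)).ne'
  rw [Complex.exp_mul_I, ← Complex.ofReal_cos, ← Complex.ofReal_sin, Real.cos_arctan,
    Real.sin_arctan]
  apply Complex.ext <;> simp <;> field_simp

theorem norm_one_add_mul_I (ε : ℝ) : ‖(1 + ε * Complex.I : ℂ)‖ = √(1 + ε ^ 2) := by
  rw [one_add_mul_I_eq, norm_mul, Complex.norm_exp_ofReal_mul_I, mul_one, Complex.norm_real,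
    Real.norm_of_nonneg (Real.sqrt_nonneg _)]

/-- In polar form the value is c^n sin(nα) with ε/2 ≤ nα ≤ π/2, and Jordan's inequality applies.
Thus solving for the coefficients costs at most a factor 4/ε. -/
theorem le_edgeIm {k n : ℕ} {ε : ℝ} (h : IsAdmissible k ε) (hn : 1 ≤ n) (hnk : n ≤ 3 * k) :
    ε / 4 ≤ edgeIm ε n := by
  have hnR : (1 : ℝ) ≤ n := by exact_mod_cast hn
  have hnk' : (n : ℝ) ≤ 3 * k := by exact_mod_cast hnk
  have e : edgeIm ε n = √(1 + ε ^ 2) ^ n * Real.sin (n * Real.arctan ε) := by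
    rw [edgeIm, one_add_mul_I_eq, mul_pow, ← Complex.exp_nat_mul, ← mul_assoc,
      ← Complex.ofReal_natCast, ← Complex.ofReal_mul, ← Complex.ofReal_pow, Complex.im_ofReal_mul,
      Complex.exp_ofReal_mul_I_im]
  have h1 : 1 ≤ √(1 + ε ^ 2) ^ n := by
    refine one_le_pow₀ ?_
    rw [Real.one_le_sqrt]
    nlinarith
  have h2 := Real.mul_le_sin (x := n * Real.arctan ε) (by have := h.arctan_pos; positivity)
    (h.mul_arctan_le (by linarith))
  have h3 : ε / 4 ≤ Real.sin (n * Real.arctan ε) := by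
    refine le_trans ?_ h2
    have h4 : ε / 2 ≤ n * Real.arctan ε := by
      have := h.half_le_arctan
      nlinarith [h.arctan_pos]
    have h5 : 1 / 2 ≤ 2 / Real.pi := by
      rw [div_le_div_iff₀ two_pos Real.pi_pos]
      linarith [Real.pi_lt_four]
    calc ε / 4 = 1 / 2 * (ε / 2) := by ring
      _ ≤ _ := by have := h.pos; gcongr
  rw [e]
  have := h.pos
  nlinarith

theorem edgeIm_pos {k n : ℕ} {ε : ℝ} (h : IsAdmissible k ε) (hn : 1 ≤ n) (hnk : n ≤ 3 * k) :
    0 < edgeIm ε n :=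
  (by have := h.pos; positivity : 0 < ε / 4).trans_le (le_edgeIm h hn hnk)

/-- The coefficients of `Im ∑ (d_m / (m + 1)) (x + i ε y)^(m + 1)`, which equals the primitive of
`P` on the upper edge. -/
def bulkCoeff (ε : ℝ) (P : Polynomial ℝ) (m : ℕ) : ℝ := P.coeff m / edgeIm ε (m + 1)

/-- The coefficients themselves may be as large as 1/ε; only their product with ε is bounded, and in
all later estimates a factor ε has to be found. -/
theorem abs_mul_bulkCoeff_le {k m : ℕ} {ε : ℝ} (h : IsAdmissible k ε) (P : Polynomial ℝ)
    (hm : m < 3 * k) : ε * |bulkCoeff ε P m| ≤ 4 * polyNorm P := by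
  have h1 := le_edgeIm h (Nat.le_add_left 1 m) hm
  have h2 := edgeIm_pos h (Nat.le_add_left 1 m) hm
  have h3 := abs_coeff_le_polyNorm P m
  rw [bulkCoeff, abs_div, abs_of_pos h2, ← mul_div_assoc, div_le_iff₀ h2]
  have hp := polyNorm_nonneg P
  have := h.pos
  calc ε * |P.coeff m| ≤ ε * polyNorm P := by gcongr
    _ = 4 * polyNorm P * (ε / 4) := by ring
    _ ≤ _ := by gcongr

/-- The holomorphic polynomial with imaginary part the bulk polynomial, multiplied by `-i`. -/
def bulkHolo (ε : ℝ) (n : ℕ) (P : Polynomial ℝ) (w : ℂ) : ℂ :=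
  -Complex.I * ∑ m ∈ Finset.range n, ((bulkCoeff ε P m / (m + 1) : ℝ) : ℂ) * w ^ (m + 1)

/-- The derivative of `bulkHolo`. -/
def bulkHoloDeriv (ε : ℝ) (n : ℕ) (P : Polynomial ℝ) (w : ℂ) : ℂ :=
  -Complex.I * ∑ m ∈ Finset.range n, (bulkCoeff ε P m : ℂ) * w ^ m

theorem hasDerivAt_bulkHolo (ε : ℝ) (n : ℕ) (P : Polynomial ℝ) (w : ℂ) :
    HasDerivAt (bulkHolo ε n P) (bulkHoloDeriv ε n P w) w := by
  refine HasDerivAt.const_mul _ (HasDerivAt.fun_sum fun m _ => ?_)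
  refine ((hasDerivAt_pow (m + 1) w).const_mul _).congr_deriv ?_
  have : (m : ℂ) + 1 ≠ 0 := by exact_mod_cast Nat.succ_ne_zero m
  push_cast
  field_simp

/-- The harmonic polynomial as a function. -/
def bulk (ε : ℝ) (n : ℕ) (P : Polynomial ℝ) : ℝ × ℝ → ℝ :=
  reSum ε (bulkHolo ε n P) 0

theorem isEpsHarmonicOn_bulk {ε : ℝ} (hε : ε ≠ 0) (n : ℕ) (P : Polynomial ℝ) :
    IsEpsHarmonicOn ε (bulk ε n P) univ :=
  isEpsHarmonicOn_reSum hε isOpen_univ isOpen_univ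
    (fun w _ => (hasDerivAt_bulkHolo ε n P w).differentiableAt.differentiableWithinAt)
    (differentiableOn_const (0 : ℂ)) (fun _ _ => mem_univ _) (fun _ _ => mem_univ _)

theorem neg_I_mul_sum_re (n : ℕ) (a : ℕ → ℝ) (b : ℕ → ℂ) :
    (-Complex.I * ∑ m ∈ Finset.range n, (a m : ℂ) * b m).re
      = ∑ m ∈ Finset.range n, a m * (b m).im := by
  simp [Complex.im_sum]

theorem neg_I_mul_sum_im (n : ℕ) (a : ℕ → ℝ) (b : ℕ → ℂ) :
    (-Complex.I * ∑ m ∈ Finset.range n, (a m : ℂ) * b m).im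
      = -∑ m ∈ Finset.range n, a m * (b m).re := by
  simp [Complex.re_sum]

theorem bulk_eq (ε : ℝ) (n : ℕ) (P : Polynomial ℝ) (z : ℝ × ℝ) : bulk ε n P z
    = ∑ m ∈ Finset.range n, bulkCoeff ε P m / (m + 1) * (cvar ε z ^ (m + 1)).im := by
  rw [bulk, reSum, bulkHolo, neg_I_mul_sum_re]
  simp

/-- The horizontal derivative of `bulk`. -/
def bulkX (ε : ℝ) (n : ℕ) (P : Polynomial ℝ) (z : ℝ × ℝ) : ℝ :=
  ∑ m ∈ Finset.range n, bulkCoeff ε P m * (cvar ε z ^ m).im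

/-- The vertical derivative of `bulk`. -/
def bulkY (ε : ℝ) (n : ℕ) (P : Polynomial ℝ) (z : ℝ × ℝ) : ℝ :=
  ε * ∑ m ∈ Finset.range n, bulkCoeff ε P m * (cvar ε z ^ m).re

theorem hasDerivAt_bulk_fst (ε : ℝ) (n : ℕ) (P : Polynomial ℝ) (x y : ℝ) :
    HasDerivAt (fun x => bulk ε n P (x, y)) (bulkX ε n P (x, y)) x := by
  refine (hasDerivAt_reSum_fst (B := 0) (hasDerivAt_bulkHolo ε n P _)
    (hasDerivAt_const _ (0 : ℂ))).congr_deriv ?_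
  rw [bulkHoloDeriv, neg_I_mul_sum_re, Complex.zero_re, add_zero, bulkX]

theorem hasDerivAt_bulk_snd (ε : ℝ) (n : ℕ) (P : Polynomial ℝ) (x y : ℝ) :
    HasDerivAt (fun y => bulk ε n P (x, y)) (bulkY ε n P (x, y)) y := by
  refine (hasDerivAt_reSum_snd (B := 0) (hasDerivAt_bulkHolo ε n P _)
    (hasDerivAt_const _ (0 : ℂ))).congr_deriv ?_
  rw [bulkHoloDeriv, neg_I_mul_sum_im, Complex.zero_im, bulkY]
  ring

theorem contDiff_bulk {ε : ℝ} (hε : ε ≠ 0) (n : ℕ) (P : Polynomial ℝ) :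
    ContDiff ℝ ((⊤ : ℕ∞) : WithTop ℕ∞) (bulk ε n P) :=
  contDiffOn_univ.1 (isEpsHarmonicOn_bulk hε n P).1

theorem continuous_bulkX (ε : ℝ) (n : ℕ) (P : Polynomial ℝ) : Continuous (bulkX ε n P) := by
  have := continuous_cvar ε
  unfold bulkX
  fun_prop

theorem continuous_bulkY (ε : ℝ) (n : ℕ) (P : Polynomial ℝ) : Continuous (bulkY ε n P) := by
  have := continuous_cvar ε
  unfold bulkY
  fun_prop

theorem cvar_diag (ε x : ℝ) : cvar ε (x, x) = (x : ℂ) * (1 + ε * Complex.I) := by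
  rw [cvar]; ring

theorem bulk_diag {k : ℕ} {ε : ℝ} (h : IsAdmissible k ε) (P : Polynomial ℝ) (x : ℝ) :
    bulk ε (3 * k) P (x, x) = primitive (3 * k) P x := by
  rw [bulk_eq, primitive]
  refine Finset.sum_congr rfl fun m hm => ?_
  have h1 := (edgeIm_pos h (Nat.le_add_left 1 m) (Finset.mem_range.1 hm)).ne'
  rw [cvar_diag, mul_pow, ← Complex.ofReal_pow, Complex.im_ofReal_mul, bulkCoeff, ← edgeIm]
  field_simp

theorem bulkX_diag (ε : ℝ) (n : ℕ) (P : Polynomial ℝ) (x : ℝ) : bulkX ε n P (x, x)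
    = ∑ m ∈ Finset.range n, bulkCoeff ε P m * edgeIm ε m * x ^ m := by
  refine Finset.sum_congr rfl fun m _ => ?_
  rw [cvar_diag, mul_pow, ← Complex.ofReal_pow, Complex.im_ofReal_mul, ← edgeIm]
  ring

theorem bulkY_diag (ε : ℝ) (n : ℕ) (P : Polynomial ℝ) (x : ℝ) : bulkY ε n P (x, x)
    = ∑ m ∈ Finset.range n, ε * bulkCoeff ε P m * ((1 + ε * Complex.I) ^ m).re * x ^ m := by
  rw [bulkY, Finset.mul_sum]
  refine Finset.sum_congr rfl fun m _ => ?_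
  rw [cvar_diag, mul_pow, ← Complex.ofReal_pow, Complex.re_ofReal_mul]
  ring

theorem bulk_bottom (ε : ℝ) (n : ℕ) (P : Polynomial ℝ) (x : ℝ) : bulk ε n P (x, 0) = 0 := by
  rw [bulk_eq]
  refine Finset.sum_eq_zero fun m _ => ?_
  have : cvar ε (x, 0) = (x : ℂ) := by simp [cvar]
  rw [this, ← Complex.ofReal_pow, Complex.ofReal_im, mul_zero]

/-- The imaginary part of `(x + i ε y)^n` as a polynomial. -/
def imPow (ε : ℝ) (n : ℕ) : MvPolynomial (Fin 2) ℝ :=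
  ∑ j ∈ Finset.range (n + 1), MvPolynomial.monomial
    (Finsupp.single 0 (n - j) + Finsupp.single 1 j) (n.choose j * ((ε * Complex.I) ^ j).im)

theorem eval_imPow (ε : ℝ) (n : ℕ) (z : ℝ × ℝ) :
    MvPolynomial.eval ![z.1, z.2] (imPow ε n) = (cvar ε z ^ n).im := by
  rw [imPow, map_sum, cvar, add_comm (z.1 : ℂ), add_pow, Complex.im_sum]
  refine Finset.sum_congr rfl fun j _ => ?_
  have e : (ε * z.2 * Complex.I : ℂ) ^ j * (z.1 : ℂ) ^ (n - j) * (n.choose j : ℂ)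
      = ((z.2 ^ j * z.1 ^ (n - j) * n.choose j : ℝ) : ℂ) * (ε * Complex.I) ^ j := by
    push_cast
    rw [mul_right_comm (ε : ℂ), mul_pow _ (z.2 : ℂ)]
    ring
  rw [e, Complex.im_ofReal_mul, MvPolynomial.eval_monomial,
    Finsupp.prod_add_index' (by simp) (by intros; rw [pow_add]), Finsupp.prod_single_index (by simp),
    Finsupp.prod_single_index (by simp)]
  simp
  ring

theorem totalDegree_imPow_le (ε : ℝ) (n : ℕ) : (imPow ε n).totalDegree ≤ n := by
  refine MvPolynomial.totalDegree_finsetSum_le fun j hj => ?_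
  refine (MvPolynomial.totalDegree_monomial_le _ _).trans ?_
  rw [Finsupp.sum_add_index' (by simp) (by simp), Finsupp.sum_single_index rfl,
    Finsupp.sum_single_index rfl]
  have := Finset.mem_range.1 hj
  simp only [id]
  omega

/-- The term j = 0 of the binomial expansion is real and drops out of the imaginary part. Every
other term carries at least one ε, which compensates the 1/ε in `bulkCoeff`. -/
theorem abs_coeff_imPow_le {ε : ℝ} (h0 : 0 ≤ ε) (h1 : ε ≤ 1) (n : ℕ) (d : Fin 2 →₀ ℕ) :
    |(imPow ε n).coeff d| ≤ 2 ^ n * ε := by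
  rw [imPow, MvPolynomial.coeff_sum]
  refine (Finset.abs_sum_le_sum_abs _ _).trans ?_
  have h2 : (2 : ℝ) ^ n = ∑ j ∈ Finset.range (n + 1), (n.choose j : ℝ) := by
    rw [← Nat.cast_sum, Nat.sum_range_choose]
    norm_num
  rw [h2, Finset.sum_mul]
  refine Finset.sum_le_sum fun j _ => ?_
  rw [MvPolynomial.coeff_monomial]
  split_ifs
  · rw [abs_mul, Nat.abs_cast]
    refine mul_le_mul_of_nonneg_left ?_ (Nat.cast_nonneg _)
    rcases Nat.eq_zero_or_pos j with rfl | hj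
    · simpa using h0
    · refine (Complex.abs_im_le_norm _).trans ?_
      rw [norm_pow, norm_mul, Complex.norm_I, mul_one, Complex.norm_real, Real.norm_of_nonneg h0]
      exact pow_le_of_le_one h0 h1 (by omega)
  · rw [abs_zero]
    positivity

/-- The harmonic polynomial. -/
def bulkPoly (ε : ℝ) (n : ℕ) (P : Polynomial ℝ) : MvPolynomial (Fin 2) ℝ :=
  ∑ m ∈ Finset.range n, (bulkCoeff ε P m / (m + 1)) • imPow ε (m + 1)

theorem eval_bulkPoly (ε : ℝ) (n : ℕ) (P : Polynomial ℝ) (z : ℝ × ℝ) :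
    MvPolynomial.eval ![z.1, z.2] (bulkPoly ε n P) = bulk ε n P z := by
  rw [bulkPoly, map_sum, bulk_eq]
  refine Finset.sum_congr rfl fun m _ => ?_
  rw [MvPolynomial.smul_eval, eval_imPow]

theorem totalDegree_bulkPoly_le (ε : ℝ) (n : ℕ) (P : Polynomial ℝ) :
    (bulkPoly ε n P).totalDegree ≤ n := by
  refine MvPolynomial.totalDegree_finsetSum_le fun m hm => ?_
  exact (MvPolynomial.totalDegree_smul_le _ _).trans
    ((totalDegree_imPow_le ε (m + 1)).trans (Finset.mem_range.1 hm))

theorem polyNorm₂_bulkPoly_le {k : ℕ} {ε : ℝ} (h : IsAdmissible k ε) (P : Polynomial ℝ) :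
    polyNorm₂ (bulkPoly ε (3 * k) P) ≤ (3 * k + 1) * (3 * k * (8 ^ k * (4 * polyNorm P))) := by
  have hp := polyNorm_nonneg P
  have := polyNorm₂_le (totalDegree_bulkPoly_le ε (3 * k) P)
    (B := 3 * k * (8 ^ k * (4 * polyNorm P))) (by positivity) fun d => ?_
  · refine this.trans (le_of_eq ?_)
    push_cast
    ring
  · rw [bulkPoly, MvPolynomial.coeff_sum]
    refine (Finset.abs_sum_le_sum_abs _ _).trans ((Finset.sum_le_card_nsmul _ _
      (8 ^ k * (4 * polyNorm P)) fun m hm => ?_).trans (le_of_eq ?_))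
    · have hm' := Finset.mem_range.1 hm
      have h1 := abs_coeff_imPow_le h.pos.le (by linarith [h.lt_half]) (m + 1) d
      have h2 := abs_mul_bulkCoeff_le h P hm'
      have h3 : |bulkCoeff ε P m / (m + 1)| ≤ |bulkCoeff ε P m| := by
        rw [abs_div, abs_of_pos (by positivity : (0 : ℝ) < m + 1)]
        exact div_le_self (abs_nonneg _) (by linarith [(Nat.cast_nonneg m : (0 : ℝ) ≤ m)])
      have h4 : (2 : ℝ) ^ (m + 1) ≤ 8 ^ k := by
        calc (2 : ℝ) ^ (m + 1) ≤ 2 ^ (3 * k) := pow_le_pow_right₀ one_le_two hm'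
          _ = 8 ^ k := by rw [pow_mul]; norm_num
      rw [MvPolynomial.coeff_smul, smul_eq_mul, abs_mul]
      have := h.pos
      calc _ ≤ |bulkCoeff ε P m| * (2 ^ (m + 1) * ε) := by gcongr
        _ = 2 ^ (m + 1) * (ε * |bulkCoeff ε P m|) := by ring
        _ ≤ _ := by gcongr
    · rw [Finset.card_range, nsmul_eq_mul]
      push_cast
      ring

/-! ### The harmonic polynomial with its cut-off. -/

theorem radius_eq_norm (ε : ℝ) (z : ℝ × ℝ) : radius ε z = ‖cvar ε z‖ := by
  rw [radius, Complex.norm_def, Complex.normSq_apply, cvar_re, cvar_im]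
  ring_nf

theorem radius_diag (ε : ℝ) {x : ℝ} (hx : 0 ≤ x) : radius ε (x, x) = √(1 + ε ^ 2) * x := by
  rw [radius_eq_norm, cvar_diag, norm_mul, norm_one_add_mul_I, Complex.norm_real,
    Real.norm_of_nonneg hx, mul_comm]

theorem continuous_radius (ε : ℝ) : Continuous (radius ε) := by unfold radius; fun_prop

theorem radius_pos (ε : ℝ) {z : ℝ × ℝ} (hz : 0 < z.1) : 0 < radius ε z :=
  Real.sqrt_pos.2 (by positivity)

theorem contDiffOn_radius (ε : ℝ) {n : WithTop ℕ∞} : ContDiffOn ℝ n (radius ε) wedge := by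
  intro z hz
  have hz1 : 0 < z.1 := hz.1
  refine ContDiffAt.contDiffWithinAt (ContDiffAt.sqrt ?_ (by positivity))
  fun_prop

theorem hasDerivAt_radius_fst (ε : ℝ) {x : ℝ} (hx : 0 < x) (y : ℝ) :
    HasDerivAt (fun x => radius ε (x, y)) (x / radius ε (x, y)) x := by
  have h1 : HasDerivAt (fun x : ℝ => x ^ 2 + ε ^ 2 * y ^ 2) (2 * x) x := by
    simpa using (hasDerivAt_pow 2 x).add_const (ε ^ 2 * y ^ 2)
  refine (h1.sqrt (by positivity)).congr_deriv ?_
  rw [radius]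
  exact mul_div_mul_left _ _ two_ne_zero

theorem hasDerivAt_radius_snd (ε : ℝ) {x : ℝ} (hx : 0 < x) (y : ℝ) :
    HasDerivAt (fun y => radius ε (x, y)) (ε ^ 2 * y / radius ε (x, y)) y := by
  have h1 : HasDerivAt (fun y : ℝ => x ^ 2 + ε ^ 2 * y ^ 2) (2 * (ε ^ 2 * y)) y := by
    have := ((hasDerivAt_pow 2 y).const_mul (ε ^ 2)).const_add (x ^ 2)
    refine this.congr_deriv ?_
    simp; ring
  refine (h1.sqrt (by positivity)).congr_deriv ?_
  rw [radius]
  exact mul_div_mul_left _ _ two_ne_zero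

/-- The bulk polynomial with cut-off. -/
def cutBulk (ζ : ℝ → ℝ) (ε : ℝ) (n : ℕ) (P : Polynomial ℝ) (z : ℝ × ℝ) : ℝ :=
  ζ (radius ε z) * bulk ε n P z

/-- The horizontal derivative of `cutBulk`. -/
def cutBulkX (ζ : ℝ → ℝ) (ε : ℝ) (n : ℕ) (P : Polynomial ℝ) (z : ℝ × ℝ) : ℝ :=
  deriv ζ (radius ε z) * (z.1 / radius ε z) * bulk ε n P z + ζ (radius ε z) * bulkX ε n P z

/-- The vertical derivative of `cutBulk`. -/
def cutBulkY (ζ : ℝ → ℝ) (ε : ℝ) (n : ℕ) (P : Polynomial ℝ) (z : ℝ × ℝ) : ℝ :=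
  deriv ζ (radius ε z) * (ε ^ 2 * z.2 / radius ε z) * bulk ε n P z
    + ζ (radius ε z) * bulkY ε n P z

section Cutoff

variable {ζ : ℝ → ℝ}

theorem hasDerivAt_cutBulk_fst (hζ : IsCutoff ζ) (ε : ℝ) (n : ℕ) (P : Polynomial ℝ) {x : ℝ}
    (hx : 0 < x) (y : ℝ) :
    HasDerivAt (fun x => cutBulk ζ ε n P (x, y)) (cutBulkX ζ ε n P (x, y)) x :=
  (((hζ.smooth.differentiable (by simp) _).hasDerivAt.comp x
    (hasDerivAt_radius_fst ε hx y))).mul (hasDerivAt_bulk_fst ε n P x y)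

theorem hasDerivAt_cutBulk_snd (hζ : IsCutoff ζ) (ε : ℝ) (n : ℕ) (P : Polynomial ℝ) {x : ℝ}
    (hx : 0 < x) (y : ℝ) :
    HasDerivAt (fun y => cutBulk ζ ε n P (x, y)) (cutBulkY ζ ε n P (x, y)) y :=
  (((hζ.smooth.differentiable (by simp) _).hasDerivAt.comp y
    (hasDerivAt_radius_snd ε hx y))).mul (hasDerivAt_bulk_snd ε n P x y)

theorem contDiffOn_cutBulk (hζ : IsCutoff ζ) {ε : ℝ} (hε : ε ≠ 0) (n : ℕ) (P : Polynomial ℝ) :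
    ContDiffOn ℝ ((⊤ : ℕ∞) : WithTop ℕ∞) (cutBulk ζ ε n P) wedge :=
  (hζ.smooth.comp_contDiffOn (contDiffOn_radius ε)).mul (contDiff_bulk hε n P).contDiffOn

theorem continuous_cutBulk (hζ : IsCutoff ζ) {ε : ℝ} (hε : ε ≠ 0) (n : ℕ) (P : Polynomial ℝ) :
    Continuous (cutBulk ζ ε n P) :=
  (hζ.smooth.continuous.comp (continuous_radius ε)).mul (contDiff_bulk hε n P).continuous

theorem continuousAt_cutBulkX (hζ : IsCutoff ζ) {ε : ℝ} (hε : ε ≠ 0) (n : ℕ) (P : Polynomial ℝ) {z : ℝ × ℝ}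
    (hz : 0 < z.1) : ContinuousAt (cutBulkX ζ ε n P) z := by
  have h1 := (hζ.contDiff_deriv.continuous.comp (continuous_radius ε)).continuousAt (x := z)
  have h2 := (hζ.smooth.continuous.comp (continuous_radius ε)).continuousAt (x := z)
  have h3 : ContinuousAt (fun z : ℝ × ℝ => z.1 / radius ε z) z :=
    continuousAt_fst.div (continuous_radius ε).continuousAt (radius_pos ε hz).ne'
  exact ((h1.mul h3).mul (contDiff_bulk hε n P).continuous.continuousAt).add
    (h2.mul (continuous_bulkX ε n P).continuousAt)

theorem continuousAt_cutBulkY (hζ : IsCutoff ζ) {ε : ℝ} (hε : ε ≠ 0) (n : ℕ) (P : Polynomial ℝ) {z : ℝ × ℝ}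
    (hz : 0 < z.1) : ContinuousAt (cutBulkY ζ ε n P) z := by
  have h1 := (hζ.contDiff_deriv.continuous.comp (continuous_radius ε)).continuousAt (x := z)
  have h2 := (hζ.smooth.continuous.comp (continuous_radius ε)).continuousAt (x := z)
  have h3 : ContinuousAt (fun z : ℝ × ℝ => ε ^ 2 * z.2 / radius ε z) z :=
    (continuousAt_const.mul continuousAt_snd).div (continuous_radius ε).continuousAt
      (radius_pos ε hz).ne'
  exact ((h1.mul h3).mul (contDiff_bulk hε n P).continuous.continuousAt).add
    (h2.mul (continuous_bulkY ε n P).continuousAt)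

/-- The y-derivative of r is ε · (εy/r), with εy/r at most 1. The remaining ε goes to the
polynomial, whose coefficients are bounded only after this multiplication. -/
theorem exists_abs_cutBulkY_le (hζ : IsCutoff ζ) (k : ℕ) : ∃ C : ℝ, 0 ≤ C ∧ ∀ ε, IsAdmissible k ε →
    ∀ (P : Polynomial ℝ), ∀ z ∈ wedge, |cutBulkY ζ ε (3 * k) P z| ≤ C * polyNorm P := by
  obtain ⟨Z, hZ⟩ := (isCompact_Icc (a := (0 : ℝ)) (b := 1 / 4)).exists_bound_of_continuousOn
    hζ.contDiff_deriv.continuous.continuousOn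
  have hZ0 : 0 ≤ Z := (norm_nonneg _).trans (hZ 0 ⟨le_rfl, by norm_num⟩)
  refine ⟨(Z + 1) * (3 * k * 4), by positivity, fun ε h P z hz => ?_⟩
  have hr := radius_pos ε hz.1
  have hp := polyNorm_nonneg P
  have hε := h.pos
  rcases lt_or_ge (1 / 4) (radius ε z) with hr4 | hr4
  · rw [cutBulkY, hζ.deriv_eq_zero_of_gt hr4, hζ.eq_zero _ hr4.le]
    simp only [zero_mul, add_zero, abs_zero]
    positivity
  have hw : ∀ m, ‖cvar ε z ^ m‖ ≤ 1 := fun m => by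
    rw [norm_pow, ← radius_eq_norm]
    exact pow_le_one₀ hr.le (by linarith)
  have hsum : ∀ b : ℕ → ℝ, (∀ m < 3 * k, ε * |b m| ≤ 4 * polyNorm P) →
      |ε * ∑ m ∈ Finset.range (3 * k), b m| ≤ 3 * k * 4 * polyNorm P := fun b hb => by
    rw [Finset.mul_sum]
    refine (Finset.abs_sum_le_sum_abs _ _).trans ((Finset.sum_le_card_nsmul _ _
      (4 * polyNorm P) fun m hm => ?_).trans (le_of_eq ?_))
    · rw [abs_mul, abs_of_pos hε]
      exact hb m (Finset.mem_range.1 hm)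
    · rw [Finset.card_range, nsmul_eq_mul]
      push_cast
      ring
  have h1 : |ε * bulk ε (3 * k) P z| ≤ 3 * k * 4 * polyNorm P := by
    rw [bulk_eq]
    refine hsum _ fun m hm => le_trans ?_ (abs_mul_bulkCoeff_le h P hm)
    refine mul_le_mul_of_nonneg_left ?_ hε.le
    rw [abs_mul, abs_div, abs_of_pos (by positivity : (0 : ℝ) < m + 1)]
    refine (mul_le_of_le_one_right (by positivity)
      ((Complex.abs_im_le_norm _).trans (hw _))).trans ?_
    exact div_le_self (abs_nonneg _) (by linarith [(Nat.cast_nonneg m : (0 : ℝ) ≤ m)])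
  have h2 : |bulkY ε (3 * k) P z| ≤ 3 * k * 4 * polyNorm P := by
    rw [bulkY]
    refine hsum _ fun m hm => le_trans ?_ (abs_mul_bulkCoeff_le h P hm)
    refine mul_le_mul_of_nonneg_left ?_ hε.le
    rw [abs_mul]
    exact mul_le_of_le_one_right (abs_nonneg _) ((Complex.abs_re_le_norm _).trans (hw _))
  have h3 : |ε * z.2 / radius ε z| ≤ 1 := by
    rw [abs_div, abs_of_pos hr, div_le_one hr, radius_eq_norm]
    simpa using Complex.abs_im_le_norm (cvar ε z)
  have h4 : |deriv ζ (radius ε z)| ≤ Z := hZ _ ⟨hr.le, hr4⟩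
  have h5 := hζ.mem_Icc _ hr.le
  have e : deriv ζ (radius ε z) * (ε ^ 2 * z.2 / radius ε z) * bulk ε (3 * k) P z
      = deriv ζ (radius ε z) * (ε * z.2 / radius ε z) * (ε * bulk ε (3 * k) P z) := by ring
  rw [cutBulkY, e]
  refine (abs_add_le _ _).trans ?_
  rw [abs_mul (_ * _) (ε * _), abs_mul (deriv ζ _), abs_mul (ζ _), abs_of_nonneg h5.1]
  calc _ ≤ Z * 1 * (3 * k * 4 * polyNorm P) + 1 * (3 * k * 4 * polyNorm P) := by
        gcongr
        exact h5.2
    _ = _ := by ring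

end Cutoff

/-! ### Norms of functions on the upper edge. -/

theorem xNorm_le_xNormOf (ε : ℝ) (ζ : ℝ → ℝ) {k : ℕ} (f : ℝ → ℝ) {P : Polynomial ℝ}
    (hP : P.degree < (3 * k : ℕ)) : xNorm ε ζ k f ≤ xNormOf ε ζ k f P :=
  iInf₂_le P hP

/-- The norm of the trace on the upper edge of a derivative. -/
theorem exists_xNorm_trace_le {k : ℕ} (hk : 1 ≤ k) {ζ : ℝ → ℝ} (hζ : IsCutoff ζ) :
    ∃ C : ℝ, 0 < C ∧ ∀ (ε : ℝ) (f : ℝ → ℝ) (G : ℝ → ℝ → ℂ), IsEdgeData k ε f G →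
      ∀ (g : ℝ → ℝ), (∀ β ∈ Icc (1 / 2 : ℝ) (3 * k + 1 / 2), ∃ T : ℝ → ℂ,
        IsLaplaceOnLine (β - 1) (fun s => g (Real.exp s)) T ∧
          ∀ ξ, ‖T ξ‖ ≤ 20 * 8 ^ k * ‖G β ξ‖) →
      ∀ (κ : ℕ → ℝ) (R : Polynomial ℝ) (M : ℝ), R.degree < (3 * k : ℕ) →
        (∀ m < 3 * k, |κ m| ≤ M) → (∀ m, |R.coeff m| ≤ M) →
        xNorm ε ζ k (fun x => g x + (∑ m ∈ Finset.range (3 * k),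
            κ m * (deriv ζ (Real.exp (logC ε) * x) * x ^ (m + 1))
          + ζ (Real.exp (logC ε) * x) * R.eval x))
          ≤ ENNReal.ofReal C * (dataNorm k ε G + ENNReal.ofReal M) := by
  obtain ⟨C₁, hC₁, hint⟩ := exists_wnorm_interpolation hk
  obtain ⟨C₂, hC₂, herr⟩ := exists_hasLaplaceDecay_cutoffError hζ (3 * k) (3 * k) (4 * k + 2)
  have hinv : 0 ≤ invFreqNorm := ENNReal.toReal_nonneg
  set A : ℝ := 20 * 8 ^ k * C₁ with hA
  set A' : ℝ := C₂ * invFreqNorm with hA'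
  have hA0 : 0 < A := by positivity
  have hA0' : 0 ≤ A' := by positivity
  set K : ℝ := (3 * k + 8) ^ (4 * k + 1) with hK
  have hK0 : 0 < K := by positivity
  refine ⟨3 * k + (1 + (k + 1) * K) * (A + A'), by positivity,
    fun ε f G h g hg κ R M hR hκ hRM => ?_⟩
  have hM : 0 ≤ M := (abs_nonneg _).trans (hRM 0)
  have hε := h.adm.pos
  have hkR : (1 : ℝ) ≤ k := by exact_mod_cast hk
  set c := Real.exp (logC ε)
  refine (xNorm_le_xNormOf ε ζ _ hR).trans ?_
  -- With R as competitor for the Taylor polynomial, replacing ζ(cx)R by ζ(x)R leaves just such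
  -- cut-off errors in the remainder.
  set q : ℝ → ℝ := fun x => g x + cutoffError ζ (3 * k) c κ R.coeff x with hq
  have e : (fun x => (g x + (∑ m ∈ Finset.range (3 * k),
      κ m * (deriv ζ (c * x) * x ^ (m + 1)) + ζ (c * x) * R.eval x)) - ζ x * R.eval x) = q := by
    ext x
    rw [hq]
    simp only [cutoffError, Finset.sum_add_distrib]
    rw [eval_eq_sum_range (by omega) hR, Finset.mul_sum, Finset.mul_sum, add_sub_assoc,
      add_sub_assoc, ← Finset.sum_sub_distrib]
    congr 2
    refine Finset.sum_congr rfl fun m _ => ?_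
    ring
  rw [xNormOf, e]
  set D : ℝ≥0∞ := dataNorm k ε G + ENNReal.ofReal M with hD
  have key : ∀ n : ℕ, n ≤ k → ∃ T, IsLaplaceOnLine (3 * n - 1 / 2) (fun s => q (Real.exp s)) T ∧
      wnorm (wt ε n) T ≤ ENNReal.ofReal (A + A') * D := fun n hn => by
    have hnR : (n : ℝ) ≤ k := by exact_mod_cast hn
    have hn0 : (0 : ℝ) ≤ n := Nat.cast_nonneg n
    obtain ⟨T, hT, hTG⟩ := hg (3 * n + 1 / 2) ⟨by linarith, by linarith⟩
    rw [show (3 * n + 1 / 2 - 1 : ℝ) = 3 * n - 1 / 2 by ring] at hT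
    obtain ⟨T', hT', hTb⟩ := herr (logC ε) (logC_mem_Icc h.adm) (3 * n - 1 / 2)
      (by rw [abs_le]; constructor <;> linarith) κ R.coeff M hκ (fun m _ => hRM m)
    refine ⟨T + T', hT.add hT', ?_⟩
    refine (wnorm_add_le (continuous_wt hε n) (fun ξ => (wt_pos hε n ξ).le)
      (isLaplaceOnLine_iff.1 hT).memLp_transform.1
      (isLaplaceOnLine_iff.1 hT').memLp_transform.1).trans ?_
    rw [ENNReal.ofReal_add hA0.le hA0', add_mul]
    refine add_le_add ?_ ?_
    · refine (wnorm_le_of_le (fun ξ => (wt_pos hε n ξ).le) hTG).trans ?_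
      rw [hA, ENNReal.ofReal_mul (p := 20 * 8 ^ k) (by positivity), mul_assoc]
      gcongr
      refine (hint ε hε f G h.laplace n ⟨hn0, hnR⟩).trans ?_
      gcongr
      exact le_self_add
    · refine (wnorm_le_of_decay hε hn hTb).trans ?_
      rw [show C₂ * M * invFreqNorm = A' * M by rw [hA']; ring, ENNReal.ofReal_mul hA0']
      gcongr
      exact le_add_self
  have h1 : ENNReal.ofReal (polyNorm R) ≤ ENNReal.ofReal (3 * k) * D := by
    refine (ENNReal.ofReal_le_ofReal (polyNorm_le hR hM hRM)).trans ?_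
    push_cast
    rw [ENNReal.ofReal_mul (by positivity)]
    gcongr
    exact le_add_self
  have h2 : eLpNorm q 2 (volume.restrict (Ioi 0)) ≤ ENNReal.ofReal (A + A') * D := by
    obtain ⟨T, hT, hb⟩ := key 0 (Nat.zero_le k)
    rw [show (3 * ((0 : ℕ) : ℝ) - 1 / 2) = -1 / 2 by norm_num] at hT
    rw [hT.eLpNorm_Ioi]
    exact (eLpNorm_le_wnorm hε (by linarith [h.adm.lt_half]) (Nat.cast_nonneg 0) T).trans hb
  have h3 : ∑ ℓ ∈ Finset.range (k + 1), xHom ε ℓ q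
      ≤ ENNReal.ofReal ((k + 1) * K * (A + A')) * D := by
    refine (Finset.sum_le_card_nsmul _ _ (ENNReal.ofReal (K * (A + A')) * D) fun n hn => ?_).trans
      (le_of_eq ?_)
    · have hn' : n ≤ k := by have := Finset.mem_range.1 hn; omega
      obtain ⟨T, hT, hb⟩ := key n hn'
      refine (xHom_le hε hn' hT).trans ?_
      rw [ENNReal.ofReal_mul hK0.le, mul_assoc]
      gcongr
    · rw [Finset.card_range, nsmul_eq_mul, ← ENNReal.ofReal_natCast, ← mul_assoc,
        ← ENNReal.ofReal_mul (by positivity)]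
      push_cast
      rw [mul_assoc ((k : ℝ) + 1)]
  calc _ ≤ ENNReal.ofReal (3 * k) * D + ENNReal.ofReal (A + A') * D
        + ENNReal.ofReal ((k + 1) * K * (A + A')) * D := add_le_add (add_le_add h1 h2) h3
    _ = _ := by
      rw [← add_mul, ← add_mul, ← ENNReal.ofReal_add (by positivity) (by positivity),
        ← ENNReal.ofReal_add (by positivity) (by positivity)]
      congr 2
      ring

/-! ### Vertical shears of the wedge. -/

theorem tendsto_vertical_bottom {x : ℝ} (hx : 0 < x) :
    Tendsto (fun y => (x, y)) (𝓝[Ioo 0 x] 0) (𝓝[wedge] (x, 0)) := by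
  refine tendsto_nhdsWithin_iff.2 ⟨?_, ?_⟩
  · exact ((Continuous.prodMk_right x).tendsto 0).mono_left nhdsWithin_le_nhds
  · filter_upwards [self_mem_nhdsWithin] with y hy
    exact ⟨hx, hy.1, hy.2⟩

theorem tendsto_vertical_top {x : ℝ} (hx : 0 < x) :
    Tendsto (fun y => (x, y)) (𝓝[Ioo 0 x] x) (𝓝[wedge] (x, x)) := by
  refine tendsto_nhdsWithin_iff.2 ⟨?_, ?_⟩
  · exact ((Continuous.prodMk_right x).tendsto x).mono_left nhdsWithin_le_nhds
  · filter_upwards [self_mem_nhdsWithin] with y hy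
    exact ⟨hx, hy.1, hy.2⟩

theorem bijOn_of_strictMonoOn {F : ℝ → ℝ} {x v₀ v₁ : ℝ} (hx : 0 < x)
    (hc : ContinuousOn F (Ioo 0 x)) (hF : StrictMonoOn F (Ioo 0 x))
    (h0 : Tendsto F (𝓝[Ioo 0 x] 0) (𝓝 v₀)) (h1 : Tendsto F (𝓝[Ioo 0 x] x) (𝓝 v₁)) :
    BijOn F (Ioo 0 x) (Ioo v₀ v₁) := by
  have : (𝓝[Ioo 0 x] (0 : ℝ)).NeBot := left_nhdsWithin_Ioo_neBot hx
  have : (𝓝[Ioo 0 x] x).NeBot := right_nhdsWithin_Ioo_neBot hx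
  refine ⟨fun y hy => ⟨?_, ?_⟩, hF.injOn, ?_⟩
  · have hm : y / 2 ∈ Ioo 0 x := ⟨by linarith [hy.1], by linarith [hy.1, hy.2]⟩
    refine lt_of_le_of_lt (le_of_tendsto h0 ?_) (hF hm hy (by linarith [hy.1]))
    filter_upwards [self_mem_nhdsWithin,
      mem_nhdsWithin_of_mem_nhds (Iio_mem_nhds (show (0 : ℝ) < y / 2 by linarith [hy.1]))]
      with t ht ht'
    exact (hF ht hm ht').le
  · have hm : (y + x) / 2 ∈ Ioo 0 x := ⟨by linarith [hy.1], by linarith [hy.2]⟩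
    refine lt_of_lt_of_le (hF hy hm (by linarith [hy.2])) (ge_of_tendsto h1 ?_)
    filter_upwards [self_mem_nhdsWithin,
      mem_nhdsWithin_of_mem_nhds (Ioi_mem_nhds (show (y + x) / 2 < x by linarith [hy.2]))]
      with t ht ht'
    exact (hF hm ht ht').le
  · exact isPreconnected_Ioo.intermediate_value_Ioo
      (le_principal_iff.2 self_mem_nhdsWithin) (le_principal_iff.2 self_mem_nhdsWithin) hc h0 h1

/-- A vertical shear with small vertical derivative is a diffeomorphism of the wedge. -/
theorem isDiffeoOn_shear {ψ ψY : ℝ × ℝ → ℝ} {g : ℝ → ℝ}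
    (hψ : ContDiffOn ℝ ((⊤ : ℕ∞) : WithTop ℕ∞) ψ wedge)
    (hd : ∀ z ∈ wedge, HasDerivAt (fun y => ψ (z.1, y)) (ψY z) z.2)
    (hb : ∀ z ∈ wedge, |ψY z| ≤ 1 / 2)
    (h0 : IsLowerTrace ψ fun _ => 0) (h1 : IsUpperTrace ψ g) :
    IsDiffeoOn (fun z => (z.1, z.2 + ψ z)) wedge {z | 0 < z.1 ∧ 0 < z.2 ∧ z.2 < z.1 + g z.1} := by
  set Ψ : ℝ × ℝ → ℝ × ℝ := fun z => (z.1, z.2 + ψ z) with hΨ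
  set V : Set (ℝ × ℝ) := {z | 0 < z.1 ∧ 0 < z.2 ∧ z.2 < z.1 + g z.1} with hV
  -- The shear preserves vertical lines. On each of them the derivative 1 + ψ_y is at least 1/2, so
  -- bijectivity is a one-dimensional matter with the traces as end points.
  have hfib : ∀ x, 0 < x → BijOn (fun y => y + ψ (x, y)) (Ioo 0 x) (Ioo 0 (x + g x)) :=
      fun x hx => by
    have hder : ∀ y ∈ Ioo 0 x, HasDerivAt (fun y => y + ψ (x, y)) (1 + ψY (x, y)) y :=
      fun y hy => (hasDerivAt_id y).add (hd (x, y) ⟨hx, hy.1, hy.2⟩)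
    have hcont : ContinuousOn (fun y => y + ψ (x, y)) (Ioo 0 x) := fun y hy =>
      (hder y hy).continuousAt.continuousWithinAt
    refine bijOn_of_strictMonoOn hx hcont ?_ ?_ ?_
    · refine strictMonoOn_of_deriv_pos (convex_Ioo 0 x) hcont fun y hy => ?_
      rw [interior_Ioo] at hy
      rw [(hder y hy).deriv]
      linarith [(abs_le.1 (hb (x, y) ⟨hx, hy.1, hy.2⟩)).1]
    · have := (tendsto_id.mono_left (nhdsWithin_le_nhds (a := (0 : ℝ)) (s := Ioo 0 x))).add
        ((h0 x hx).comp (tendsto_vertical_bottom hx))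
      rwa [add_zero] at this
    · exact (tendsto_id.mono_left (nhdsWithin_le_nhds (a := x) (s := Ioo 0 x))).add
        ((h1 x hx).comp (tendsto_vertical_top hx))
  have hbij : BijOn Ψ wedge V := by
    refine ⟨fun z hz => ?_, fun z hz z' hz' h => ?_, fun w hw => ?_⟩
    · have := (hfib z.1 hz.1).mapsTo hz.2
      exact ⟨hz.1, this.1, this.2⟩
    · obtain ⟨x, y⟩ := z
      obtain ⟨x', y'⟩ := z'
      obtain ⟨e1, e2⟩ := Prod.mk.inj h
      obtain rfl : x = x' := e1
      have e3 : y = y' := (hfib x hz.1).injOn hz.2 hz'.2 e2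
      rw [e3]
    · obtain ⟨x, t⟩ := w
      obtain ⟨y, hy, rfl⟩ := (hfib x hw.1).surjOn hw.2
      exact ⟨(x, y), ⟨hw.1, hy.1, hy.2⟩, rfl⟩
  have hs : ContDiffOn ℝ ((⊤ : ℕ∞) : WithTop ℕ∞) Ψ wedge :=
    contDiffOn_fst.prodMk (contDiffOn_snd.add hψ)
  -- The differential is triangular with diagonal entries 1 and 1 + ψ_y, hence invertible.
  have hequiv : ∀ z ∈ wedge, ∃ L : (ℝ × ℝ) ≃L[ℝ] (ℝ × ℝ),
      HasFDerivAt Ψ (L : (ℝ × ℝ) →L[ℝ] (ℝ × ℝ)) z := fun z hz => by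
    have hf := ((hψ.contDiffAt (isOpen_wedge.mem_nhds hz)).differentiableAt
      (by simp)).hasFDerivAt
    have hy : fderiv ℝ ψ z (0, 1) = ψY z := by
      have h2 : HasDerivAt (fun y : ℝ => (z.1, y)) (0, 1) z.2 :=
        (hasDerivAt_const z.2 z.1).prodMk (hasDerivAt_id z.2)
      have h3 : HasDerivAt (fun y => ψ (z.1, y)) (fderiv ℝ ψ z (0, 1)) z.2 :=
        HasFDerivAt.comp_hasDerivAt z.2 (f := fun y : ℝ => (z.1, y)) hf h2
      exact h3.unique (hd z hz)
    set L₀ : (ℝ × ℝ) →L[ℝ] (ℝ × ℝ) := (ContinuousLinearMap.fst ℝ ℝ ℝ).prod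
      (ContinuousLinearMap.snd ℝ ℝ ℝ + fderiv ℝ ψ z) with hL₀
    have hL : HasFDerivAt Ψ L₀ z := hasFDerivAt_fst.prodMk (hasFDerivAt_snd.add hf)
    have hinj : Function.Injective (L₀ : (ℝ × ℝ) →ₗ[ℝ] (ℝ × ℝ)) := by
      refine (injective_iff_map_eq_zero _).2 ?_
      rintro ⟨a, b⟩ hab
      obtain ⟨e1, e2⟩ := Prod.mk.inj (show (a, b + fderiv ℝ ψ z (a, b)) = ((0 : ℝ), (0 : ℝ)) from hab)
      obtain rfl : a = 0 := e1
      have e3 : ((0 : ℝ), b) = b • ((0 : ℝ), (1 : ℝ)) := by simp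
      rw [e3, map_smul, hy, smul_eq_mul] at e2
      have e4 : b * (1 + ψY z) = 0 := by linarith
      rcases mul_eq_zero.1 e4 with h | h
      · rw [h]; rfl
      · linarith [(abs_le.1 (hb z hz)).1]
    refine ⟨(LinearEquiv.ofInjectiveEndo _ hinj).toContinuousLinearEquiv, ?_⟩
    convert! hL
  have hstrict : ∀ z (hz : z ∈ wedge), ∃ L : (ℝ × ℝ) ≃L[ℝ] (ℝ × ℝ),
      HasFDerivAt Ψ (L : (ℝ × ℝ) →L[ℝ] (ℝ × ℝ)) z ∧
      HasStrictFDerivAt Ψ (L : (ℝ × ℝ) →L[ℝ] (ℝ × ℝ)) z := fun z hz => by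
    obtain ⟨L, hL⟩ := hequiv z hz
    exact ⟨L, hL, (hs.contDiffAt (isOpen_wedge.mem_nhds hz)).hasStrictFDerivAt' hL (by simp)⟩
  set Ξ : ℝ × ℝ → ℝ × ℝ := Function.invFunOn Ψ wedge with hΞ
  have hleft : LeftInvOn Ξ Ψ wedge := hbij.injOn.leftInvOn_invFunOn
  have hright : RightInvOn Ξ Ψ V := hbij.invOn_invFunOn.2
  have hmap : MapsTo Ξ V wedge := hbij.surjOn.mapsTo_invFunOn
  refine ⟨isOpen_wedge, ?_, hs, hbij.mapsTo, Ξ, ?_, hmap, hleft, hright⟩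
  · rw [isOpen_iff_mem_nhds]
    intro w hw
    obtain ⟨z, hz, rfl⟩ := hbij.surjOn hw
    obtain ⟨L, -, hL⟩ := hstrict z hz
    rw [← hL.map_nhds_eq_of_equiv]
    refine mem_map.2 (mem_of_superset (isOpen_wedge.mem_nhds hz) hbij.mapsTo)
  · intro w hw
    obtain ⟨z, hz, rfl⟩ := hbij.surjOn hw
    obtain ⟨L, hL, hL'⟩ := hstrict z hz
    have hcd := hs.contDiffAt (isOpen_wedge.mem_nhds hz)
    -- The global inverse coincides near each point with the smooth local inverse.
    have h3 := hL'.localInverse_unique (g := Ξ) (by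
      filter_upwards [isOpen_wedge.mem_nhds hz] with x hx
      exact hleft hx)
    exact ((hcd.to_localInverse hL (by simp)).congr_of_eventuallyEq h3).contDiffWithinAt

/-! ### Traces of the first derivatives. -/

/-- The polynomial of degree less than `n` with coefficients `b`. -/
def ofCoeffs (n : ℕ) (b : ℕ → ℝ) : Polynomial ℝ :=
  ∑ m ∈ Finset.range n, Polynomial.monomial m (b m)

theorem coeff_ofCoeffs (n : ℕ) (b : ℕ → ℝ) (m : ℕ) :
    (ofCoeffs n b).coeff m = if m < n then b m else 0 := by
  rw [ofCoeffs, Polynomial.finsetSum_coeff]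
  simp [Polynomial.coeff_monomial]

theorem degree_ofCoeffs_lt (n : ℕ) (b : ℕ → ℝ) : (ofCoeffs n b).degree < n := by
  rw [Polynomial.degree_lt_iff_coeff_zero]
  intro m hm
  rw [coeff_ofCoeffs, if_neg (by omega)]

theorem eval_ofCoeffs (n : ℕ) (b : ℕ → ℝ) (x : ℝ) :
    (ofCoeffs n b).eval x = ∑ m ∈ Finset.range n, b m * x ^ m := by
  rw [ofCoeffs, Polynomial.eval_finsetSum]
  simp [Polynomial.eval_monomial]

theorem abs_coeff_ofCoeffs_le {n : ℕ} {b : ℕ → ℝ} {M : ℝ} (hM : 0 ≤ M) (h : ∀ m < n, |b m| ≤ M)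
    (m : ℕ) : |(ofCoeffs n b).coeff m| ≤ M := by
  rw [coeff_ofCoeffs]
  split_ifs with hm
  · exact h m hm
  · rwa [abs_zero]

theorem norm_one_add_mul_I_pow_le {k m : ℕ} {ε : ℝ} (h : IsAdmissible k ε) (hm : m < 3 * k) :
    ‖(1 + ε * Complex.I : ℂ) ^ m‖ ≤ 8 ^ k := by
  have h1 : √(1 + ε ^ 2) ≤ 2 := by rw [← exp_logC]; exact exp_logC_le_two h
  rw [norm_pow, norm_one_add_mul_I]
  calc √(1 + ε ^ 2) ^ m ≤ 2 ^ m := by gcongr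
    _ ≤ 2 ^ (3 * k) := pow_le_pow_right₀ one_le_two hm.le
    _ = 8 ^ k := by rw [pow_mul]; norm_num

theorem abs_mul_coeff_le {ε c θ : ℝ} (hθ : |θ| ≤ 1) (hc : 1 ≤ c) (hε : ε = θ / c)
    (P : Polynomial ℝ) (m : ℕ) : |ε * (P.coeff m / (m + 1))| ≤ polyNorm P := by
  have h1 : |ε| ≤ 1 := by
    rw [hε, abs_div, abs_of_pos (by linarith : 0 < c)]
    exact div_le_one_of_le₀ (hθ.trans hc) (by linarith)
  rw [abs_mul, abs_div, abs_of_pos (by positivity : (0 : ℝ) < m + 1)]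
  refine (mul_le_of_le_one_left (by positivity) h1).trans ?_
  refine (div_le_self (abs_nonneg _) ?_).trans (abs_coeff_le_polyNorm P m)
  linarith [(Nat.cast_nonneg m : (0 : ℝ) ≤ m)]

section Traces

variable {k : ℕ} {ε : ℝ} {ζ : ℝ → ℝ}

/-- The polynomial part of `ε ∂_x` of the bulk polynomial on the upper edge. -/
def tracePolyX (k : ℕ) (ε : ℝ) (P : Polynomial ℝ) : Polynomial ℝ :=
  ofCoeffs (3 * k) fun m => ε * bulkCoeff ε P m * edgeIm ε m

/-- The polynomial part of `∂_y` of the bulk polynomial on the upper edge. -/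
def tracePolyY (k : ℕ) (ε : ℝ) (P : Polynomial ℝ) : Polynomial ℝ :=
  ofCoeffs (3 * k) fun m => ε * bulkCoeff ε P m * ((1 + ε * Complex.I) ^ m).re

theorem abs_mul_bulkCoeff_mul_le (h : IsAdmissible k ε) (P : Polynomial ℝ) {m : ℕ}
    (hm : m < 3 * k) {t : ℝ} (ht : |t| ≤ ‖(1 + ε * Complex.I : ℂ) ^ m‖) :
    |ε * bulkCoeff ε P m * t| ≤ 4 * 8 ^ k * polyNorm P := by
  have h1 := abs_mul_bulkCoeff_le h P hm
  have h2 := ht.trans (norm_one_add_mul_I_pow_le h hm)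
  have := polyNorm_nonneg P
  rw [abs_mul, abs_mul, abs_of_pos h.pos]
  calc _ ≤ 4 * polyNorm P * 8 ^ k := by gcongr
    _ = _ := by ring

theorem mul_cutBulkX_diag (h : IsAdmissible k ε) (P : Polynomial ℝ) {x : ℝ} (hx : 0 < x) :
    ε * cutBulkX ζ ε (3 * k) P (x, x) = ∑ m ∈ Finset.range (3 * k),
        ε / Real.exp (logC ε) * (P.coeff m / (m + 1)) *
          (deriv ζ (Real.exp (logC ε) * x) * x ^ (m + 1))
      + ζ (Real.exp (logC ε) * x) * (tracePolyX k ε P).eval x := by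
  have hc : √(1 + ε ^ 2) ≠ 0 := (by positivity : 0 < √(1 + ε ^ 2)).ne'
  rw [cutBulkX, radius_diag ε hx.le, bulk_diag h, bulkX_diag, tracePolyX, eval_ofCoeffs, exp_logC,
    mul_add, primitive, Finset.mul_sum, Finset.mul_sum, Finset.mul_sum, Finset.mul_sum,
    Finset.mul_sum]
  congr 1
  · refine Finset.sum_congr rfl fun m _ => ?_
    have := hx.ne'
    field_simp
  · refine Finset.sum_congr rfl fun m _ => ?_
    ring

theorem cutBulkY_diag (h : IsAdmissible k ε) (P : Polynomial ℝ) {x : ℝ} (hx : 0 < x) :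
    cutBulkY ζ ε (3 * k) P (x, x) = ∑ m ∈ Finset.range (3 * k),
        ε ^ 2 / Real.exp (logC ε) * (P.coeff m / (m + 1)) *
          (deriv ζ (Real.exp (logC ε) * x) * x ^ (m + 1))
      + ζ (Real.exp (logC ε) * x) * (tracePolyY k ε P).eval x := by
  have hc : √(1 + ε ^ 2) ≠ 0 := (by positivity : 0 < √(1 + ε ^ 2)).ne'
  rw [cutBulkY, radius_diag ε hx.le, bulk_diag h, bulkY_diag, tracePolyY, eval_ofCoeffs, exp_logC,
    primitive, Finset.mul_sum]
  congr 1
  refine Finset.sum_congr rfl fun m _ => ?_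
  have := hx.ne'
  field_simp

theorem IsUpperTrace.add {q q' : ℝ × ℝ → ℝ} {g g' : ℝ → ℝ} (h : IsUpperTrace q g)
    (h' : IsUpperTrace q' g') : IsUpperTrace (fun z => q z + q' z) (fun x => g x + g' x) :=
  fun x hx => (h x hx).add (h' x hx)

theorem IsUpperTrace.congr {q q' : ℝ × ℝ → ℝ} {g g' : ℝ → ℝ} (h : IsUpperTrace q g)
    (hq : ∀ z ∈ wedge, q z = q' z) (hg : ∀ x, 0 < x → g x = g' x) : IsUpperTrace q' g' :=
  fun x hx => by
    rw [← hg x hx]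
    refine (h x hx).congr' ?_
    filter_upwards [self_mem_nhdsWithin] with z hz
    exact hq z hz

theorem IsUpperTrace.of_continuousAt {q : ℝ × ℝ → ℝ} (h : ∀ x, 0 < x → ContinuousAt q (x, x)) :
    IsUpperTrace q fun x => q (x, x) :=
  fun x hx => (h x hx).tendsto.mono_left nhdsWithin_le_nhds

/-- The extension contributes functions with bounded multipliers, the cut-off polynomial contributes
a polynomial cut off at cx and terms with ζ'(cx). On the edge the polynomial equals the primitive of
P, so the terms with ζ' involve no 1/ε. -/
theorem exists_traces (hk : 1 ≤ k) (hζ : IsCutoff ζ) : ∃ C : ℝ, 0 < C ∧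
    ∀ (ε : ℝ) (f : ℝ → ℝ) (G : ℝ → ℝ → ℂ), IsEdgeData k ε f G → ∀ P : Polynomial ℝ,
      ∃ a b : ℝ → ℝ,
        IsUpperTrace (fun z => extensionX ε G z + cutBulkX ζ ε (3 * k) P z) a ∧
        IsUpperTrace (fun z => extensionY ε G z + cutBulkY ζ ε (3 * k) P z) b ∧
        xNorm ε ζ k (fun x => ε * a x) + xNorm ε ζ k b
          ≤ ENNReal.ofReal C * (dataNorm k ε G + ENNReal.ofReal (polyNorm P)) := by
  obtain ⟨C, hC, hx⟩ := exists_xNorm_trace_le hk hζ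
  refine ⟨2 * (C * (4 * 8 ^ k)), by positivity, fun ε f G h P => ?_⟩
  have hε := h.adm.pos
  have hε1 : ε ≤ 1 := by linarith [h.adm.lt_half]
  have hp := polyNorm_nonneg P
  set c := Real.exp (logC ε) with hc
  have hc1 : 1 ≤ c := Real.one_le_exp (logC_nonneg ε)
  have h8 : (1 : ℝ) ≤ 8 ^ k := one_le_pow₀ (by norm_num)
  have hM : polyNorm P ≤ 4 * 8 ^ k * polyNorm P := by nlinarith
  have hb : ∀ (g : ℝ → ℝ), (∀ β ∈ Icc (1 / 2 : ℝ) (3 * k + 1 / 2), ∃ T : ℝ → ℂ,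
      IsLaplaceOnLine (β - 1) (fun s => g (Real.exp s)) T ∧
        ∀ ξ, ‖T ξ‖ ≤ 20 * 8 ^ k * ‖G β ξ‖) → ∀ (θ : ℝ) (t : ℕ → ℝ), |θ| ≤ 1 →
      (∀ m, |t m| ≤ ‖(1 + ε * Complex.I : ℂ) ^ m‖) →
      xNorm ε ζ k (fun x => g x + (∑ m ∈ Finset.range (3 * k),
            θ / c * (P.coeff m / (m + 1)) * (deriv ζ (c * x) * x ^ (m + 1))
          + ζ (c * x) * (ofCoeffs (3 * k) fun m => ε * bulkCoeff ε P m * t m).eval x))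
        ≤ ENNReal.ofReal (C * (4 * 8 ^ k)) * (dataNorm k ε G + ENNReal.ofReal (polyNorm P)) := by
    intro g hg θ t hθ ht
    refine (hx ε f G h g hg (fun m => θ / c * (P.coeff m / (m + 1)))
      (ofCoeffs (3 * k) fun m => ε * bulkCoeff ε P m * t m) (4 * 8 ^ k * polyNorm P)
      (degree_ofCoeffs_lt _ _) (fun m _ => (abs_mul_coeff_le hθ hc1 rfl P m).trans hM)
      (abs_coeff_ofCoeffs_le (by positivity) fun m hm =>
        abs_mul_bulkCoeff_mul_le h.adm P hm (ht m))).trans ?_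
    rw [ENNReal.ofReal_mul hC.le, ENNReal.ofReal_mul (p := 4 * 8 ^ k) (by positivity), mul_assoc]
    refine mul_le_mul_right ?_ _
    rw [mul_add]
    refine add_le_add ?_ le_rfl
    refine le_mul_of_one_le_left' ?_
    rw [ENNReal.one_le_ofReal]
    linarith
  have hX := hb (fun x => ε * extensionX ε G (x, x)) (fun β hβ => h.exists_laplace_traceX hβ) ε
    (edgeIm ε) (by rwa [abs_of_pos hε]) fun m => Complex.abs_im_le_norm _
  have hY := hb (fun x => extensionY ε G (x, x)) (fun β hβ => h.exists_laplace_traceY hβ) (ε ^ 2)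
    (fun m => ((1 + ε * Complex.I) ^ m).re)
    (by rw [abs_of_pos (by positivity)]; exact pow_le_one₀ hε.le hε1)
    fun m => Complex.abs_re_le_norm _
  -- The trace a is written with ε⁻¹ in front so that εa simplifies to exactly the function
  -- estimated in `hX`, for all x and not only for x > 0.
  refine ⟨fun x => ε⁻¹ * (ε * extensionX ε G (x, x) + (∑ m ∈ Finset.range (3 * k),
      ε / c * (P.coeff m / (m + 1)) * (deriv ζ (c * x) * x ^ (m + 1))
      + ζ (c * x) * (tracePolyX k ε P).eval x)),
    fun x => extensionY ε G (x, x) + (∑ m ∈ Finset.range (3 * k),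
      ε ^ 2 / c * (P.coeff m / (m + 1)) * (deriv ζ (c * x) * x ^ (m + 1))
      + ζ (c * x) * (tracePolyY k ε P).eval x), ?_, ?_, ?_⟩
  · refine (h.isUpperTrace_extensionX.add (IsUpperTrace.of_continuousAt fun x hx =>
      continuousAt_cutBulkX hζ hε.ne' (3 * k) P hx)).congr (fun _ _ => rfl) fun x hx => ?_
    rw [← mul_cutBulkX_diag h.adm P hx, ← mul_add, inv_mul_cancel_left₀ hε.ne']
  · refine (h.isUpperTrace_extensionY.add (IsUpperTrace.of_continuousAt fun x hx =>
      continuousAt_cutBulkY hζ hε.ne' (3 * k) P hx)).congr (fun _ _ => rfl) fun x hx => ?_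
    rw [cutBulkY_diag h.adm P hx]
  · simp only [mul_inv_cancel_left₀ hε.ne']
    refine (add_le_add hX hY).trans (le_of_eq ?_)
    rw [← two_mul, ENNReal.ofReal_mul two_pos.le, ENNReal.ofReal_ofNat, mul_assoc]

end Traces

end Wedge

end

/-! ### Assembly of the lemma. -/

open Wedge

theorem lemma6p7 (k : ℕ) (hk : 1 ≤ k) (ζ : ℝ → ℝ) (hζ : Wedge.IsCutoff ζ) :
    ∃ C δ : ℝ, 0 < C ∧ 0 < δ ∧
      ∀ ε ∈ Set.Ioo (0 : ℝ) (Real.pi / (3 * (2 * k + 1))), ∀ φ : ℝ → ℝ,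
        Wedge.xNorm ε ζ k φ ≤ ENNReal.ofReal δ →
        ∃ (ψ ψ₀ : ℝ × ℝ → ℝ) (P : MvPolynomial (Fin 2) ℝ),
          -- the diffeomorphism, and the boundary values of the displacement
          Wedge.IsDiffeoOn (fun z => (z.1, z.2 + ψ z)) Wedge.wedge (Wedge.wedgeOf φ) ∧
          Wedge.IsLowerTrace ψ (fun _ => 0) ∧
          Wedge.IsUpperTrace ψ (fun x => ∫ s in (0 : ℝ)..x, φ s) ∧
          -- the decomposition, with ε-harmonic constituents
          (∀ z ∈ Wedge.wedge,
            ψ z = ψ₀ z + ζ (Wedge.radius ε z) * MvPolynomial.eval ![z.1, z.2] P) ∧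
          P.totalDegree ≤ 3 * k ∧
          Wedge.IsEpsHarmonicOn ε ψ₀ Wedge.wedge ∧
          Wedge.IsEpsHarmonicOn ε (fun z => MvPolynomial.eval ![z.1, z.2] P) Set.univ ∧
          -- the weighted bounds
          (⨆ ℓ ∈ Set.Icc (0 : ℝ) k,
              Wedge.stripNorm ε (3 * ℓ + 1 / 2) (3 * ℓ + 2) (ℓ + 1)
                (fun u v => ε * ψ₀ (Wedge.polar ε u v)))
            + ENNReal.ofReal (Wedge.polyNorm₂ P) ≤ ENNReal.ofReal C * Wedge.xNorm ε ζ k φ ∧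
          -- the traces of the first derivatives
          ∃ a b : ℝ → ℝ,
            Wedge.IsUpperTrace (fun z => deriv (fun x => ψ (x, z.2)) z.1) a ∧
            Wedge.IsUpperTrace (fun z => deriv (fun y => ψ (z.1, y)) z.2) b ∧
            Wedge.xNorm ε ζ k (fun x => ε * a x) + Wedge.xNorm ε ζ k b
              ≤ ENNReal.ofReal C * Wedge.xNorm ε ζ k φ := by
  obtain ⟨C₁, hC₁, hdata⟩ := exists_isEdgeData hk hζ
  obtain ⟨C₂, hC₂, hint⟩ := exists_wnorm_interpolation hk
  obtain ⟨C₃, hC₃, htr⟩ := exists_traces hk hζ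
  obtain ⟨C₄, hC₄, hY⟩ := exists_abs_cutBulkY_le hζ k
  have hinv : 0 ≤ invFreqNorm := ENNReal.toReal_nonneg
  have hkR : (1 : ℝ) ≤ k := by exact_mod_cast hk
  set S : ℝ := (3 * k + 3) * (30 * (3 * k + 8) ^ (4 * k + 1)) with hS
  have hS0 : 0 < S := by positivity
  set B : ℝ := (3 * k + 1) * (3 * k * (8 ^ k * 4)) with hB
  have hB0 : 0 < B := by positivity
  -- A is the constant in the bound of sup |ψ_y| by Aδ: the first summand comes from the extension
  -- on the line Re λ = 1, the second from the cut-off polynomial, where 2 is the loss in the choice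
  -- of P.
  set A : ℝ := 20 * (invFreqNorm * (C₂ * (6 * C₁))) + C₄ * 2 with hA
  have hA0 : 0 ≤ A := by positivity
  refine ⟨(S * (C₂ * (6 * C₁)) + B * 2) + C₃ * (6 * C₁ + 2), 1 / (2 * (A + 1)), by positivity,
    by positivity, fun ε hε φ hφ => ?_⟩
  set δ : ℝ := 1 / (2 * (A + 1)) with hδ
  have hδ0 : 0 < δ := by positivity
  have hadm : IsAdmissible k ε := ⟨hk, hε.1, hε.2⟩
  have hε0 := hadm.pos
  have hε1 : ε ≤ 1 := by linarith [hadm.lt_half]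
  set X := xNorm ε ζ k φ with hX
  have hXt : X ≠ ⊤ := ne_top_of_le_ne_top ENNReal.ofReal_ne_top hφ
  obtain ⟨P, hPd, hPX⟩ := exists_xNormOf_le hζ hk hXt
  have hpoly : ENNReal.ofReal (polyNorm P) ≤ ENNReal.ofReal 2 * X := by
    rw [ENNReal.ofReal_ofNat]
    exact (polyNorm_le_xNormOf ε ζ k φ P).trans hPX
  have hx0 := (xHom_le_xNormOf ε ζ (Nat.zero_le k) φ P).trans hPX
  have hxk := (xHom_le_xNormOf ε ζ le_rfl φ P).trans hPX
  have h2X : 2 * X ≠ ⊤ := ENNReal.mul_ne_top (by simp) hXt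
  obtain ⟨G, hG, hGn⟩ := hdata ε hadm φ P (ne_top_of_le_ne_top h2X hx0)
    (ne_top_of_le_ne_top h2X hxk)
  -- The 6 is 3 · 2: the polynomial and the two seminorms are each at most twice the norm of φ.
  have hD : dataNorm k ε G ≤ ENNReal.ofReal (6 * C₁) * X := by
    refine hGn.trans ?_
    rw [mul_comm 6 C₁, ENNReal.ofReal_mul hC₁.le, mul_assoc]
    gcongr
    rw [ENNReal.ofReal_ofNat] at hpoly ⊢
    refine (add_le_add (add_le_add hpoly hx0) hxk).trans (le_of_eq ?_)
    ring
  have hDt : dataNorm k ε G ≠ ⊤ :=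
    ne_top_of_le_ne_top (ENNReal.mul_ne_top ENNReal.ofReal_ne_top hXt) hD
  have hw : ∀ ℓ ∈ Set.Icc (0 : ℝ) k, wnorm (wt ε ℓ) (G (3 * ℓ + 1 / 2))
      ≤ ENNReal.ofReal (C₂ * (6 * C₁)) * X := fun ℓ hℓ => by
    refine (hint ε hε0 _ G hG.laplace ℓ hℓ).trans ?_
    rw [ENNReal.ofReal_mul hC₂.le, mul_assoc]
    gcongr
  have hpδ : polyNorm P ≤ 2 * δ := by
    rw [← ENNReal.ofReal_le_ofReal_iff (by positivity), ENNReal.ofReal_mul two_pos.le]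
    exact hpoly.trans (by gcongr)
  have hGδ : ∫ ξ, ‖G 1 ξ‖ ≤ invFreqNorm * (C₂ * (6 * C₁)) * δ := by
    -- The order ℓ = 1/6 corresponds to the line 3ℓ + 1/2 = 1, so non-integer orders are needed
    -- already for the diffeomorphism.
    have h1 := hw (1 / 6) ⟨by norm_num, by linarith⟩
    rw [show (3 * (1 / 6) + 1 / 2 : ℝ) = 1 by norm_num] at h1
    have h2 := ofReal_integral_norm_le hε0 hε1 (by norm_num : (0 : ℝ) ≤ 1 / 6)
      (hG.integrable 1 hG.one_mem).1
      (ne_top_of_le_ne_top (ENNReal.mul_ne_top ENNReal.ofReal_ne_top hXt) h1)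
    rw [← ENNReal.ofReal_le_ofReal_iff (by positivity), ENNReal.ofReal_mul (by positivity),
      ENNReal.ofReal_mul hinv, mul_assoc]
    refine h2.trans ?_
    gcongr
    exact h1.trans (by gcongr)
  have hsmall : ∀ z ∈ wedge, |extensionY ε G z + cutBulkY ζ ε (3 * k) P z| ≤ 1 / 2 := fun z hz => by
    have h1 := hG.abs_extensionY_le hz
    have h2 := hY ε hadm P z hz
    calc _ ≤ |extensionY ε G z| + |cutBulkY ζ ε (3 * k) P z| := abs_add_le _ _
      _ ≤ 20 * (invFreqNorm * (C₂ * (6 * C₁)) * δ) + C₄ * (2 * δ) := by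
        refine add_le_add (h1.trans (by linarith)) (h2.trans ?_)
        gcongr
      _ = A * δ := by rw [hA]; ring
      _ ≤ (A + 1) * δ := by linarith
      _ = 1 / 2 := by rw [hδ]; field_simp
  set ψ : ℝ × ℝ → ℝ := fun z => extension ε G z + cutBulk ζ ε (3 * k) P z with hψ
  have hfst : ∀ z ∈ wedge, HasDerivAt (fun x => ψ (x, z.2))
      (extensionX ε G z + cutBulkX ζ ε (3 * k) P z) z.1 := fun z hz =>
    (hG.hasDerivAt_extension_fst hz).add (hasDerivAt_cutBulk_fst hζ ε (3 * k) P hz.1 z.2)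
  have hsnd : ∀ z ∈ wedge, HasDerivAt (fun y => ψ (z.1, y))
      (extensionY ε G z + cutBulkY ζ ε (3 * k) P z) z.2 := fun z hz =>
    (hG.hasDerivAt_extension_snd hz).add (hasDerivAt_cutBulk_snd hζ ε (3 * k) P hz.1 z.2)
  have hlow : IsLowerTrace ψ fun _ => 0 := fun x hx => by
    have h1 := hG.isLowerTrace_extension x hx
    have h2 : Tendsto (cutBulk ζ ε (3 * k) P) (𝓝[wedge] (x, 0)) (𝓝 0) := by
      have := (continuous_cutBulk hζ hε0.ne' (3 * k) P).tendsto (x, 0)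
      rw [show cutBulk ζ ε (3 * k) P (x, 0) = 0 by rw [cutBulk, bulk_bottom, mul_zero]] at this
      exact this.mono_left nhdsWithin_le_nhds
    simpa using h1.add h2
  have hup : IsUpperTrace ψ fun x => ∫ s in (0 : ℝ)..x, φ s := by
    refine (hG.isUpperTrace_extension.add (IsUpperTrace.of_continuousAt fun x _ =>
      (continuous_cutBulk hζ hε0.ne' (3 * k) P).continuousAt)).congr (fun _ _ => rfl)
      fun x hx => ?_
    obtain ⟨h1, h2⟩ := hG.extension_upper (Real.log x)
    have h3 := integral_eq_integral_reducedData hζ (by omega) _ φ hPd h1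
    rw [Real.exp_log hx] at h2 h3
    rw [h2, h3, cutBulk, bulk_diag hadm, radius_diag ε hx.le, exp_logC]
  obtain ⟨a, b, ha, hb, hab⟩ := htr ε _ G hG P
  refine ⟨ψ, extension ε G, bulkPoly ε (3 * k) P, ?_, hlow, hup, fun z _ => ?_,
    totalDegree_bulkPoly_le ε (3 * k) P, hG.isEpsHarmonicOn_extension, ?_, ?_, a, b, ?_, ?_, ?_⟩
  · exact isDiffeoOn_shear (hG.isEpsHarmonicOn_extension.1.add
      (contDiffOn_cutBulk hζ hε0.ne' (3 * k) P)) hsnd hsmall hlow hup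
  · rw [eval_bulkPoly]
    rfl
  · simp only [eval_bulkPoly]
    exact isEpsHarmonicOn_bulk hε0.ne' (3 * k) P
  · have h1 : (⨆ ℓ ∈ Set.Icc (0 : ℝ) k, stripNorm ε (3 * ℓ + 1 / 2) (3 * ℓ + 2) (ℓ + 1)
        (fun u v => ε * extension ε G (polar ε u v)))
        ≤ ENNReal.ofReal (S * (C₂ * (6 * C₁))) * X := iSup₂_le fun ℓ hℓ => by
      refine (hG.stripNorm_le hℓ).trans ?_
      rw [ENNReal.ofReal_mul hS0.le, mul_assoc]
      gcongr
      exact hw ℓ hℓ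
    have h2 : ENNReal.ofReal (polyNorm₂ (bulkPoly ε (3 * k) P)) ≤ ENNReal.ofReal (B * 2) * X := by
      refine (ENNReal.ofReal_le_ofReal ((polyNorm₂_bulkPoly_le hadm P).trans_eq
        (show _ = B * polyNorm P by rw [hB]; ring))).trans ?_
      rw [ENNReal.ofReal_mul hB0.le, ENNReal.ofReal_mul hB0.le, mul_assoc]
      gcongr
    refine (add_le_add h1 h2).trans ?_
    rw [← add_mul, ← ENNReal.ofReal_add (by positivity) (by positivity)]
    refine mul_le_mul' (ENNReal.ofReal_le_ofReal ?_) le_rfl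
    have : 0 ≤ C₃ * (6 * C₁ + 2) := by positivity
    linarith
  · exact ha.congr (fun z hz => (hfst z hz).deriv.symm) fun _ _ => rfl
  · exact hb.congr (fun z hz => (hsnd z hz).deriv.symm) fun _ _ => rfl
  · refine hab.trans ?_
    have h1 : dataNorm k ε G + ENNReal.ofReal (polyNorm P) ≤ ENNReal.ofReal (6 * C₁ + 2) * X := by
      rw [ENNReal.ofReal_add (by positivity) two_pos.le, add_mul]
      exact add_le_add hD hpoly
    calc _ ≤ ENNReal.ofReal C₃ * (ENNReal.ofReal (6 * C₁ + 2) * X) := by gcongr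
      _ = ENNReal.ofReal (C₃ * (6 * C₁ + 2)) * X := by rw [ENNReal.ofReal_mul hC₃.le, mul_assoc]
      _ ≤ _ := by
        refine mul_le_mul' (ENNReal.ofReal_le_ofReal ?_) le_rfl
        have : 0 ≤ S * (C₂ * (6 * C₁)) + B * 2 := by positivity
        linarith
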